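/- For a finite set $\mathcal{M}$ of positive integers put $$S(\mathcal{M}) := \sum_{m,n\in\mathcal{M}} \sqrt{\frac{(m,n)}{[m,n]}},$$ where $(m,n)$ is the greatest common divisor and $[m,n]$ the least common multiple of $m$ and $n$. For an integer $D\ge 1$ let $\mathcal{T}_D$ be the set of all positive divisors of $D$, let $\tau(D)=|\mathcal{T}_D|$, and let $\mu$ be the Möbius function. For an integer $N\ge 1$ put $$\Gamma'(N) := \sup_{\tau(D)\le N} \frac{S(\mathcal{T}_D)}{N}, \qquad \Gamma''(N) := \sup_{\tau(D)\le N} \frac{\mu(D)^2 S(\mathcal{T}_D)}{N},$$ the suprema being over all integers $D\ge 1$ with $\tau(D)\le N$. Let $$B := 4\sqrt{\sum_{k\ge 1} \frac{1}{k^2(1+k)^2\log(1+1/k)}},$$ and write $\log_2 = \log\log$ and $\log_3 = \log\log\log$ for the iterated natural logarithms. **Theorem.** As the integer $N$ tends to infinity, $$\log\Gamma'(N) = B\sqrt{\frac{\log N}{\log_2 N}}\left\{1+O\left(\frac{\log_3 N}{\log_2 N}\right)\right\},$$ $$\log\Gamma''(N) = \frac{2}{\sqrt{\log 2}}\sqrt{\frac{\log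 N}{\log_2 N}}\left\{1+O\left(\frac{\log_3 N}{\log_2 N}\right)\right\}.$$ -/

import Mathlib

/-- The Gál sum `S_α(M) = ∑_{m, n ∈ M} (m, n)^α / [m, n]^α` of a finite set of integers,
where `(m, n)` is the gcd and `[m, n]` the lcm. -/
noncomputable def galSum (α : ℝ) (M : Finset ℕ) : ℝ :=
  ∑ m ∈ M, ∑ n ∈ M, (Nat.gcd m n : ℝ) ^ α / (Nat.lcm m n : ℝ) ^ α

/-- `Γ'(N)`: the supremum of `S_{1/2}(T_D) / N` over the integers `D ≥ 1` with `τ(D) ≤ N`,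
where `T_D = D.divisors` is the set of the divisors of `D` and `τ(D)` its cardinality. -/
noncomputable def gammaDiv (N : ℕ) : ℝ :=
  ⨆ D : {D : ℕ // 0 < D ∧ D.divisors.card ≤ N}, galSum (1 / 2) D.1.divisors / N

/-- `Γ''(N)`: the supremum of `μ(D)² S_{1/2}(T_D) / N` over the integers `D ≥ 1`
with `τ(D) ≤ N`. -/
noncomputable def gammaDivSqfree (N : ℕ) : ℝ :=
  ⨆ D : {D : ℕ // 0 < D ∧ D.divisors.card ≤ N},
    (ArithmeticFunction.moebius D.1 : ℝ) ^ 2 * galSum (1 / 2) D.1.divisors / N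

/-- The constant `B = 4 √(∑_{k ≥ 1} 1 / (k² (1 + k)² log (1 + 1/k)))`. -/
noncomputable def constB : ℝ :=
  4 * Real.sqrt (∑' k : ℕ+,
    1 / ((k : ℝ) ^ 2 * (1 + (k : ℝ)) ^ 2 * Real.log (1 + 1 / (k : ℝ))))

/-! Well-definedness: the two suprema are over nonempty bounded sets, and the series for `B`
converges. -/

theorem galSum_nonneg (α : ℝ) (M : Finset ℕ) : 0 ≤ galSum α M :=
  Finset.sum_nonneg fun _ _ => Finset.sum_nonneg fun _ _ => by positivity

theorem galSum_half_le (M : Finset ℕ) : galSum (1 / 2) M ≤ (M.card : ℝ) ^ 2 := by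
  have key : ∀ m n : ℕ, (Nat.gcd m n : ℝ) ^ (1 / 2 : ℝ) / (Nat.lcm m n : ℝ) ^ (1 / 2 : ℝ) ≤ 1 := by
    intro m n
    rcases Nat.eq_zero_or_pos (Nat.lcm m n) with h | h
    · simp [h]
    · refine div_le_one_of_le₀ (Real.rpow_le_rpow (by positivity) ?_ (by norm_num))
        (by positivity)
      exact_mod_cast Nat.le_of_dvd h ((Nat.gcd_dvd_left m n).trans (Nat.dvd_lcm_left m n))
  calc galSum (1 / 2) M ≤ ∑ m ∈ M, ∑ n ∈ M, (1 : ℝ) :=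
        Finset.sum_le_sum fun m _ => Finset.sum_le_sum fun n _ => key m n
    _ = (M.card : ℝ) ^ 2 := by simp [sq]

theorem nonempty_index {N : ℕ} (hN : 1 ≤ N) :
    Nonempty {D : ℕ // 0 < D ∧ D.divisors.card ≤ N} :=
  ⟨⟨1, Nat.one_pos, by simpa using hN⟩⟩

theorem galSum_div_le {N D : ℕ} (h : D.divisors.card ≤ N) :
    galSum (1 / 2) D.divisors / N ≤ (N : ℝ) ^ 2 / N := by
  have h' : (D.divisors.card : ℝ) ≤ N := by exact_mod_cast h
  have := galSum_half_le D.divisors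
  gcongr
  exact this.trans (by gcongr)

theorem bddAbove_gammaDiv (N : ℕ) :
    BddAbove (Set.range fun D : {D : ℕ // 0 < D ∧ D.divisors.card ≤ N} =>
      galSum (1 / 2) D.1.divisors / N) := by
  refine ⟨(N : ℝ) ^ 2 / N, ?_⟩
  rintro _ ⟨D, rfl⟩
  exact galSum_div_le D.2.2

theorem bddAbove_gammaDivSqfree (N : ℕ) :
    BddAbove (Set.range fun D : {D : ℕ // 0 < D ∧ D.divisors.card ≤ N} =>
      (ArithmeticFunction.moebius D.1 : ℝ) ^ 2 * galSum (1 / 2) D.1.divisors / N) := by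
  refine ⟨(N : ℝ) ^ 2 / N, ?_⟩
  rintro _ ⟨D, rfl⟩
  refine le_trans ?_ (galSum_div_le D.2.2)
  have h1 : (ArithmeticFunction.moebius D.1 : ℝ) ^ 2 ≤ 1 := by
    have h := ArithmeticFunction.abs_moebius_le_one (n := D.1)
    have h2 : |(ArithmeticFunction.moebius D.1 : ℝ)| ≤ 1 := by exact_mod_cast h
    exact (sq_le_one_iff_abs_le_one _).2 h2
  have h0 := galSum_nonneg (1 / 2) D.1.divisors
  have : (ArithmeticFunction.moebius D.1 : ℝ) ^ 2 * galSum (1 / 2) D.1.divisors ≤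
      galSum (1 / 2) D.1.divisors := mul_le_of_le_one_left h0 h1
  exact div_le_div_of_nonneg_right this (Nat.cast_nonneg N)

theorem summable_constB : Summable fun k : ℕ+ =>
    1 / ((k : ℝ) ^ 2 * (1 + (k : ℝ)) ^ 2 * Real.log (1 + 1 / (k : ℝ))) := by
  have hs : Summable fun k : ℕ+ => 1 / (k : ℝ) ^ 2 :=
    (Real.summable_one_div_nat_pow.2 (by norm_num : 1 < 2)).comp_injective
      PNat.coe_injective
  refine Summable.of_nonneg_of_le (fun k => ?_) (fun k => ?_) hs
  · have hk : (0 : ℝ) < k := by exact_mod_cast k.pos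
    have : 0 ≤ Real.log (1 + 1 / (k : ℝ)) := Real.log_nonneg (by simp)
    positivity
  · have hk : (0 : ℝ) < k := by exact_mod_cast k.pos
    have hl : 1 / (1 + (k : ℝ)) ≤ Real.log (1 + 1 / (k : ℝ)) := by
      have := Real.one_sub_inv_le_log_of_pos (x := 1 + 1 / (k : ℝ)) (by positivity)
      refine le_trans (le_of_eq ?_) this
      field_simp
      ring
    refine one_div_le_one_div_of_le (by positivity) ?_
    calc (k : ℝ) ^ 2 = (k : ℝ) ^ 2 * 1 := by ring
      _ ≤ (k : ℝ) ^ 2 * ((1 + (k : ℝ)) ^ 2 * (1 / (1 + (k : ℝ)))) := by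
        have : (1 + (k : ℝ)) ^ 2 * (1 / (1 + (k : ℝ))) = 1 + k := by field_simp
        rw [this]
        gcongr
        linarith
      _ ≤ (k : ℝ) ^ 2 * ((1 + (k : ℝ)) ^ 2 * Real.log (1 + 1 / (k : ℝ))) := by gcongr
      _ = _ := by ring

/-!
The Gál sum `S(T_D)` is multiplicative in `D`, and at a prime power
`S(T_{p^ν}) = (ν + 1) (1 + 2 ν / ((ν + 1) √p) + O(1/p))`. Hence, up to an error
`O(∑ p ∣ D, 1/p) = O(1 + log log N)` for `τ(D) ≤ N`, the logarithm of `S(T_D) / τ(D)` is the sum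
`linSum D` of `2 ν / ((ν + 1) √p)` over `p^ν ∥ D` (`abs_log_galSum_div_card_sub_linSum_le`,
`sum_one_div_primeFactors_le`). It is to be maximised under
the constraint `log τ(D) ≤ log N`, where `log τ(D)` is the sum of `log (ν + 1)`.

This is a separable problem: raising the exponent of `p` from `k - 1` to `k` gains
`2 / (k (k + 1) √p)` and costs `log (1 + 1/k)`, and the ratio of the two decreases in `k`. With the
Lagrange multiplier `2 / √x` the step pays exactly if `p ≤ x c_k²`, where
`c_k = 1 / (k (k + 1) log (1 + 1/k))`. Weak duality (`exists_linSum_le`) bounds `linSum D` by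
`(2 / √x) log τ(D)` plus the dual function `dualSum`, for each `x`; equality holds for the integers
that contain exactly the steps that pay (`linSum_levelInt`). The dual function is a combination of
the sums `∑ p ≤ y, (1/√p - 1/√y)`, which are asymptotic to `√y / log y` by the prime number theorem.
This gives `dualSum = 2 A (√x / log x) (1 + O(log log x / log x))`, where `A` is the sum of
`1 / (k² (k + 1)² log (1 + 1/k))` over the admissible exponents `k` (`exists_dualSum_bounds`).
Choosing `x = L log L / A` with `L = log N` yields the upper bound `4 √(A L / log L)`. For the lower
bound the level of an optimal integer whose divisors number about `N` need not be located: whatever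
it is, the inequality between the arithmetic and the geometric mean shows that the dual value is not
below the main term (`eventually_le_dual`). Since `S(T_D) / N` has the denominator `N` and not
`τ(D)`, the optimal integer is multiplied by new primes until `2 τ(D) > N`
(`exists_card_divisors_le`).

All of this is carried out for the integers whose exponents lie in a downward closed set `K`
(`exists_abs_log_sub_le`). The two assertions are the cases `K = ℕ`, where `4 √A` is `constB`, and
`K = {1}`, the squarefree integers, where `A = 1 / (4 log 2)`.

The relative error `O(log log x / log x)` requires a prime number theorem with a saving of one
logarithm. It is obtained from bounds for `(s - 1) ζ(s)` on `Re s ≥ 1` that are polynomial in `Im s`,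
from above (`exists_norm_riemannZeta₁_le`) and, by means of the `3-4-1` inequality, from below
(`exists_le_norm_riemannZeta₁`). They make `-ζ'/ζ - ζ` and its derivative `O(|s|^{1/2})`, so the
Perron integral with the weight `(1 - √(n/x))₊`, whose Mellin transform decays quadratically, can be
integrated by parts once on the line `Re w = 1/2 + 1/log x`
(`exists_abs_sum_vonMangoldt_sub_one_le`).
-/

/-! ### The function `(s - 1) ζ(s)` near the line `Re s = 1`: upper bounds -/

namespace GalDivisors

open Complex Filter Topology Asymptotics

/-- The general term of the expansion `(s - 1) ζ(s) = 1 + ∑ n, zetaTerm n s`: it is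
`(s - 1) ((n + 1)^{-s} - ∫ x in n + 1..n + 2, x^{-s})`, written without the integral so that it
is visibly entire. -/
noncomputable def zetaTerm (n : ℕ) (s : ℂ) : ℂ :=
  (s - 1) * ((n + 1 : ℕ) : ℂ) ^ (-s) + ((n + 2 : ℕ) : ℂ) ^ (1 - s) - ((n + 1 : ℕ) : ℂ) ^ (1 - s)

theorem differentiable_zetaTerm (n : ℕ) : Differentiable ℂ (zetaTerm n) := by
  have h1 : ((n + 1 : ℕ) : ℂ) ≠ 0 := by exact_mod_cast Nat.succ_ne_zero n
  have h2 : ((n + 2 : ℕ) : ℂ) ≠ 0 := by exact_mod_cast Nat.succ_ne_zero (n + 1)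
  unfold zetaTerm
  intro s
  refine ((DifferentiableAt.mul (by fun_prop) ?_).add ?_).sub ?_
  · exact DifferentiableAt.const_cpow (by fun_prop) (Or.inl h1)
  · exact DifferentiableAt.const_cpow (by fun_prop) (Or.inl h2)
  · exact DifferentiableAt.const_cpow (by fun_prop) (Or.inl h1)

theorem norm_ofReal_cpow_sub_le {a x : ℝ} (ha : 0 < a) (hx : a ≤ x) {s : ℂ} (hs : 0 < s.re) :
    ‖(x : ℂ) ^ (-s) - (a : ℂ) ^ (-s)‖ ≤ ‖s‖ * a ^ (-s.re - 1) * (x - a) := by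
  have hs0 : -s ≠ 0 := by
    intro h
    have := congrArg Complex.re h
    simp at this; linarith
  refine norm_image_sub_le_of_norm_deriv_le_segment' (f := fun y : ℝ => (y : ℂ) ^ (-s))
    (f' := fun y : ℝ => -s * (y : ℂ) ^ (-s - 1)) (a := a) (b := x) ?_ ?_ x ⟨hx, le_rfl⟩
  · intro y hy
    exact (hasDerivAt_ofReal_cpow_const (ha.trans_le hy.1).ne' hs0).hasDerivWithinAt
  · intro y hy
    rw [norm_mul, norm_neg, norm_cpow_eq_rpow_re_of_pos (ha.trans_le hy.1)]
    gcongr ‖s‖ * ?_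
    simp only [sub_re, neg_re, one_re]
    exact Real.rpow_le_rpow_of_nonpos ha hy.1 (by linarith)

theorem norm_zetaTerm_le_of_forall {n : ℕ} {s : ℂ} {C : ℝ} (hs1 : s ≠ 1)
    (h : ∀ x ∈ Set.Ico ((n : ℝ) + 1) (n + 2),
      ‖(x : ℂ) ^ (-s) - (((n : ℝ) + 1 : ℝ) : ℂ) ^ (-s)‖ ≤ C) :
    ‖zetaTerm n s‖ ≤ ‖s - 1‖ * C := by
  have h0 : (0 : ℝ) < n + 1 := by positivity
  have hs0 : 1 - s ≠ 0 := sub_ne_zero.2 (Ne.symm hs1)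
  have := norm_image_sub_le_of_norm_deriv_le_segment'
    (f := fun y : ℝ => (y : ℂ) ^ (1 - s) + (s - 1) * (((n : ℝ) + 1 : ℝ) : ℂ) ^ (-s) * y)
    (f' := fun y : ℝ => (1 - s) * (y : ℂ) ^ (1 - s - 1) +
      (s - 1) * (((n : ℝ) + 1 : ℝ) : ℂ) ^ (-s) * 1)
    (a := (n : ℝ) + 1) (b := n + 2) (C := ‖s - 1‖ * C) ?_ ?_ (n + 2) ⟨by linarith, le_rfl⟩
  · refine le_trans (le_of_eq ?_) (this.trans (le_of_eq ?_))
    · congr 1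
      unfold zetaTerm
      push_cast
      ring
    · ring
  · intro y hy
    have hy0 : y ≠ 0 := (h0.trans_le hy.1).ne'
    refine HasDerivAt.hasDerivWithinAt (HasDerivAt.add ?_ ?_)
    · exact hasDerivAt_ofReal_cpow_const hy0 hs0
    · exact (ofRealCLM.hasDerivAt (x := y)).const_mul _
  · intro y hy
    have e : (1 - s) * (y : ℂ) ^ (1 - s - 1) + (s - 1) * (((n : ℝ) + 1 : ℝ) : ℂ) ^ (-s) * 1 =
        (1 - s) * ((y : ℂ) ^ (-s) - (((n : ℝ) + 1 : ℝ) : ℂ) ^ (-s)) := by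
      rw [show 1 - s - 1 = -s by ring]; ring
    rw [e, norm_mul, norm_sub_rev 1 s]
    gcongr
    exact h y hy

theorem zetaTerm_one (n : ℕ) : zetaTerm n 1 = 0 := by simp [zetaTerm]

/-- Each term is `O(|s - 1| |s| n^{-σ - 1})` because `x ↦ x^{-s}` varies little, and trivially
`O(|s - 1| n^{-σ})`; a geometric mean of the two gives convergence slightly to the left of the line
`Re s = 1` together with a small power of `|s|`. -/
theorem norm_zetaTerm_le (n : ℕ) {s : ℂ} (hs : 0 < s.re) {θ : ℝ} (h0 : 0 ≤ θ) (h1 : θ ≤ 1) :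
    ‖zetaTerm n s‖ ≤ 2 * ‖s - 1‖ * ‖s‖ ^ θ * ((n : ℝ) + 1) ^ (-s.re - θ) := by
  rcases eq_or_ne s 1 with rfl | hs1
  · simp [zetaTerm_one]
  have ha : (0 : ℝ) < n + 1 := by positivity
  set a : ℝ := (n : ℝ) + 1 with ha'
  have hsn : 0 < ‖s‖ := norm_pos_iff.2 (by rintro rfl; simp at hs)
  have hB : ∀ x ∈ Set.Ico a (n + 2), ‖(x : ℂ) ^ (-s) - (a : ℂ) ^ (-s)‖ ≤
      2 * ‖s‖ ^ θ * a ^ (-s.re - θ) := by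
    intro x hx
    have hx0 : 0 < x := ha.trans_le hx.1
    have b1 : ‖(x : ℂ) ^ (-s) - (a : ℂ) ^ (-s)‖ ≤ ‖s‖ * a ^ (-s.re - 1) := by
      refine (norm_ofReal_cpow_sub_le ha hx.1 hs).trans ?_
      have : x - a ≤ 1 := by have := hx.2; rw [ha']; linarith
      exact mul_le_of_le_one_right (by positivity) this
    have b2 : ‖(x : ℂ) ^ (-s) - (a : ℂ) ^ (-s)‖ ≤ 2 * a ^ (-s.re) := by
      refine (norm_sub_le _ _).trans ?_
      rw [norm_cpow_eq_rpow_re_of_pos hx0, norm_cpow_eq_rpow_re_of_pos ha, neg_re]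
      have := Real.rpow_le_rpow_of_nonpos (z := -s.re) ha hx.1 (by linarith)
      linarith
    set X := ‖(x : ℂ) ^ (-s) - (a : ℂ) ^ (-s)‖
    have hX : 0 ≤ X := norm_nonneg _
    calc X = X ^ θ * X ^ (1 - θ) := by
          rw [← Real.rpow_add_of_nonneg hX h0 (by linarith)]; simp
      _ ≤ (‖s‖ * a ^ (-s.re - 1)) ^ θ * (2 * a ^ (-s.re)) ^ (1 - θ) := by
          have h1' : 0 ≤ 1 - θ := by linarith
          gcongr
      _ = ‖s‖ ^ θ * 2 ^ (1 - θ) * (a ^ ((-s.re - 1) * θ) * a ^ (-s.re * (1 - θ))) := by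
          rw [Real.mul_rpow (by positivity) (by positivity),
            Real.mul_rpow (by positivity) (by positivity), ← Real.rpow_mul ha.le,
            ← Real.rpow_mul ha.le]
          ring
      _ = ‖s‖ ^ θ * 2 ^ (1 - θ) * a ^ (-s.re - θ) := by
          rw [← Real.rpow_add ha]; ring_nf
      _ ≤ ‖s‖ ^ θ * 2 ^ (1 : ℝ) * a ^ (-s.re - θ) := by
          gcongr
          · norm_num
          · linarith
      _ = _ := by rw [Real.rpow_one]; ring
  refine (norm_zetaTerm_le_of_forall hs1 (C := 2 * ‖s‖ ^ θ * a ^ (-s.re - θ)) hB).trans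
    (le_of_eq ?_)
  ring

theorem summable_nat_add_one_rpow {p : ℝ} (hp : p < -1) :
    Summable fun n : ℕ => ((n : ℝ) + 1) ^ p := by
  have := (summable_nat_add_iff 1).2 (Real.summable_nat_rpow.2 hp)
  simpa using this

theorem hasSum_zetaTerm_of_one_lt_re {s : ℂ} (hs : 1 < s.re) :
    HasSum (fun n => zetaTerm n s) (riemannZeta₁ s - 1) := by
  have hs1 : s ≠ 1 := by rintro rfl; simp at hs
  have hz : Summable fun n : ℕ => 1 / ((n : ℂ) + 1) ^ s := by
    have := (summable_nat_add_iff 1).2 (Complex.summable_one_div_nat_cpow.2 hs)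
    simpa using this
  have hsum : HasSum (fun n : ℕ => (s - 1) * ((n + 1 : ℕ) : ℂ) ^ (-s))
      ((s - 1) * riemannZeta s) := by
    rw [zeta_eq_tsum_one_div_nat_add_one_cpow hs]
    refine (hz.hasSum.mul_left (s - 1)).congr_fun ?_
    intro n
    simp [cpow_neg]
  have hS : Summable fun n => zetaTerm n s := by
    refine Summable.of_norm_bounded (g := fun n : ℕ => 2 * ‖s - 1‖ * ‖s‖ ^ (1 : ℝ) *
      ((n : ℝ) + 1) ^ (-s.re - 1)) ?_
      (fun n => norm_zetaTerm_le n (by linarith) zero_le_one le_rfl)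
    exact (summable_nat_add_one_rpow (by linarith)).mul_left _
  have hlim : Tendsto (fun N : ℕ => ((N + 1 : ℕ) : ℂ) ^ (1 - s) - 1) atTop (𝓝 (0 - 1)) := by
    refine Tendsto.sub_const ?_ 1
    rw [tendsto_zero_iff_norm_tendsto_zero]
    have h1 : Tendsto (fun N : ℕ => ((N + 1 : ℕ) : ℝ) ^ (-(s.re - 1))) atTop (𝓝 0) :=
      (tendsto_rpow_neg_atTop (by linarith)).comp
        (tendsto_natCast_atTop_atTop.comp (tendsto_add_atTop_nat 1))
    refine h1.congr fun N => ?_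
    rw [show ((N + 1 : ℕ) : ℂ) = (((N + 1 : ℕ) : ℝ) : ℂ) by push_cast; ring,
      norm_cpow_eq_rpow_re_of_pos (by positivity)]
    congr 1
    simp
  have htel := hsum.tendsto_sum_nat.add hlim
  have e : (s - 1) * riemannZeta s + (0 - 1) = riemannZeta₁ s - 1 := by
    rw [riemannZeta_eq_inv_sub_mul hs1, ← mul_assoc, mul_inv_cancel₀ (sub_ne_zero.2 hs1)]
    ring
  rw [e] at htel
  refine (hS.hasSum_iff_tendsto_nat).2 (htel.congr fun N => ?_)
  simp only [zetaTerm, add_sub_assoc, Finset.sum_add_distrib]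
  congr 1
  rw [Finset.sum_range_sub (fun n : ℕ => ((n + 1 : ℕ) : ℂ) ^ (1 - s))]
  simp

theorem riemannZeta₁_eq_tsum {s : ℂ} (hs : 1 / 2 < s.re) :
    riemannZeta₁ s = 1 + ∑' n, zetaTerm n s := by
  set R : ℝ := ‖s‖ + 3
  set U : Set ℂ := {z | 1 / 2 < z.re} ∩ Metric.ball 0 R with hU
  have hUo : IsOpen U := (isOpen_lt continuous_const continuous_re).inter Metric.isOpen_ball
  have hUc : IsPreconnected U :=
    ((convex_halfSpace_re_gt (1 / 2)).inter (convex_ball 0 R)).isPreconnected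
  have hd : DifferentiableOn ℂ (fun z => ∑' n, zetaTerm n z) U := by
    refine differentiableOn_tsum_of_summable_norm
      (u := fun n : ℕ => 2 * (R + 1) * R * ((n : ℝ) + 1) ^ (-(3 / 2) : ℝ))
      ((summable_nat_add_one_rpow (by norm_num)).mul_left _)
      (fun n => (differentiable_zetaTerm n).differentiableOn) hUo ?_
    rintro n z ⟨hz1, hz2⟩
    have hz1' : 1 / 2 < z.re := hz1
    have hzR : ‖z‖ ≤ R := (mem_ball_zero_iff.1 hz2).le
    refine (norm_zetaTerm_le n (by linarith) zero_le_one le_rfl).trans ?_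
    rw [Real.rpow_one]
    have : ‖z - 1‖ ≤ R + 1 := (norm_sub_le _ _).trans (by simpa using hzR)
    gcongr
    · simp
    · linarith
  have hmem : (2 : ℂ) ∈ U := by
    refine ⟨by norm_num, ?_⟩
    have : 0 ≤ ‖s‖ := norm_nonneg s
    simp only [Metric.mem_ball, dist_zero_right, R]
    norm_num
    linarith
  have hEq : Set.EqOn riemannZeta₁ (fun z => 1 + ∑' n, zetaTerm n z) U := by
    refine AnalyticOnNhd.eqOn_of_preconnected_of_eventuallyEq
      (differentiable_riemannZeta₁.differentiableOn.analyticOnNhd hUo)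
      (((differentiableOn_const 1).add hd).analyticOnNhd hUo) hUc hmem ?_
    have : {z : ℂ | 1 < z.re} ∈ 𝓝 (2 : ℂ) :=
      (isOpen_lt continuous_const continuous_re).mem_nhds (by norm_num)
    filter_upwards [this] with z hz
    rw [(hasSum_zetaTerm_of_one_lt_re hz).tsum_eq]
    ring
  refine hEq ⟨hs, ?_⟩
  simp only [Metric.mem_ball, dist_zero_right, R]
  linarith

/-- Polynomial growth of `(s - 1) ζ(s)` with an exponent close to `1` slightly to the left of the
line `Re s = 1`. -/
theorem exists_norm_riemannZeta₁_le :
    ∃ C : ℝ, 0 < C ∧ ∀ s : ℂ, 39 / 40 ≤ s.re → s.re ≤ 3 →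
      ‖riemannZeta₁ s‖ ≤ C * (1 + |s.im|) ^ (21 / 20 : ℝ) := by
  have hsm : Summable fun n : ℕ => ((n : ℝ) + 1) ^ (-(41 / 40) : ℝ) :=
    summable_nat_add_one_rpow (by norm_num)
  set S := ∑' n : ℕ, ((n : ℝ) + 1) ^ (-(41 / 40) : ℝ)
  have hS : 0 ≤ S := tsum_nonneg fun n => by positivity
  refine ⟨1 + 2 * 2 * 3 * S, by positivity, fun s h1 h2 => ?_⟩
  rw [riemannZeta₁_eq_tsum (by linarith)]
  set m : ℝ := 1 + |s.im|
  have hm : 1 ≤ m := by simp [m]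
  have hm0 : 0 < m := by linarith
  have hn : ‖s‖ ≤ 3 * m := by
    refine (norm_le_abs_re_add_abs_im s).trans ?_
    rw [abs_of_nonneg (by linarith)]
    simp only [m]
    have := abs_nonneg s.im
    linarith
  have hn1 : ‖s - 1‖ ≤ 2 * m := by
    refine (norm_le_abs_re_add_abs_im _).trans ?_
    have h3 : |(s - 1).re| ≤ 2 := by
      rw [abs_le]; simp; constructor <;> linarith
    have h4 : |(s - 1).im| = |s.im| := by simp
    rw [h4]
    simp only [m]
    have := abs_nonneg s.im
    linarith
  have hts : ‖∑' n, zetaTerm n s‖ ≤ 2 * (2 * m) * (3 * m ^ (1 / 20 : ℝ)) * S := by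
    refine tsum_of_norm_bounded (hsm.hasSum.mul_left _) fun n => ?_
    refine (norm_zetaTerm_le n (by linarith) (θ := 1 / 20) (by norm_num) (by norm_num)).trans ?_
    have h5 : ‖s‖ ^ (1 / 20 : ℝ) ≤ 3 * m ^ (1 / 20 : ℝ) := by
      calc ‖s‖ ^ (1 / 20 : ℝ) ≤ (3 * m) ^ (1 / 20 : ℝ) := by gcongr
        _ = 3 ^ (1 / 20 : ℝ) * m ^ (1 / 20 : ℝ) := Real.mul_rpow (by norm_num) hm0.le
        _ ≤ 3 ^ (1 : ℝ) * m ^ (1 / 20 : ℝ) := by gcongr <;> norm_num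
        _ = _ := by rw [Real.rpow_one]
    gcongr
    · simp
    · linarith
  have hpow : m * m ^ (1 / 20 : ℝ) = m ^ (21 / 20 : ℝ) := by
    nth_rw 1 [← Real.rpow_one m]
    rw [← Real.rpow_add hm0]; norm_num
  have hone : 1 ≤ m ^ (21 / 20 : ℝ) := Real.one_le_rpow hm (by norm_num)
  calc ‖1 + ∑' n, zetaTerm n s‖ ≤ 1 + 2 * (2 * m) * (3 * m ^ (1 / 20 : ℝ)) * S := by
        refine (norm_add_le _ _).trans ?_
        rw [norm_one]
        gcongr
    _ = 1 + 2 * 2 * 3 * S * (m * m ^ (1 / 20 : ℝ)) := by ring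
    _ ≤ _ := by rw [hpow]; nlinarith

end GalDivisors

/-! ### Derivatives and lower bounds of `(s - 1) ζ(s)` -/

namespace GalDivisors

open Complex Filter Topology Asymptotics

theorem one_le_one_add_abs (t : ℝ) : 1 ≤ 1 + |t| := by simp

/-- Cauchy's estimates on discs of radius `1 / 40` transfer the growth of `(s - 1) ζ(s)` to its
first two derivatives on the strip `1 ≤ Re s ≤ 2`. -/
theorem exists_norm_iteratedDeriv_riemannZeta₁_le :
    ∃ C : ℝ, 1 ≤ C ∧ ∀ s : ℂ, 1 ≤ s.re → s.re ≤ 2 →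
      ‖riemannZeta₁ s‖ ≤ C * (1 + |s.im|) ^ (21 / 20 : ℝ) ∧
      ‖deriv riemannZeta₁ s‖ ≤ C * (1 + |s.im|) ^ (21 / 20 : ℝ) ∧
      ‖deriv (deriv riemannZeta₁) s‖ ≤ C * (1 + |s.im|) ^ (21 / 20 : ℝ) := by
  obtain ⟨C, hC, h⟩ := exists_norm_riemannZeta₁_le
  refine ⟨C * 4 * 3200 + 1, by nlinarith, fun s h1 h2 => ?_⟩
  set m : ℝ := 1 + |s.im|
  have hm : 1 ≤ m := one_le_one_add_abs _
  have hM : 0 ≤ m ^ (21 / 20 : ℝ) := by positivity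
  have hball : ∀ z ∈ Metric.sphere s (1 / 40), ‖riemannZeta₁ z‖ ≤ C * 4 * m ^ (21 / 20 : ℝ) := by
    intro z hz
    have hz' : ‖z - s‖ = 1 / 40 := by simpa [dist_eq_norm] using hz
    have hre := (abs_re_le_norm (z - s)).trans hz'.le
    have him := (abs_im_le_norm (z - s)).trans hz'.le
    rw [sub_re, abs_le] at hre
    rw [sub_im] at him
    have him' : |z.im| ≤ |s.im| + 1 := by
      have := abs_sub_abs_le_abs_sub z.im s.im
      linarith
    refine (h z (by linarith) (by linarith)).trans ?_
    have h3 : (1 + |z.im|) ^ (21 / 20 : ℝ) ≤ 4 * m ^ (21 / 20 : ℝ) := by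
      calc (1 + |z.im|) ^ (21 / 20 : ℝ) ≤ (2 * m) ^ (21 / 20 : ℝ) := by
            gcongr; simp only [m]; have := abs_nonneg s.im; linarith
        _ = 2 ^ (21 / 20 : ℝ) * m ^ (21 / 20 : ℝ) :=
            Real.mul_rpow (by norm_num) (by linarith)
        _ ≤ 2 ^ (2 : ℝ) * m ^ (21 / 20 : ℝ) := by gcongr <;> norm_num
        _ = _ := by norm_num
    calc C * (1 + |z.im|) ^ (21 / 20 : ℝ) ≤ C * (4 * m ^ (21 / 20 : ℝ)) := by gcongr
      _ = _ := by ring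
  have hd := differentiable_riemannZeta₁.diffContOnCl (s := Metric.ball s (1 / 40))
  have hk := fun k : ℕ => norm_iteratedDeriv_le_of_forall_mem_sphere_norm_le k
    (by norm_num : (0 : ℝ) < 1 / 40) hd hball
  have k0 := hk 0
  have k1 := hk 1
  have k2 := hk 2
  rw [iteratedDeriv_zero] at k0
  rw [iteratedDeriv_one] at k1
  rw [iteratedDeriv_succ, iteratedDeriv_one] at k2
  norm_num at k0 k1 k2
  have hCM : 0 ≤ C * m ^ (21 / 20 : ℝ) := by positivity
  refine ⟨?_, ?_, ?_⟩
  · linarith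
  · have : m ^ (21 / 20 : ℝ) * C * 4 * 40 ≤ (C * 4 * 3200 + 1) * m ^ (21 / 20 : ℝ) := by linarith
    linarith
  · have : m ^ (21 / 20 : ℝ) * C * 4 * 3200 ≤ (C * 4 * 3200 + 1) * m ^ (21 / 20 : ℝ) := by linarith
    linarith

theorem riemannZeta₁_ne_zero {s : ℂ} (hs : 1 ≤ s.re) : riemannZeta₁ s ≠ 0 := by
  rcases eq_or_ne s 1 with rfl | h
  · simp
  · intro h0
    exact riemannZeta_ne_zero_of_one_le_re hs (by rw [riemannZeta_eq_inv_sub_mul h, h0, mul_zero])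

theorem isCompact_strip : IsCompact (Set.Icc (1 : ℝ) 2 ×ℂ Set.Icc (-1 : ℝ) 1) :=
  isCompact_Icc.reProdIm isCompact_Icc

/-- The inequality `ζ(σ)³ |ζ(σ + iy)|⁴ |ζ(σ + 2iy)| ≥ 1` expressed through `(s - 1) ζ(s)`. -/
theorem riemannZeta₁_product_ge {x y : ℝ} (hx : 0 < x) (hy : y ≠ 0) :
    2 * x ^ 3 * |y| ^ 5 ≤ ‖riemannZeta₁ (1 + x)‖ ^ 3 * ‖riemannZeta₁ (1 + x + I * y)‖ ^ 4 *
      ‖riemannZeta₁ (1 + x + 2 * I * y)‖ := by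
  have key := DirichletCharacter.norm_LSeries_product_ge_one (1 : DirichletCharacter ℂ 1) hx y
  have hy0 : 0 < |y| := abs_pos.2 hy
  have hL : ∀ z : ℂ, 0 < z.re → LSeries (fun n : ℕ => (1 : DirichletCharacter ℂ 1) n) (1 + z) =
      z⁻¹ * riemannZeta₁ (1 + z) := by
    intro z hz
    rw [DirichletCharacter.LSeries_modOne_eq, LSeries_one_eq_riemannZeta (by simpa using hz),
      riemannZeta_eq_inv_sub_mul, add_sub_cancel_left]
    intro h
    have : z = 0 := by simpa using h
    simp [this] at hz
  rw [one_pow, add_assoc, add_assoc, hL _ (by simpa using hx), hL _ (by simpa using hx),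
    hL _ (by simpa using hx)] at key
  simp only [norm_mul, norm_pow, norm_inv] at key
  rw [add_assoc, add_assoc]
  have e1 : ‖(x : ℂ)‖ = x := by rw [norm_real, Real.norm_of_nonneg hx.le]
  have e2 : |y| ≤ ‖(x : ℂ) + I * y‖ := by
    simpa using abs_im_le_norm ((x : ℂ) + I * y)
  have e3 : 2 * |y| ≤ ‖(x : ℂ) + 2 * I * y‖ := by
    have := abs_im_le_norm ((x : ℂ) + 2 * I * y)
    simpa [abs_mul] using this
  rw [e1] at key
  set p := ‖riemannZeta₁ (1 + x)‖
  set q := ‖riemannZeta₁ (1 + (x + I * y))‖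
  set r := ‖riemannZeta₁ (1 + (x + 2 * I * y))‖
  have i2 : ‖(x : ℂ) + I * y‖⁻¹ ≤ |y|⁻¹ := inv_anti₀ hy0 e2
  have i3 : ‖(x : ℂ) + 2 * I * y‖⁻¹ ≤ (2 * |y|)⁻¹ := inv_anti₀ (by positivity) e3
  have : 1 ≤ (x⁻¹ * p) ^ 3 * (|y|⁻¹ * q) ^ 4 * ((2 * |y|)⁻¹ * r) := by
    refine le_trans key ?_
    gcongr
  have h2 : (x⁻¹ * p) ^ 3 * (|y|⁻¹ * q) ^ 4 * ((2 * |y|)⁻¹ * r) =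
      p ^ 3 * q ^ 4 * r / (2 * x ^ 3 * |y| ^ 5) := by
    field_simp
  rw [h2, le_div_iff₀ (by positivity)] at this
  linarith

/-- Polynomial lower bound for `(s - 1) ζ(s)` away from the real axis. The bound coming from the
`3-4-1` inequality degenerates as `Re s → 1`, so near that line it is carried over from
`Re s = 1 + a⁴` by means of the bound for the derivative. -/
theorem exists_le_norm_riemannZeta₁_of_one_le_abs_im :
    ∃ c : ℝ, 0 < c ∧ ∀ x y : ℝ, 0 < x → x ≤ 1 → 1 ≤ |y| →
      c * (1 + |y|) ^ (4 / 5 : ℝ) ≤ ‖riemannZeta₁ (1 + x + I * y)‖ := by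
  obtain ⟨C, hC1, hC⟩ := exists_norm_iteratedDeriv_riemannZeta₁_le
  have hC0 : 0 < C := by linarith
  -- the constant `c₁` balances the main term against the variation of `(s - 1) ζ(s)`
  obtain ⟨c₁, hc₁, hc₁', hc₁''⟩ : ∃ c₁ : ℝ, 0 < c₁ ∧ c₁ ≤ 1 ∧ 6 * C ^ 2 * c₁ ≤ 1 := by
    have h6 : 1 ≤ 6 * C ^ 2 := by nlinarith
    exact ⟨1 / (6 * C ^ 2), by positivity, by rw [div_le_one (by positivity)]; exact h6,
      by field_simp; exact le_rfl⟩
  refine ⟨c₁ ^ 3 / (6 * C), by positivity, fun x y hx hx1 hy => ?_⟩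
  set m : ℝ := 1 + |y| with hm_def
  have hm : 1 ≤ m := one_le_one_add_abs _
  have hm0 : 0 < m := by linarith
  -- in powers of `q` the growth exponent `21 / 20` is `m q⁴` and the target `4 / 5` is `m / q¹⁶`
  set q : ℝ := m ^ (1 / 80 : ℝ) with hq_def
  have hq : 1 ≤ q := Real.one_le_rpow hm (by norm_num)
  have hq0 : 0 < q := by linarith
  have hqpow : ∀ k : ℕ, q ^ k = m ^ ((k : ℝ) / 80) := by
    intro k
    rw [hq_def, ← Real.rpow_natCast, ← Real.rpow_mul hm0.le]
    ring_nf
  have hmq4 : m ^ (21 / 20 : ℝ) = m * q ^ 4 := by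
    rw [hqpow]
    nth_rw 2 [← Real.rpow_one m]
    rw [← Real.rpow_add hm0]; norm_num
  have hmq16 : m ^ (4 / 5 : ℝ) * q ^ 16 = m := by
    rw [hqpow, ← Real.rpow_add hm0]; norm_num
  have hy0 : y ≠ 0 := by rintro rfl; norm_num at hy
  -- the fourth root of the `3-4-1` inequality
  have fourth : ∀ u a : ℝ, 0 < u → u ≤ 1 → 0 ≤ a → a ^ 4 ≤ u →
      a ^ 3 * m / (3 * C * q) ≤ ‖riemannZeta₁ (1 + u + I * y)‖ := by
    intro u a hu hu1 ha hau
    have h1 := riemannZeta₁_product_ge hu hy0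
    have b1 : ‖riemannZeta₁ (1 + u)‖ ≤ C := by
      have := (hC (1 + u) (by simp [hu.le]) (by simp; linarith)).1
      simpa using this
    have b2 : ‖riemannZeta₁ (1 + u + 2 * I * y)‖ ≤ C * (4 * (m * q ^ 4)) := by
      refine (hC (1 + u + 2 * I * y) (by simp [hu.le]) (by simp; linarith)).1.trans ?_
      have : |(1 + (u : ℂ) + 2 * I * y).im| = 2 * |y| := by simp [abs_mul]
      rw [this, ← hmq4]
      gcongr C * ?_
      calc (1 + 2 * |y|) ^ (21 / 20 : ℝ) ≤ (2 * m) ^ (21 / 20 : ℝ) := by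
            gcongr; simp only [hm_def]; linarith
        _ = 2 ^ (21 / 20 : ℝ) * m ^ (21 / 20 : ℝ) := Real.mul_rpow (by norm_num) hm0.le
        _ ≤ 2 ^ (2 : ℝ) * m ^ (21 / 20 : ℝ) := by gcongr <;> norm_num
        _ = _ := by norm_num
    have hmy : m / 2 ≤ |y| := by simp only [hm_def]; linarith
    set X := ‖riemannZeta₁ (1 + u + I * y)‖
    have hX : 0 ≤ X := norm_nonneg _
    have h2 : 2 * (a ^ 4) ^ 3 * (m / 2) ^ 5 ≤ C ^ 3 * X ^ 4 * (C * (4 * (m * q ^ 4))) := by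
      calc 2 * (a ^ 4) ^ 3 * (m / 2) ^ 5 ≤ 2 * u ^ 3 * |y| ^ 5 := by gcongr
        _ ≤ _ := h1
        _ ≤ _ := by gcongr
    have h3 : (a ^ 3 * m) ^ 4 ≤ (3 * C * q * X) ^ 4 := by
      have h4 : m * (a ^ 3 * m) ^ 4 ≤ m * (64 * (C * q * X) ^ 4) := by
        nlinarith [h2]
      have h5 := le_of_mul_le_mul_left h4 hm0
      have h6 : 0 ≤ (C * q * X) ^ 4 := by positivity
      calc (a ^ 3 * m) ^ 4 ≤ 81 * (C * q * X) ^ 4 := by linarith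
        _ = _ := by ring
    have h7 := le_of_pow_le_pow_left₀ (by norm_num) (by positivity) h3
    rw [div_le_iff₀ (by positivity)]
    linarith
  set a : ℝ := c₁ / q ^ 5 with ha_def
  have ha : 0 < a := by positivity
  have ha1 : a ≤ 1 := by
    rw [ha_def, div_le_one (by positivity)]
    exact hc₁'.trans (one_le_pow₀ hq)
  have ha4 : a ^ 4 ≤ 1 := pow_le_one₀ ha.le ha1
  have main : a ^ 3 * m / (3 * C * q) = 2 * (c₁ ^ 3 / (6 * C) * m ^ (4 / 5 : ℝ)) := by
    have : m ^ (4 / 5 : ℝ) = m / q ^ 16 := by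
      rw [eq_div_iff (by positivity)]; exact hmq16
    rw [this, ha_def]
    field_simp
    ring
  have hpos : 0 ≤ c₁ ^ 3 / (6 * C) * m ^ (4 / 5 : ℝ) := by positivity
  rcases le_or_gt (a ^ 4) x with hxa | hxa
  · have := fourth x a hx hx1 ha.le hxa
    linarith
  -- for `x < a⁴` the bound at `a⁴` is moved to `x` by the mean value inequality
  · have h1 := fourth (a ^ 4) a (by positivity) ha4 ha.le le_rfl
    have h2 : ‖riemannZeta₁ (1 + x + I * y) - riemannZeta₁ (1 + (a ^ 4 : ℝ) + I * y)‖ ≤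
        C * (m * q ^ 4) * ‖(1 + x + I * y : ℂ) - (1 + (a ^ 4 : ℝ) + I * y)‖ := by
      have hconv : Convex ℝ {z : ℂ | 1 ≤ z.re ∧ z.re ≤ 2 ∧ z.im = y} := by
        have := ((convex_halfSpace_re_ge (1 : ℝ)).inter (convex_halfSpace_re_le (2 : ℝ))).inter
          (convex_halfSpace_im_le y) |>.inter (convex_halfSpace_im_ge y)
        convert this using 1
        ext z
        simp only [Set.mem_ofPred_eq, Set.mem_inter_iff]
        constructor
        · rintro ⟨p, q, r⟩; exact ⟨⟨⟨p, q⟩, r.le⟩, r.ge⟩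
        · rintro ⟨⟨⟨p, q⟩, r⟩, r'⟩; exact ⟨p, q, le_antisymm r r'⟩
      refine hconv.norm_image_sub_le_of_norm_deriv_le (𝕜 := ℂ)
        (fun z _ => differentiable_riemannZeta₁ z) ?_ ?_ ?_
      · rintro z ⟨z1, z2, z3⟩
        have := (hC z z1 z2).2.1
        rwa [z3, ← hm_def, hmq4] at this
      · have : 0 ≤ a ^ 4 := by positivity
        refine ⟨?_, ?_, ?_⟩ <;> simp [-ofReal_pow]
        · positivity
        · linarith
      · refine ⟨?_, ?_, ?_⟩ <;> simp
        · positivity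
        · linarith
    have h3 : ‖(1 + x + I * y : ℂ) - (1 + (a ^ 4 : ℝ) + I * y)‖ ≤ a ^ 4 := by
      have : (1 + x + I * y : ℂ) - (1 + (a ^ 4 : ℝ) + I * y) = ((x - a ^ 4 : ℝ) : ℂ) := by
        push_cast; ring
      rw [this, norm_real, Real.norm_eq_abs, abs_le]
      constructor <;> linarith
    have h4 : C * (m * q ^ 4) * a ^ 4 ≤ c₁ ^ 3 / (6 * C) * m ^ (4 / 5 : ℝ) := by
      have : m ^ (4 / 5 : ℝ) = m / q ^ 16 := by
        rw [eq_div_iff (by positivity)]; exact hmq16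
      rw [this, ha_def]
      have e : C * (m * q ^ 4) * (c₁ / q ^ 5) ^ 4 =
          (6 * C ^ 2 * c₁) * (c₁ ^ 3 / (6 * C) * (m / q ^ 16)) := by
        field_simp
      rw [e]
      exact mul_le_of_le_one_left (by positivity) hc₁''
    have h5 : ‖riemannZeta₁ (1 + (a ^ 4 : ℝ) + I * y)‖ - ‖riemannZeta₁ (1 + x + I * y)‖ ≤
        C * (m * q ^ 4) * a ^ 4 := by
      refine (norm_sub_norm_le _ _).trans ?_
      rw [norm_sub_rev]
      refine h2.trans ?_
      gcongr
    linarith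

/-- Polynomial lower bound for `(s - 1) ζ(s)`; near the real axis it holds by compactness. -/
theorem exists_le_norm_riemannZeta₁ :
    ∃ c : ℝ, 0 < c ∧ ∀ s : ℂ, 1 < s.re → s.re ≤ 2 →
      c * (1 + |s.im|) ^ (4 / 5 : ℝ) ≤ ‖riemannZeta₁ s‖ := by
  obtain ⟨c, hc, h⟩ := exists_le_norm_riemannZeta₁_of_one_le_abs_im
  obtain ⟨z, hz, hmin⟩ := isCompact_strip.exists_isMinOn
    (⟨1, by simp [mem_reProdIm]⟩ : (Set.Icc (1 : ℝ) 2 ×ℂ Set.Icc (-1 : ℝ) 1).Nonempty)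
    (f := fun s => ‖riemannZeta₁ s‖) differentiable_riemannZeta₁.continuous.norm.continuousOn
  have hz0 : 0 < ‖riemannZeta₁ z‖ := norm_pos_iff.2 (riemannZeta₁_ne_zero hz.1.1)
  refine ⟨min c (‖riemannZeta₁ z‖ / 2), by positivity, fun s h1 h2 => ?_⟩
  rcases le_or_gt 1 |s.im| with hs | hs
  · have := h (s.re - 1) s.im (by linarith) (by linarith) hs
    have e : (1 + (s.re - 1 : ℝ) + I * s.im : ℂ) = s := by
      apply Complex.ext <;> simp
    rw [e] at this
    refine le_trans ?_ this
    gcongr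
    exact min_le_left _ _
  · have hmem : s ∈ Set.Icc (1 : ℝ) 2 ×ℂ Set.Icc (-1 : ℝ) 1 := by
      rw [mem_reProdIm]
      exact ⟨⟨h1.le, h2⟩, abs_le.1 hs.le⟩
    have hle : ‖riemannZeta₁ z‖ ≤ ‖riemannZeta₁ s‖ := hmin hmem
    have hm : (1 + |s.im|) ^ (4 / 5 : ℝ) ≤ 2 := by
      calc (1 + |s.im|) ^ (4 / 5 : ℝ) ≤ 2 ^ (4 / 5 : ℝ) := by gcongr; linarith
        _ ≤ 2 ^ (1 : ℝ) := by gcongr <;> norm_num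
        _ = 2 := by norm_num
    calc min c (‖riemannZeta₁ z‖ / 2) * (1 + |s.im|) ^ (4 / 5 : ℝ)
        ≤ ‖riemannZeta₁ z‖ / 2 * 2 := by
          gcongr
          exact min_le_right _ _
      _ ≤ _ := by linarith

end GalDivisors

/-! ### The Dirichlet series of `Λ(n) - 1` -/

namespace GalDivisors

open Complex Filter Topology Asymptotics

/-- Growth of the entire function `ζ(s) - 1 / (s - 1)` and of its derivative. Away from the real axis
the bounds for `(s - 1) ζ(s)` are divided by `s - 1`; near it compactness suffices. -/
theorem exists_norm_riemannZeta₀_le :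
    ∃ C : ℝ, 1 ≤ C ∧ ∀ s : ℂ, 1 ≤ s.re → s.re ≤ 2 →
      ‖riemannZeta₀ s‖ ≤ C * (1 + |s.im|) ^ (1 / 20 : ℝ) ∧
      ‖deriv riemannZeta₀ s‖ ≤ C * (1 + |s.im|) ^ (1 / 20 : ℝ) := by
  obtain ⟨C, hC1, hC⟩ := exists_norm_iteratedDeriv_riemannZeta₁_le
  obtain ⟨A, hA⟩ := isCompact_strip.exists_bound_of_continuousOn
    differentiable_riemannZeta₀.continuous.continuousOn
  obtain ⟨A', hA'⟩ := isCompact_strip.exists_bound_of_continuousOn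
    differentiable_riemannZeta₀.deriv.continuous.continuousOn
  refine ⟨2 * (C + (2 * (C + 1))) + |A| + |A'|, ?_, fun s h1 h2 => ?_⟩
  · have := abs_nonneg A; have := abs_nonneg A'; linarith
  set m : ℝ := 1 + |s.im| with hm_def
  have hm : 1 ≤ m := one_le_one_add_abs _
  have hm0 : 0 < m := by linarith
  set q := m ^ (1 / 20 : ℝ) with hq
  have hq1 : 1 ≤ q := Real.one_le_rpow hm (by norm_num)
  have hmq : m ^ (21 / 20 : ℝ) = m * q := by
    rw [hq]
    nth_rw 2 [← Real.rpow_one m]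
    rw [← Real.rpow_add hm0]; norm_num
  have hA0 := abs_nonneg A
  have hA0' := abs_nonneg A'
  rcases le_or_gt 1 |s.im| with hs | hs
  · have hmq1 : 1 ≤ m * q := one_le_mul_of_one_le_of_one_le hm hq1
    obtain ⟨b0, b1, -⟩ := hC s h1 h2
    rw [← hm_def, hmq] at b0 b1
    have hs1 : |s.im| ≤ ‖s - 1‖ := by simpa using abs_im_le_norm (s - 1)
    have hms : m ≤ 2 * ‖s - 1‖ := by simp only [hm_def]; linarith
    have hpos : 0 < ‖s - 1‖ := by linarith
    have c0 : ‖riemannZeta₀ s‖ ≤ 2 * (C + 1) * q := by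
      have e : (s - 1) * riemannZeta₀ s = riemannZeta₁ s - 1 := by simp [riemannZeta₁]
      have : ‖s - 1‖ * ‖riemannZeta₀ s‖ ≤ ‖s - 1‖ * (2 * (C + 1) * q) := by
        rw [← norm_mul, e]
        refine (norm_sub_le _ _).trans ?_
        rw [norm_one]
        calc ‖riemannZeta₁ s‖ + 1 ≤ (C + 1) * q * m := by nlinarith
          _ ≤ (C + 1) * q * (2 * ‖s - 1‖) := by gcongr
          _ = _ := by ring
      exact le_of_mul_le_mul_left this hpos
    have c1 : ‖deriv riemannZeta₀ s‖ ≤ 2 * (C + 2 * (C + 1)) * q := by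
      have e : (s - 1) * deriv riemannZeta₀ s = deriv riemannZeta₁ s - riemannZeta₀ s := by
        have : HasDerivAt riemannZeta₁ (0 + (1 * riemannZeta₀ s + (s - 1) * deriv riemannZeta₀ s))
            s := by
          refine (hasDerivAt_const s 1).add (HasDerivAt.mul ?_ ?_)
          · exact (hasDerivAt_id s).sub_const 1
          · exact (differentiable_riemannZeta₀ s).hasDerivAt
        rw [this.deriv]; ring
      have : ‖s - 1‖ * ‖deriv riemannZeta₀ s‖ ≤ ‖s - 1‖ * (2 * (C + 2 * (C + 1)) * q) := by
        rw [← norm_mul, e]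
        refine (norm_sub_le _ _).trans ?_
        calc ‖deriv riemannZeta₁ s‖ + ‖riemannZeta₀ s‖ ≤ C * (m * q) + 2 * (C + 1) * q * m := by
              have : 2 * (C + 1) * q ≤ 2 * (C + 1) * q * m :=
                le_mul_of_one_le_right (by positivity) hm
              linarith
          _ = (C + 2 * (C + 1)) * q * m := by ring
          _ ≤ (C + 2 * (C + 1)) * q * (2 * ‖s - 1‖) := by gcongr
          _ = _ := by ring
      exact le_of_mul_le_mul_left this hpos
    constructor
    · refine c0.trans ?_
      gcongr
      linarith
    · refine c1.trans ?_
      gcongr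
      linarith
  · have hmem : s ∈ Set.Icc (1 : ℝ) 2 ×ℂ Set.Icc (-1 : ℝ) 1 := by
      rw [mem_reProdIm]
      exact ⟨⟨h1, h2⟩, abs_le.1 hs.le⟩
    have hD : 0 ≤ 2 * (C + (2 * (C + 1))) := by positivity
    constructor
    · calc ‖riemannZeta₀ s‖ ≤ A := hA s hmem
        _ ≤ (2 * (C + (2 * (C + 1))) + |A| + |A'|) * 1 := by linarith [le_abs_self A]
        _ ≤ _ := by gcongr
    · calc ‖deriv riemannZeta₀ s‖ ≤ A' := hA' s hmem
        _ ≤ (2 * (C + (2 * (C + 1))) + |A| + |A'|) * 1 := by linarith [le_abs_self A']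
        _ ≤ _ := by gcongr

/-- The function `-ζ'/ζ - ζ`, which has no singularity on `Re s ≥ 1`: the poles at `s = 1` cancel.
It is expressed through the entire functions `ζ(s) - 1 / (s - 1)` and `(s - 1) ζ(s)`. -/
noncomputable def lambdaSubOne (s : ℂ) : ℂ :=
  -(deriv riemannZeta₁ s / riemannZeta₁ s) - riemannZeta₀ s

/-- The derivative of `lambdaSubOne`. -/
noncomputable def derivLambdaSubOne (s : ℂ) : ℂ :=
  -((deriv (deriv riemannZeta₁) s * riemannZeta₁ s - deriv riemannZeta₁ s * deriv riemannZeta₁ s) /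
    riemannZeta₁ s ^ 2) - deriv riemannZeta₀ s

theorem hasDerivAt_lambdaSubOne {s : ℂ} (hs : 1 ≤ s.re) :
    HasDerivAt lambdaSubOne (derivLambdaSubOne s) s := by
  have h0 := riemannZeta₁_ne_zero hs
  exact (((differentiable_riemannZeta₁.deriv s).hasDerivAt.div
    (differentiable_riemannZeta₁ s).hasDerivAt h0).neg).sub
    (differentiable_riemannZeta₀ s).hasDerivAt

theorem continuousAt_derivLambdaSubOne {s : ℂ} (hs : 1 ≤ s.re) :
    ContinuousAt derivLambdaSubOne s := by
  have h0 : riemannZeta₁ s ^ 2 ≠ 0 := pow_ne_zero 2 (riemannZeta₁_ne_zero hs)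
  have c1 := differentiable_riemannZeta₁.continuous.continuousAt (x := s)
  have c2 := differentiable_riemannZeta₁.deriv.continuous.continuousAt (x := s)
  have c3 := differentiable_riemannZeta₁.deriv.deriv.continuous.continuousAt (x := s)
  have c4 := differentiable_riemannZeta₀.deriv.continuous.continuousAt (x := s)
  exact ((((c3.mul c1).sub (c2.mul c2)).div (c1.pow 2) h0).neg).sub c4

/-- Each quotient of a derivative of `(s - 1) ζ(s)` by the function itself costs the exponent
`21 / 20 - 4 / 5 = 1 / 4`, and the derivative of `lambdaSubOne` contains a product of two. -/
theorem exists_norm_lambdaSubOne_le :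
    ∃ C : ℝ, 0 < C ∧ ∀ s : ℂ, 1 < s.re → s.re ≤ 2 →
      ‖lambdaSubOne s‖ ≤ C * (1 + |s.im|) ^ (1 / 2 : ℝ) ∧
      ‖derivLambdaSubOne s‖ ≤ C * (1 + |s.im|) ^ (1 / 2 : ℝ) := by
  obtain ⟨C, hC1, hC⟩ := exists_norm_iteratedDeriv_riemannZeta₁_le
  obtain ⟨D, hD1, hD⟩ := exists_norm_riemannZeta₀_le
  obtain ⟨c, hc, hcb⟩ := exists_le_norm_riemannZeta₁
  refine ⟨C / c + 2 * (C / c) ^ 2 + C / c + D, by positivity, fun s h1 h2 => ?_⟩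
  obtain ⟨b0, b1, b2⟩ := hC s h1.le h2
  obtain ⟨d0, d1⟩ := hD s h1.le h2
  have hl := hcb s h1 h2
  set m : ℝ := 1 + |s.im| with hm_def
  have hm : 1 ≤ m := one_le_one_add_abs _
  have hm0 : 0 < m := by linarith
  have hZ : 0 < ‖riemannZeta₁ s‖ := lt_of_lt_of_le (by positivity) hl
  have hquot : ∀ w : ℂ, ‖w‖ ≤ C * m ^ (21 / 20 : ℝ) →
      ‖w‖ / ‖riemannZeta₁ s‖ ≤ C / c * m ^ (1 / 4 : ℝ) := by
    intro w hw
    calc ‖w‖ / ‖riemannZeta₁ s‖ ≤ C * m ^ (21 / 20 : ℝ) / (c * m ^ (4 / 5 : ℝ)) := by gcongr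
      _ = C / c * (m ^ (21 / 20 : ℝ) / m ^ (4 / 5 : ℝ)) := by
        field_simp
      _ = _ := by rw [← Real.rpow_sub hm0]; norm_num
  have q1 := hquot _ b1
  have q2 := hquot _ b2
  have hsq : m ^ (1 / 4 : ℝ) * m ^ (1 / 4 : ℝ) = m ^ (1 / 2 : ℝ) := by
    rw [← Real.rpow_add hm0]; norm_num
  have hle : m ^ (1 / 4 : ℝ) ≤ m ^ (1 / 2 : ℝ) :=
    Real.rpow_le_rpow_of_exponent_le hm (by norm_num)
  have hle' : m ^ (1 / 20 : ℝ) ≤ m ^ (1 / 2 : ℝ) :=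
    Real.rpow_le_rpow_of_exponent_le hm (by norm_num)
  have hCc : 0 < C / c := by positivity
  have hM : 0 < m ^ (1 / 2 : ℝ) := by positivity
  have p1 : C / c * m ^ (1 / 4 : ℝ) ≤ C / c * m ^ (1 / 2 : ℝ) := by gcongr
  have p2 : D * m ^ (1 / 20 : ℝ) ≤ D * m ^ (1 / 2 : ℝ) := by gcongr
  have p3 : 0 ≤ (C / c) ^ 2 * m ^ (1 / 2 : ℝ) := by positivity
  constructor
  · refine (norm_sub_le _ _).trans ?_
    rw [norm_neg, norm_div]
    nlinarith
  · refine (norm_sub_le _ _).trans ?_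
    rw [norm_neg]
    have e : (deriv (deriv riemannZeta₁) s * riemannZeta₁ s -
        deriv riemannZeta₁ s * deriv riemannZeta₁ s) / riemannZeta₁ s ^ 2 =
        deriv (deriv riemannZeta₁) s / riemannZeta₁ s - (deriv riemannZeta₁ s / riemannZeta₁ s) *
          (deriv riemannZeta₁ s / riemannZeta₁ s) := by
      have : riemannZeta₁ s ≠ 0 := norm_pos_iff.1 hZ
      field_simp
    rw [e]
    have q3 : ‖deriv riemannZeta₁ s‖ / ‖riemannZeta₁ s‖ * (‖deriv riemannZeta₁ s‖ /
        ‖riemannZeta₁ s‖) ≤ (C / c) ^ 2 * m ^ (1 / 2 : ℝ) := by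
      calc _ ≤ C / c * m ^ (1 / 4 : ℝ) * (C / c * m ^ (1 / 4 : ℝ)) := by gcongr
        _ = (C / c) ^ 2 * (m ^ (1 / 4 : ℝ) * m ^ (1 / 4 : ℝ)) := by ring
        _ = _ := by rw [hsq]
    have q4 := norm_sub_le (deriv (deriv riemannZeta₁) s / riemannZeta₁ s)
      ((deriv riemannZeta₁ s / riemannZeta₁ s) * (deriv riemannZeta₁ s / riemannZeta₁ s))
    rw [norm_mul, norm_div, norm_div] at q4
    nlinarith

open ArithmeticFunction in
theorem LSeries_vonMangoldt_sub_one {s : ℂ} (hs : 1 < s.re) :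
    LSeriesHasSum (fun n => (vonMangoldt n : ℂ) - 1) s (lambdaSubOne s) := by
  have hs1 : s ≠ 1 := by rintro rfl; simp at hs
  have h0 : s - 1 ≠ 0 := sub_ne_zero.2 hs1
  have hZ := riemannZeta₁_ne_zero hs.le
  have h1 : LSeriesHasSum (fun n => (vonMangoldt n : ℂ)) s (-deriv riemannZeta s / riemannZeta s) := by
    rw [← ArithmeticFunction.LSeries_vonMangoldt_eq_deriv_riemannZeta_div hs]
    exact (ArithmeticFunction.LSeriesSummable_vonMangoldt hs).LSeriesHasSum
  have h := h1.sub (LSeriesHasSum_one hs)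
  have e : -deriv riemannZeta s / riemannZeta s - riemannZeta s = lambdaSubOne s := by
    rw [deriv_riemannZeta_eq_neg_inv_sub_sq_mul_add hs1, lambdaSubOne]
    nth_rw 2 [riemannZeta_eq_inv_sub_add hs1]
    rw [riemannZeta_eq_inv_sub_mul hs1]
    field_simp
    ring
  rw [e] at h
  exact h

end GalDivisors

/-! ### Mellin transform of the weight `(1 - √y)₊` -/

namespace GalDivisors

open Complex Filter Topology Asymptotics MeasureTheory

/-- The weight `(1 - √y)₊` on the positive half-line, as a difference of two functions whose Mellin
transforms are in Mathlib. -/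
noncomputable def rieszWeight (y : ℝ) : ℂ :=
  (Set.Ioc (0 : ℝ) 1).indicator (fun _ => (1 : ℂ)) y -
    (Set.Ioc (0 : ℝ) 1).indicator (fun t => (t : ℂ) ^ (1 / 2 : ℂ)) y

/-- The Mellin transform of `rieszWeight`. -/
noncomputable def rieszMellin (w : ℂ) : ℂ := 1 / w - 1 / (w + 1 / 2)

theorem hasMellin_rieszWeight {w : ℂ} (hw : 0 < w.re) :
    HasMellin rieszWeight w (rieszMellin w) := by
  have h1 := hasMellin_one_Ioc hw
  have h2 := hasMellin_cpow_Ioc (1 / 2) (s := w) (by norm_num; linarith)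
  have h := hasMellin_sub h1.1 h2.1
  rw [h1.2, h2.2] at h
  exact h

theorem rieszWeight_of_pos {y : ℝ} (hy : 0 < y) :
    rieszWeight y = ((max 0 (1 - √y) : ℝ) : ℂ) := by
  unfold rieszWeight
  rcases le_or_gt y 1 with h | h
  · have hm : y ∈ Set.Ioc (0 : ℝ) 1 := ⟨hy, h⟩
    rw [Set.indicator_of_mem hm, Set.indicator_of_mem hm,
      max_eq_right (by rw [sub_nonneg]; exact Real.sqrt_le_one.2 h), Real.sqrt_eq_rpow,
      ofReal_sub, ofReal_cpow hy.le]
    norm_num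
  · have hm : y ∉ Set.Ioc (0 : ℝ) 1 := fun hh => absurd hh.2 (not_le.2 h)
    rw [Set.indicator_of_notMem hm, Set.indicator_of_notMem hm, max_eq_left]
    · simp
    · rw [sub_nonpos]; exact (Real.one_le_sqrt).2 h.le

theorem continuousAt_rieszWeight {y : ℝ} (hy : 0 < y) : ContinuousAt rieszWeight y := by
  have : ContinuousAt (fun y : ℝ => ((max 0 (1 - √y) : ℝ) : ℂ)) y := by
    refine Continuous.continuousAt ?_
    fun_prop
  refine this.congr ?_
  filter_upwards [lt_mem_nhds hy] with z hz
  exact (rieszWeight_of_pos hz).symm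

theorem ne_zero_of_half_le_re {w : ℂ} (hw : 1 / 2 ≤ w.re) : w ≠ 0 := by
  rintro rfl
  norm_num at hw

theorem one_add_abs_im_le_norm {w : ℂ} (hw : 1 / 2 ≤ w.re) : (1 + |w.im|) / 4 ≤ ‖w‖ := by
  have h1 := abs_im_le_norm w
  have h2 := re_le_norm w
  rcases le_or_gt |w.im| 1 with h | h <;> linarith

theorem norm_inv_sq_le {w : ℂ} (hw : 1 / 2 ≤ w.re) {m : ℝ} (hm : m = 1 + |w.im|) :
    ‖(w ^ 2)⁻¹‖ ≤ 16 * m ^ (-2 : ℝ) := by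
  have h1 := one_add_abs_im_le_norm hw
  have hm1 := one_le_one_add_abs w.im
  rw [← hm] at h1 hm1
  have hm0 : 0 < m := by linarith
  rw [norm_inv, norm_pow, Real.rpow_neg hm0.le, Real.rpow_two]
  calc (‖w‖ ^ 2)⁻¹ ≤ ((m / 4) ^ 2)⁻¹ := by gcongr
    _ = _ := by field_simp; norm_num

theorem norm_rieszMellin_le {w : ℂ} (hw : 1 / 2 ≤ w.re) :
    ‖rieszMellin w‖ ≤ 16 * (1 + |w.im|) ^ (-2 : ℝ) := by
  have h0 := ne_zero_of_half_le_re hw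
  have hw' : 1 / 2 ≤ (w + 1 / 2).re := by norm_num; linarith
  have h0' := ne_zero_of_half_le_re hw'
  have e : rieszMellin w = (1 / 2) * w⁻¹ * (w + 1 / 2)⁻¹ := by
    rw [rieszMellin, div_sub_div _ _ h0 h0', div_eq_mul_inv, mul_inv]
    ring
  have h1 : ‖w‖ ≤ ‖w + 1 / 2‖ := by
    rw [Complex.norm_def, Complex.norm_def]
    refine Real.sqrt_le_sqrt ?_
    rw [normSq_apply, normSq_apply]
    norm_num
    nlinarith
  rw [e]
  refine le_trans ?_ (norm_inv_sq_le hw rfl)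
  rw [norm_mul, norm_mul, norm_inv, norm_inv, norm_inv, norm_pow, sq, mul_inv]
  have : ‖w + 1 / 2‖⁻¹ ≤ ‖w‖⁻¹ := inv_anti₀ (norm_pos_iff.2 h0) h1
  have h2 : ‖(1 / 2 : ℂ)‖ ≤ 1 := by norm_num
  calc ‖(1 / 2 : ℂ)‖ * ‖w‖⁻¹ * ‖w + 1 / 2‖⁻¹ ≤ 1 * ‖w‖⁻¹ * ‖w‖⁻¹ := by gcongr
    _ = _ := by ring

/-- The derivative of `rieszMellin`. -/
noncomputable def derivRieszMellin (w : ℂ) : ℂ := -(w ^ 2)⁻¹ + ((w + 1 / 2) ^ 2)⁻¹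

theorem hasDerivAt_rieszMellin {w : ℂ} (hw : 1 / 2 ≤ w.re) :
    HasDerivAt rieszMellin (derivRieszMellin w) w := by
  have h0 := ne_zero_of_half_le_re hw
  have hw' : 1 / 2 ≤ (w + 1 / 2).re := by norm_num; linarith
  have h0' := ne_zero_of_half_le_re hw'
  have h1 := hasDerivAt_inv h0
  have h2 := ((hasDerivAt_id w).add_const (1 / 2 : ℂ)).inv h0'
  have h := h1.sub h2
  have e : rieszMellin = (fun w => w⁻¹) - fun w => (id w + 1 / 2)⁻¹ := by
    funext z; simp [rieszMellin]
  rw [e]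
  refine h.congr_deriv ?_
  simp [derivRieszMellin]
  ring

theorem norm_derivRieszMellin_le {w : ℂ} (hw : 1 / 2 ≤ w.re) :
    ‖derivRieszMellin w‖ ≤ 32 * (1 + |w.im|) ^ (-2 : ℝ) := by
  have hw' : 1 / 2 ≤ (w + 1 / 2).re := by norm_num; linarith
  have him : (w + 1 / 2).im = w.im := by simp
  refine (norm_add_le _ _).trans ?_
  rw [norm_neg]
  have h1 := norm_inv_sq_le hw rfl
  have h2 := norm_inv_sq_le hw' (m := 1 + |w.im|) (by rw [him])
  linarith

/-- The integrand of the Perron formula on the line `Re w = c`, without the factor `x ^ w`. -/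
noncomputable def perronFun (c : ℝ) (t : ℝ) : ℂ :=
  rieszMellin (c + t * I) * lambdaSubOne (c + t * I + 1 / 2)

/-- The derivative of `perronFun c`. -/
noncomputable def derivPerronFun (c : ℝ) (t : ℝ) : ℂ :=
  I * (derivRieszMellin (c + t * I) * lambdaSubOne (c + t * I + 1 / 2) +
    rieszMellin (c + t * I) * derivLambdaSubOne (c + t * I + 1 / 2))

theorem hasDerivAt_perronFun {c : ℝ} (hc : 1 / 2 < c) (t : ℝ) :
    HasDerivAt (perronFun c) (derivPerronFun c t) t := by
  have h0 : HasDerivAt (fun t : ℝ => (c : ℂ) + t * I) I t := by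
    have := (ofRealCLM.hasDerivAt (x := t)).mul_const I
    simpa using this.const_add (c : ℂ)
  have h1 : HasDerivAt (fun t : ℝ => rieszMellin (c + t * I))
      (derivRieszMellin (c + t * I) * I) t :=
    HasDerivAt.comp (h₂ := rieszMellin) t
      (hasDerivAt_rieszMellin (w := c + t * I) (by simp; norm_num at hc; linarith)) h0
  have h2 : HasDerivAt (fun t : ℝ => lambdaSubOne (c + t * I + 1 / 2))
      (derivLambdaSubOne (c + t * I + 1 / 2) * I) t :=
    HasDerivAt.comp (h₂ := lambdaSubOne) t
      (hasDerivAt_lambdaSubOne (s := c + t * I + 1 / 2) (by norm_num; linarith)) (h0.add_const _)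
  refine (h1.mul h2).congr_deriv ?_
  rw [derivPerronFun]
  ring

theorem continuous_derivPerronFun {c : ℝ} (hc : 1 / 2 < c) : Continuous (derivPerronFun c) := by
  rw [continuous_iff_continuousAt]
  intro t
  have h0 : Continuous fun t : ℝ => (c : ℂ) + t * I := by fun_prop
  have hw : 1 / 2 ≤ ((c : ℂ) + t * I).re := by simp; norm_num at hc; linarith
  have hs : 1 ≤ ((c : ℂ) + t * I + 1 / 2).re := by norm_num; linarith
  have n0 := ne_zero_of_half_le_re hw
  have n1 : (c : ℂ) + t * I + 1 / 2 ≠ 0 := by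
    intro h; rw [h] at hs; norm_num at hs
  have c1 : ContinuousAt (fun t : ℝ => derivRieszMellin (c + t * I)) t := by
    refine ContinuousAt.comp (g := derivRieszMellin) (f := fun t : ℝ => (c : ℂ) + t * I) ?_
      h0.continuousAt
    unfold derivRieszMellin
    refine ContinuousAt.add (ContinuousAt.neg (ContinuousAt.inv₀ (by fun_prop) (pow_ne_zero 2 n0)))
      (ContinuousAt.inv₀ (by fun_prop) (pow_ne_zero 2 n1))
  have c2 : ContinuousAt (fun t : ℝ => rieszMellin (c + t * I)) t :=
    ContinuousAt.comp (g := rieszMellin) (f := fun t : ℝ => (c : ℂ) + t * I)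
      (hasDerivAt_rieszMellin hw).continuousAt h0.continuousAt
  have c3 : ContinuousAt (fun t : ℝ => lambdaSubOne (c + t * I + 1 / 2)) t :=
    ContinuousAt.comp (g := lambdaSubOne) (f := fun t : ℝ => (c : ℂ) + t * I + 1 / 2)
      (hasDerivAt_lambdaSubOne hs).continuousAt (h0.add continuous_const).continuousAt
  have c4 : ContinuousAt (fun t : ℝ => derivLambdaSubOne (c + t * I + 1 / 2)) t :=
    ContinuousAt.comp (g := derivLambdaSubOne) (f := fun t : ℝ => (c : ℂ) + t * I + 1 / 2)
      (continuousAt_derivLambdaSubOne hs) (h0.add continuous_const).continuousAt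
  exact continuousAt_const.mul ((c1.mul c3).add (c2.mul c4))

/-- The quadratic decay of the Mellin transform beats the growth of `lambdaSubOne`, uniformly up to
the line `Re w = 1 / 2`. -/
theorem exists_norm_perronFun_le :
    ∃ C : ℝ, 0 < C ∧ ∀ c t : ℝ, 1 / 2 < c → c ≤ 3 / 2 →
      ‖perronFun c t‖ ≤ C * (1 + ‖t‖) ^ (-(3 / 2) : ℝ) ∧
      ‖derivPerronFun c t‖ ≤ C * (1 + ‖t‖) ^ (-(3 / 2) : ℝ) := by
  obtain ⟨C, hC, h⟩ := exists_norm_lambdaSubOne_le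
  refine ⟨48 * C, by positivity, fun c t h1 h2 => ?_⟩
  have hw : 1 / 2 ≤ ((c : ℂ) + t * I).re := by simp; norm_num at h1; linarith
  obtain ⟨l0, l1⟩ := h (c + t * I + 1 / 2) (by norm_num; linarith) (by norm_num; linarith)
  have k0 := norm_rieszMellin_le hw
  have k1 := norm_derivRieszMellin_le hw
  have im0 : ((c : ℂ) + t * I).im = t := by simp
  have im1 : ((c : ℂ) + t * I + 1 / 2).im = t := by simp
  rw [im1] at l0 l1
  rw [im0] at k0 k1
  rw [Real.norm_eq_abs]
  set m := 1 + |t|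
  have hm0 : 0 < m := by have := one_le_one_add_abs t; linarith
  have hmul : m ^ (-2 : ℝ) * m ^ (1 / 2 : ℝ) = m ^ (-(3 / 2) : ℝ) := by
    rw [← Real.rpow_add hm0]; norm_num
  have hp : 0 < m ^ (-(3 / 2) : ℝ) := by positivity
  have a00 : ‖rieszMellin (c + t * I)‖ * ‖lambdaSubOne (c + t * I + 1 / 2)‖ ≤
      16 * C * m ^ (-(3 / 2) : ℝ) := by
    calc _ ≤ 16 * m ^ (-2 : ℝ) * (C * m ^ (1 / 2 : ℝ)) := by gcongr
      _ = _ := by rw [← hmul]; ring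
  have a10 : ‖derivRieszMellin (c + t * I)‖ * ‖lambdaSubOne (c + t * I + 1 / 2)‖ ≤
      32 * C * m ^ (-(3 / 2) : ℝ) := by
    calc _ ≤ 32 * m ^ (-2 : ℝ) * (C * m ^ (1 / 2 : ℝ)) := by gcongr
      _ = _ := by rw [← hmul]; ring
  have a01 : ‖rieszMellin (c + t * I)‖ * ‖derivLambdaSubOne (c + t * I + 1 / 2)‖ ≤
      16 * C * m ^ (-(3 / 2) : ℝ) := by
    calc _ ≤ 16 * m ^ (-2 : ℝ) * (C * m ^ (1 / 2 : ℝ)) := by gcongr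
      _ = _ := by rw [← hmul]; ring
  have hCp : 0 < C * m ^ (-(3 / 2) : ℝ) := by positivity
  constructor
  · rw [perronFun, norm_mul]
    linarith
  · rw [derivPerronFun, norm_mul, norm_I, one_mul]
    refine (norm_add_le _ _).trans ?_
    rw [norm_mul, norm_mul]
    linarith

theorem integrable_one_add_norm_rpow :
    Integrable fun t : ℝ => (1 + ‖t‖) ^ (-(3 / 2) : ℝ) :=
  integrable_one_add_norm (by norm_num)

theorem continuous_perronFun {c : ℝ} (hc : 1 / 2 < c) : Continuous (perronFun c) :=
  continuous_iff_continuousAt.2 fun t => (hasDerivAt_perronFun hc t).continuousAt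

theorem integrable_perronFun {c : ℝ} (h1 : 1 / 2 < c) (h2 : c ≤ 3 / 2) :
    Integrable (perronFun c) := by
  obtain ⟨C, -, h⟩ := exists_norm_perronFun_le
  exact (integrable_one_add_norm_rpow.const_mul C).mono'
    (continuous_perronFun h1).aestronglyMeasurable
    (Eventually.of_forall fun t => (h c t h1 h2).1)

theorem integrable_derivPerronFun {c : ℝ} (h1 : 1 / 2 < c) (h2 : c ≤ 3 / 2) :
    Integrable (derivPerronFun c) := by
  obtain ⟨C, -, h⟩ := exists_norm_perronFun_le
  exact (integrable_one_add_norm_rpow.const_mul C).mono'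
    (continuous_derivPerronFun h1).aestronglyMeasurable
    (Eventually.of_forall fun t => (h c t h1 h2).2)

theorem continuous_rieszMellin_line {c : ℝ} (hc : 1 / 2 ≤ c) :
    Continuous fun t : ℝ => rieszMellin (c + t * I) := by
  have h0 : Continuous fun t : ℝ => (c : ℂ) + t * I := by fun_prop
  refine continuous_iff_continuousAt.2 fun t => ?_
  exact ContinuousAt.comp (g := rieszMellin) (f := fun t : ℝ => (c : ℂ) + t * I)
    (hasDerivAt_rieszMellin (by simp; norm_num at hc; linarith)).continuousAt h0.continuousAt

theorem integrable_rieszMellin_line {c : ℝ} (hc : 1 / 2 ≤ c) :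
    Integrable fun t : ℝ => rieszMellin (c + t * I) := by
  refine ((integrable_one_add_norm (E := ℝ) (r := 2) (by norm_num)).const_mul 16).mono'
    (continuous_rieszMellin_line hc).aestronglyMeasurable (Eventually.of_forall fun t => ?_)
  simpa using norm_rieszMellin_le (w := c + t * I) (by simp; norm_num at hc; linarith)

/-- Mellin inversion for the weight `(1 - √y)₊`. -/
theorem integral_rieszMellin {c y : ℝ} (hc : 1 / 2 ≤ c) (hy : 0 < y) :
    ∫ t : ℝ, (y : ℂ) ^ (-(c + t * I : ℂ)) * rieszMellin (c + t * I) =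
      2 * Real.pi * rieszWeight y := by
  have hpos : ∀ t : ℝ, 0 < ((c : ℂ) + t * I).re := fun t => by simp; linarith
  have hm : ∀ t : ℝ, mellin rieszWeight (c + t * I) = rieszMellin (c + t * I) := fun t =>
    (hasMellin_rieszWeight (hpos t)).2
  have h := mellinInv_mellin_eq c rieszWeight hy
    (by simpa using (hasMellin_rieszWeight (hpos 0)).1) ?_ (continuousAt_rieszWeight hy)
  · rw [← h, mellinInv]
    simp only [hm, smul_eq_mul, real_smul]
    have : (Real.pi : ℂ) ≠ 0 := by exact_mod_cast Real.pi_ne_zero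
    push_cast
    rw [← mul_assoc, mul_one_div_cancel (mul_ne_zero two_ne_zero this), one_mul]
  · unfold VerticalIntegrable
    simp only [hm]
    exact integrable_rieszMellin_line hc

end GalDivisors

/-! ### The prime number theorem for the weight `1/√n - 1/√x` -/

namespace GalDivisors

open Complex Filter Topology Asymptotics MeasureTheory ArithmeticFunction

/-- The smoothed Perron formula for the coefficients `Λ(n) - 1`. -/
theorem hasSum_rieszWeight_vonMangoldt_sub_one {c x : ℝ} (h1 : 1 / 2 < c) (hx : 0 < x) :
    HasSum (fun n : ℕ => 2 * Real.pi *
        (LSeries.term (fun n => (vonMangoldt n : ℂ) - 1) (1 / 2) n * rieszWeight (n / x)))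
      (∫ t : ℝ, (x : ℂ) ^ (c + t * I : ℂ) * perronFun c t) := by
  set a : ℕ → ℂ := fun n => (vonMangoldt n : ℂ) - 1 with ha
  set F : ℕ → ℝ → ℂ := fun n t => (x : ℂ) ^ (c + t * I : ℂ) * rieszMellin (c + t * I) *
    LSeries.term a (c + t * I + 1 / 2) n with hF
  have hx0 : (x : ℂ) ≠ 0 := by exact_mod_cast hx.ne'
  have hre : ∀ t : ℝ, 1 < ((c : ℂ) + t * I + 1 / 2).re := fun t => by norm_num; linarith
  have hnorm : ∀ n t, ‖F n t‖ = ‖LSeries.term a (c + 1 / 2) n‖ * x ^ c *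
      ‖rieszMellin (c + t * I)‖ := by
    intro n t
    simp only [hF, norm_mul]
    rw [norm_cpow_eq_rpow_re_of_pos hx, LSeries.norm_term_eq, LSeries.norm_term_eq]
    have e1 : ((c : ℂ) + t * I).re = c := by simp
    have e2 : ((c : ℂ) + t * I + 1 / 2).re = ((c : ℂ) + 1 / 2).re := by simp
    rw [e1, e2]
    ring
  have hterm : ∀ n t, F n t = LSeries.term a (1 / 2) n *
      (((n / x : ℝ) : ℂ) ^ (-(c + t * I : ℂ)) * rieszMellin (c + t * I)) := by
    intro n t
    rcases eq_or_ne n 0 with rfl | hn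
    · simp [hF]
    have hn0 : (n : ℂ) ≠ 0 := by exact_mod_cast hn
    simp only [hF, LSeries.term_of_ne_zero hn]
    have e : ((n / x : ℝ) : ℂ) ^ (-(c + t * I : ℂ)) =
        (x : ℂ) ^ (c + t * I : ℂ) * ((n : ℂ) ^ (c + t * I : ℂ))⁻¹ := by
      have harg : (x : ℂ).arg ≠ Real.pi := by
        rw [arg_ofReal_of_nonneg hx.le]
        exact Real.pi_ne_zero.symm
      rw [div_eq_mul_inv, ofReal_mul, mul_cpow_ofReal_nonneg (by positivity) (by positivity),
        cpow_neg, cpow_neg, ofReal_inv, inv_cpow _ _ harg, inv_inv, ofReal_natCast]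
      ring
    rw [e, cpow_add _ _ hn0]
    field_simp
  have hint : ∀ n, Integrable (F n) := by
    intro n
    refine Integrable.mono' ((integrable_rieszMellin_line h1.le).norm.const_mul
      (‖LSeries.term a (c + 1 / 2) n‖ * x ^ c)) ?_ (Eventually.of_forall fun t => (hnorm n t).le)
    have : F n = fun t : ℝ => LSeries.term a (1 / 2) n *
      (((n / x : ℝ) : ℂ) ^ (-(c + t * I : ℂ)) * rieszMellin (c + t * I)) := funext (hterm n)
    rw [this]
    rcases eq_or_ne n 0 with rfl | hn
    · simp only [LSeries.term_zero, zero_mul]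
      exact aestronglyMeasurable_const
    refine Continuous.aestronglyMeasurable ?_
    refine continuous_const.mul (Continuous.mul ?_ (continuous_rieszMellin_line h1.le))
    refine Continuous.const_cpow (by fun_prop) (Or.inl ?_)
    have : (0 : ℝ) < n := by positivity
    exact_mod_cast (div_pos this hx).ne'
  have hsumm : Summable fun n => ∫ t, ‖F n t‖ := by
    simp only [hnorm]
    have hs : Summable fun n => ‖LSeries.term a (c + 1 / 2) n‖ :=
      (LSeries_vonMangoldt_sub_one (s := c + 1 / 2) (by norm_num; linarith)).summable.norm
    refine ((hs.mul_right (x ^ c)).mul_right (∫ t : ℝ, ‖rieszMellin (c + t * I)‖)).congr fun n => ?_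
    rw [integral_const_mul]
  have key := hasSum_integral_of_summable_integral_norm hint hsumm
  have e1 : ∀ t, ∑' n, F n t = (x : ℂ) ^ (c + t * I : ℂ) * perronFun c t := by
    intro t
    simp only [hF, tsum_mul_left]
    rw [(LSeries_vonMangoldt_sub_one (hre t)).tsum_eq, perronFun, mul_assoc]
  simp only [e1] at key
  refine key.congr_fun fun n => ?_
  rcases eq_or_ne n 0 with rfl | hn
  · simp [hF]
  have hnx : 0 < (n : ℝ) / x := div_pos (by positivity) hx
  simp only [hterm n, integral_const_mul]
  rw [integral_rieszMellin h1.le hnx]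
  ring

/-- One integration by parts along the vertical line saves a factor `log x`. -/
theorem exists_norm_integral_perronFun_le :
    ∃ C : ℝ, 0 < C ∧ ∀ c x : ℝ, 1 / 2 < c → c ≤ 3 / 2 → 1 < x →
      ‖∫ t : ℝ, (x : ℂ) ^ (c + t * I : ℂ) * perronFun c t‖ ≤ C * x ^ c / Real.log x := by
  obtain ⟨C, hC, h⟩ := exists_norm_perronFun_le
  set J := ∫ t : ℝ, (1 + ‖t‖) ^ (-(3 / 2) : ℝ)
  have hJ : 0 ≤ J := integral_nonneg fun t => by positivity
  refine ⟨C * J + 1, by positivity, fun c x h1 h2 hx => ?_⟩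
  have hx0 : 0 < x := by linarith
  have hxc : (x : ℂ) ≠ 0 := by exact_mod_cast hx0.ne'
  have hlog : 0 < Real.log x := Real.log_pos hx
  have hlogc : (Real.log x : ℂ) ≠ 0 := by exact_mod_cast hlog.ne'
  set v : ℝ → ℂ := fun t => (x : ℂ) ^ (c + t * I : ℂ) / (I * Real.log x) with hv
  set v' : ℝ → ℂ := fun t => (x : ℂ) ^ (c + t * I : ℂ) with hv'
  have hvd : ∀ t, HasDerivAt v (v' t) t := by
    intro t
    have h0 : HasDerivAt (fun t : ℝ => (c : ℂ) + t * I) I t := by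
      have := (ofRealCLM.hasDerivAt (x := t)).mul_const I
      simpa using this.const_add (c : ℂ)
    have h3 := (HasDerivAt.comp (h₂ := fun w : ℂ => (x : ℂ) ^ w) t
      ((hasDerivAt_id _).const_cpow (Or.inl hxc)) h0).div_const (I * Real.log x)
    refine h3.congr_deriv ?_
    rw [← ofReal_log hx0.le]
    have := I_ne_zero
    simp only [hv', id_eq]
    field_simp
  have hnv' : ∀ t, ‖v' t‖ = x ^ c := by
    intro t
    simp only [hv']
    rw [norm_cpow_eq_rpow_re_of_pos hx0]
    simp
  have hnv : ∀ t, ‖v t‖ = x ^ c / Real.log x := by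
    intro t
    have : v t = v' t / (I * Real.log x) := rfl
    rw [this, norm_div, hnv', norm_mul, norm_I, one_mul, norm_real, Real.norm_of_nonneg hlog.le]
  have hcv : Continuous v := continuous_iff_continuousAt.2 fun t => (hvd t).continuousAt
  have hcv' : Continuous v' := by
    simp only [hv']
    exact Continuous.const_cpow (by fun_prop) (Or.inl hxc)
  have i1 := integrable_perronFun h1 h2
  have i2 := integrable_derivPerronFun h1 h2
  have ibp := integral_mul_deriv_eq_deriv_mul_of_integrable
    (u := perronFun c) (v := v) (u' := derivPerronFun c) (v' := v')
    (fun t _ => hasDerivAt_perronFun h1 t) (fun t _ => hvd t)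
    (i1.mul_bdd (c := x ^ c) hcv'.aestronglyMeasurable (Eventually.of_forall fun t => (hnv' t).le))
    (i2.mul_bdd (c := x ^ c / Real.log x) hcv.aestronglyMeasurable
      (Eventually.of_forall fun t => (hnv t).le))
    (i1.mul_bdd (c := x ^ c / Real.log x) hcv.aestronglyMeasurable
      (Eventually.of_forall fun t => (hnv t).le))
  have e : ∫ t : ℝ, (x : ℂ) ^ (c + t * I : ℂ) * perronFun c t = ∫ t, perronFun c t * v' t := by
    congr 1
    funext t
    exact mul_comm _ _
  rw [e, ibp, norm_neg]
  have hp : 0 < x ^ c / Real.log x := by positivity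
  calc ‖∫ t, derivPerronFun c t * v t‖
      ≤ ∫ t : ℝ, C * (x ^ c / Real.log x) * (1 + ‖t‖) ^ (-(3 / 2) : ℝ) := by
        refine norm_integral_le_of_norm_le (integrable_one_add_norm_rpow.const_mul _)
          (Eventually.of_forall fun t => ?_)
        rw [norm_mul, hnv]
        calc _ ≤ C * (1 + ‖t‖) ^ (-(3 / 2) : ℝ) * (x ^ c / Real.log x) := by
              gcongr; exact (h c t h1 h2).2
          _ = _ := by ring
    _ = C * J * (x ^ c / Real.log x) := by rw [integral_const_mul]; ring
    _ ≤ (C * J + 1) * (x ^ c / Real.log x) := by gcongr; linarith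
    _ = _ := by ring

/-- The prime number theorem in a smoothed form, with a saving of a factor `log x`. -/
theorem exists_abs_sum_vonMangoldt_sub_one_le :
    ∃ C : ℝ, 0 < C ∧ ∀ x : ℝ, 3 ≤ x →
      |∑ n ∈ Finset.Ioc 0 ⌊x⌋₊, (vonMangoldt n - 1) * (1 / √n - 1 / √x)| ≤
        C * √x / Real.log x := by
  obtain ⟨C, hC, h⟩ := exists_norm_integral_perronFun_le
  refine ⟨C * Real.exp 1, by positivity, fun x hx => ?_⟩
  have hx0 : 0 < x := by linarith
  have hl1 : 1 ≤ Real.log x := by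
    rw [Real.le_log_iff_exp_le hx0]
    exact Real.exp_one_lt_three.le.trans hx
  -- with this `c` the factor `x ^ c` is `e √x`
  set c : ℝ := 1 / 2 + 1 / Real.log x with hc
  have hc1 : 1 / 2 < c := by have : 0 < 1 / Real.log x := by positivity
                             linarith
  have hc2 : c ≤ 3 / 2 := by
    have : 1 / Real.log x ≤ 1 := by rw [div_le_one (by linarith)]; exact hl1
    linarith
  have hxc : x ^ c = √x * Real.exp 1 := by
    rw [hc, Real.rpow_add hx0, Real.sqrt_eq_rpow]
    congr 1
    rw [Real.rpow_def_of_pos hx0, mul_one_div_cancel (by linarith)]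
  have hs := (hasSum_rieszWeight_vonMangoldt_sub_one hc1 hx0).tsum_eq
  have hb := h c x hc1 hc2 (by linarith)
  rw [← hs, hxc] at hb
  have hterm : ∀ n : ℕ, n ∈ Finset.Ioc 0 ⌊x⌋₊ → 2 * (Real.pi : ℂ) *
      (LSeries.term (fun n => (vonMangoldt n : ℂ) - 1) (1 / 2) n * rieszWeight (n / x)) =
      ((2 * Real.pi * ((vonMangoldt n - 1) * (1 / √n - 1 / √x)) : ℝ) : ℂ) := by
    intro n hn
    rw [Finset.mem_Ioc] at hn
    have hn0 : (0 : ℝ) < n := by exact_mod_cast hn.1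
    have hnx : (n : ℝ) ≤ x := (Nat.le_floor_iff hx0.le).1 hn.2
    rw [LSeries.term_of_ne_zero hn.1.ne', rieszWeight_of_pos (div_pos hn0 hx0), max_eq_right]
    · have e : ((n : ℂ)) ^ (1 / 2 : ℂ) = ((√n : ℝ) : ℂ) := by
        rw [Real.sqrt_eq_rpow, ofReal_cpow hn0.le]
        norm_num
      rw [e, Real.sqrt_div' _ hx0.le]
      have h1 : ((√n : ℝ) : ℂ) ≠ 0 := by exact_mod_cast (Real.sqrt_pos.2 hn0).ne'
      have h2 : ((√x : ℝ) : ℂ) ≠ 0 := by exact_mod_cast (Real.sqrt_pos.2 hx0).ne'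
      push_cast
      field_simp
    · rw [sub_nonneg, Real.sqrt_le_one]
      rwa [div_le_one hx0]
  have hout : ∀ n : ℕ, n ∉ Finset.Ioc 0 ⌊x⌋₊ → 2 * (Real.pi : ℂ) *
      (LSeries.term (fun n => (vonMangoldt n : ℂ) - 1) (1 / 2) n * rieszWeight (n / x)) = 0 := by
    intro n hn
    rcases eq_or_ne n 0 with rfl | hn0
    · simp
    have hnx : x < n := by
      by_contra hcon
      exact hn (Finset.mem_Ioc.2 ⟨Nat.pos_of_ne_zero hn0, Nat.le_floor (not_lt.1 hcon)⟩)
    have hn1 : (0 : ℝ) < n := by linarith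
    rw [rieszWeight_of_pos (div_pos hn1 hx0), max_eq_left]
    · simp
    · rw [sub_nonpos, Real.one_le_sqrt, one_le_div hx0]
      exact hnx.le
  rw [tsum_eq_sum (fun n hn => hout n hn), Finset.sum_congr rfl hterm, ← ofReal_sum, norm_real,
    ← Finset.mul_sum, Real.norm_eq_abs, abs_mul, abs_of_pos (by positivity)] at hb
  have hpi : 1 ≤ 2 * Real.pi := by have := Real.pi_gt_three; linarith
  refine (le_mul_of_one_le_left (abs_nonneg _) hpi).trans (hb.trans (le_of_eq ?_))
  ring

end GalDivisors

/-! ### Passage from prime powers to primes -/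

namespace GalDivisors

open Filter Topology Asymptotics ArithmeticFunction

theorem inv_sqrt_le {n : ℕ} : 1 / √((n + 1 : ℕ) : ℝ) ≤ 2 * (√((n + 1 : ℕ) : ℝ) - √(n : ℝ)) := by
  have h1 : 0 < √((n + 1 : ℕ) : ℝ) := Real.sqrt_pos.2 (by positivity)
  have h2 : √((n + 1 : ℕ) : ℝ) ^ 2 = n + 1 := by rw [Real.sq_sqrt (by positivity)]; push_cast; rfl
  have h3 : √(n : ℝ) ^ 2 = n := Real.sq_sqrt (by positivity)
  rw [div_le_iff₀ h1]
  nlinarith [sq_nonneg (√((n + 1 : ℕ) : ℝ) - √(n : ℝ))]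

theorem le_inv_sqrt {n : ℕ} :
    2 * (√((n + 2 : ℕ) : ℝ) - √((n + 1 : ℕ) : ℝ)) ≤ 1 / √((n + 1 : ℕ) : ℝ) := by
  have h1 : 0 < √((n + 1 : ℕ) : ℝ) := Real.sqrt_pos.2 (by positivity)
  have h2 : √((n + 1 : ℕ) : ℝ) ^ 2 = n + 1 := by rw [Real.sq_sqrt (by positivity)]; push_cast; rfl
  have h3 : √((n + 2 : ℕ) : ℝ) ^ 2 = n + 2 := by rw [Real.sq_sqrt (by positivity)]; push_cast; rfl
  rw [le_div_iff₀ h1]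
  nlinarith [sq_nonneg (√((n + 2 : ℕ) : ℝ) - √((n + 1 : ℕ) : ℝ))]

theorem sum_inv_sqrt_le (N : ℕ) : ∑ n ∈ Finset.Ioc 0 N, 1 / √(n : ℝ) ≤ 2 * √(N : ℝ) := by
  induction N with
  | zero => simp
  | succ N ih =>
    rw [Finset.sum_Ioc_succ_top (Nat.zero_le N)]
    have := inv_sqrt_le (n := N)
    linarith

theorem le_sum_inv_sqrt (N : ℕ) :
    2 * √((N + 1 : ℕ) : ℝ) - 2 ≤ ∑ n ∈ Finset.Ioc 0 N, 1 / √(n : ℝ) := by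
  induction N with
  | zero => simp
  | succ N ih =>
    rw [Finset.sum_Ioc_succ_top (Nat.zero_le N)]
    have := le_inv_sqrt (n := N)
    linarith

theorem sum_inv_sqrt_floor_le {x : ℝ} (hx : 0 ≤ x) :
    ∑ n ∈ Finset.Ioc 0 ⌊x⌋₊, 1 / √(n : ℝ) ≤ 2 * √x :=
  (sum_inv_sqrt_le _).trans (by gcongr; exact Nat.floor_le hx)

theorem abs_sum_inv_sqrt_sub_sub_sqrt_le {x : ℝ} (hx : 1 ≤ x) :
    |∑ n ∈ Finset.Ioc 0 ⌊x⌋₊, (1 / √(n : ℝ) - 1 / √x) - √x| ≤ 2 := by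
  have hx0 : 0 < x := by linarith
  have hs : 1 ≤ √x := Real.one_le_sqrt.2 hx
  have hs0 : 0 < √x := by linarith
  have hsq : √x * √x = x := Real.mul_self_sqrt hx0.le
  rw [Finset.sum_sub_distrib, Finset.sum_const, Nat.card_Ioc, nsmul_eq_mul, Nat.sub_zero]
  have h1 := sum_inv_sqrt_floor_le hx0.le
  have h2 := le_sum_inv_sqrt ⌊x⌋₊
  have h3 : √x ≤ √((⌊x⌋₊ + 1 : ℕ) : ℝ) := by
    gcongr; push_cast; exact (Nat.lt_floor_add_one x).le
  have h4 : (⌊x⌋₊ : ℝ) * (1 / √x) ≤ √x := by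
    rw [mul_one_div, div_le_iff₀ hs0, hsq]; exact Nat.floor_le hx0.le
  have h5 : √x - 1 ≤ (⌊x⌋₊ : ℝ) * (1 / √x) := by
    rw [mul_one_div, le_div_iff₀ hs0]
    have := Nat.lt_floor_add_one x
    nlinarith
  rw [abs_le]
  constructor <;> linarith

/-- Proper prime powers contribute little. -/
theorem exists_sum_vonMangoldt_not_prime_le :
    ∃ C : ℝ, 0 < C ∧ ∀ x : ℝ, 3 ≤ x →
      ∑ n ∈ (Finset.Ioc 0 ⌊x⌋₊).filter (fun n => ¬ n.Prime),
        vonMangoldt n * (1 / √(n : ℝ) - 1 / √x) ≤ C * √x / Real.log x := by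
  obtain ⟨C, hC⟩ := Chebyshev.psi_sub_theta_le_mul_sqrt
  refine ⟨64 + |C| * 8, by positivity, fun x hx => ?_⟩
  have hx0 : 0 < x := by linarith
  have hl : 0 < Real.log x := Real.log_pos (by linarith)
  set y := √x with hy
  have hy1 : 1 ≤ y := Real.one_le_sqrt.2 (by linarith)
  have hy0 : 0 < y := by linarith
  have hyx : y ≤ x := by rw [hy, Real.sqrt_le_left hx0.le]; nlinarith
  set z := √y with hz
  have hz1 : 1 ≤ z := Real.one_le_sqrt.2 hy1
  have hz0 : 0 < z := by linarith
  have hzz : z * z = y := Real.mul_self_sqrt hy0.le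
  set S := (Finset.Ioc 0 ⌊x⌋₊).filter (fun n => ¬ n.Prime)
  have hS : ∀ n ∈ S, 0 < n ∧ (n : ℝ) ≤ x := by
    intro n hn
    have := Finset.mem_Ioc.1 (Finset.mem_filter.1 hn).1
    exact ⟨this.1, (Nat.le_floor_iff hx0.le).1 this.2⟩
  have hlogz : Real.log x = 4 * Real.log z := by
    have e : x = z ^ 4 := by
      have : y * y = x := Real.mul_self_sqrt hx0.le
      rw [← this, ← hzz]; ring
    rw [e, Real.log_pow]; norm_num
  -- the range is cut at `√x`
  have hsplit : ∀ n ∈ S, vonMangoldt n * (1 / √(n : ℝ) - 1 / √x) ≤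
      (if (n : ℝ) ≤ y then Real.log x / 2 * (1 / √(n : ℝ)) else 0) + vonMangoldt n * (1 / z) := by
    intro n hn
    obtain ⟨hn0, hnx⟩ := hS n hn
    have hn1 : (0 : ℝ) < n := by exact_mod_cast hn0
    have hΛ : 0 ≤ vonMangoldt n := vonMangoldt_nonneg
    have hxs : 0 ≤ 1 / √x := by positivity
    split_ifs with h
    · have h1 : vonMangoldt n ≤ Real.log x / 2 := by
        refine vonMangoldt_le_log.trans ?_
        have : Real.log y = Real.log x / 2 := by rw [hy, Real.log_sqrt hx0.le]
        rw [← this]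
        exact Real.log_le_log hn1 h
      have : vonMangoldt n * (1 / √(n : ℝ) - 1 / √x) ≤ Real.log x / 2 * (1 / √(n : ℝ)) := by
        calc _ ≤ vonMangoldt n * (1 / √(n : ℝ)) := by gcongr; linarith
          _ ≤ _ := by gcongr
      have : 0 ≤ vonMangoldt n * (1 / z) := by positivity
      linarith
    · rw [zero_add]
      gcongr
      have : 1 / √(n : ℝ) ≤ 1 / z := by
        gcongr
        exact Real.sqrt_le_sqrt (not_le.1 h).le
      linarith
  have hfirst : ∑ n ∈ S, (if (n : ℝ) ≤ y then Real.log x / 2 * (1 / √(n : ℝ)) else 0) ≤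
      Real.log x * z := by
    rw [← Finset.sum_filter, ← Finset.mul_sum]
    have : ∑ n ∈ S.filter (fun n : ℕ => (n : ℝ) ≤ y), 1 / √(n : ℝ) ≤ 2 * z := by
      refine le_trans ?_ (sum_inv_sqrt_floor_le hy0.le)
      refine Finset.sum_le_sum_of_subset_of_nonneg ?_ (fun _ _ _ => by positivity)
      intro n hn
      have h1 := Finset.mem_filter.1 hn
      exact Finset.mem_Ioc.2 ⟨(hS n h1.1).1, Nat.le_floor h1.2⟩
    calc _ ≤ Real.log x / 2 * (2 * z) := by gcongr
      _ = _ := by ring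
  have hsecond : ∑ n ∈ S, vonMangoldt n * (1 / z) ≤ |C| * z := by
    rw [← Finset.sum_mul]
    have h1 : ∑ n ∈ S, vonMangoldt n = Chebyshev.psi x - Chebyshev.theta x :=
      (Chebyshev.psi_sub_theta_eq_sum_not_prime x).symm
    have h2 : Chebyshev.psi x - Chebyshev.theta x ≤ |C| * y :=
      (hC x).trans (by gcongr; exact le_abs_self C)
    rw [h1, mul_one_div, div_le_iff₀ hz0, mul_assoc, hzz]
    exact h2
  have hlz : Real.log z ≤ 2 * √z := by
    have h1 := Real.log_le_sub_one_of_pos (Real.sqrt_pos.2 hz0)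
    rw [Real.log_sqrt hz0.le] at h1
    linarith
  have hlz2 : Real.log x ^ 2 ≤ 64 * z := by
    rw [hlogz]
    have h0 : 0 ≤ Real.log z := Real.log_nonneg hz1
    have : √z ^ 2 = z := Real.sq_sqrt hz0.le
    nlinarith
  have hlz3 : Real.log x ≤ 8 * z := by
    have h1 := Real.log_le_sub_one_of_pos hz0
    rw [hlogz]; linarith
  calc _ ≤ ∑ n ∈ S, ((if (n : ℝ) ≤ y then Real.log x / 2 * (1 / √(n : ℝ)) else 0) +
        vonMangoldt n * (1 / z)) := Finset.sum_le_sum hsplit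
    _ ≤ Real.log x * z + |C| * z := by rw [Finset.sum_add_distrib]; linarith
    _ ≤ _ := by
      rw [le_div_iff₀ hl, ← hzz]
      have h1 : Real.log x * z * Real.log x ≤ 64 * z * z := by nlinarith
      have h2 : |C| * z * Real.log x ≤ |C| * z * (8 * z) := by gcongr
      nlinarith

/-- Sum over the primes up to `x` of `log p (1/√p - 1/√x)`. -/
noncomputable def primeLogSum (x : ℝ) : ℝ :=
  ∑ p ∈ (Finset.Ioc 0 ⌊x⌋₊).filter Nat.Prime, Real.log p * (1 / √(p : ℝ) - 1 / √x)

/-- Sum over the primes up to `x` of `1/√p - 1/√x`. -/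
noncomputable def primeSum (x : ℝ) : ℝ :=
  ∑ p ∈ (Finset.Ioc 0 ⌊x⌋₊).filter Nat.Prime, (1 / √(p : ℝ) - 1 / √x)

theorem exists_abs_primeLogSum_sub_sqrt_le :
    ∃ C : ℝ, 0 < C ∧ ∀ x : ℝ, 3 ≤ x → |primeLogSum x - √x| ≤ C * √x / Real.log x := by
  obtain ⟨C₁, hC₁, h₁⟩ := exists_abs_sum_vonMangoldt_sub_one_le
  obtain ⟨C₂, hC₂, h₂⟩ := exists_sum_vonMangoldt_not_prime_le
  refine ⟨C₁ + C₂ + 4, by positivity, fun x hx => ?_⟩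
  have hx0 : 0 < x := by linarith
  have hl : 0 < Real.log x := Real.log_pos (by linarith)
  have k1 := h₁ x hx
  have k2 := h₂ x hx
  have k3 := abs_sum_inv_sqrt_sub_sub_sqrt_le (x := x) (by linarith)
  have hnn : 0 ≤ ∑ n ∈ (Finset.Ioc 0 ⌊x⌋₊).filter (fun n => ¬ n.Prime),
      vonMangoldt n * (1 / √(n : ℝ) - 1 / √x) := by
    refine Finset.sum_nonneg fun n hn => mul_nonneg vonMangoldt_nonneg ?_
    have h := Finset.mem_Ioc.1 (Finset.mem_filter.1 hn).1
    have hn0 : (0 : ℝ) < n := by exact_mod_cast h.1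
    have hnx := (Nat.le_floor_iff hx0.le).1 h.2
    rw [sub_nonneg]
    gcongr
  have hsum : primeLogSum x + ∑ n ∈ (Finset.Ioc 0 ⌊x⌋₊).filter (fun n => ¬ n.Prime),
      vonMangoldt n * (1 / √(n : ℝ) - 1 / √x) =
      ∑ n ∈ Finset.Ioc 0 ⌊x⌋₊, vonMangoldt n * (1 / √(n : ℝ) - 1 / √x) := by
    rw [← Finset.sum_filter_add_sum_filter_not (Finset.Ioc 0 ⌊x⌋₊) Nat.Prime
      (fun n => vonMangoldt n * (1 / √(n : ℝ) - 1 / √x)), primeLogSum]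
    congr 1
    refine Finset.sum_congr rfl fun p hp => ?_
    rw [vonMangoldt_apply_prime (Finset.mem_filter.1 hp).2]
  have hsub : ∑ n ∈ Finset.Ioc 0 ⌊x⌋₊, (vonMangoldt n - 1) * (1 / √(n : ℝ) - 1 / √x) =
      ∑ n ∈ Finset.Ioc 0 ⌊x⌋₊, vonMangoldt n * (1 / √(n : ℝ) - 1 / √x) -
        ∑ n ∈ Finset.Ioc 0 ⌊x⌋₊, (1 / √(n : ℝ) - 1 / √x) := by
    rw [← Finset.sum_sub_distrib]
    exact Finset.sum_congr rfl fun n _ => by ring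
  have h2 : 2 ≤ 4 * √x / Real.log x := by
    rw [le_div_iff₀ hl]
    have h1 := Real.log_le_sub_one_of_pos (Real.sqrt_pos.2 hx0)
    rw [Real.log_sqrt hx0.le] at h1
    linarith
  have e : (C₁ + C₂ + 4) * √x / Real.log x =
      C₁ * √x / Real.log x + C₂ * √x / Real.log x + 4 * √x / Real.log x := by ring
  rw [hsub, ← hsum, abs_le] at k1
  rw [abs_le] at k3 ⊢
  rw [e]
  have : 0 < C₂ * √x / Real.log x := by positivity
  constructor <;> linarith

theorem inv_sqrt_sub_nonneg_of_mem {x : ℝ} {p : ℕ}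
    (hp : p ∈ (Finset.Ioc 0 ⌊x⌋₊).filter Nat.Prime) : 0 ≤ 1 / √(p : ℝ) - 1 / √x := by
  have h := Finset.mem_Ioc.1 (Finset.mem_filter.1 hp).1
  have hn0 : (0 : ℝ) < p := by exact_mod_cast h.1
  have hnx := (Nat.le_floor_iff' h.1.ne').1 h.2
  rw [sub_nonneg]
  gcongr

theorem primeSum_nonneg (x : ℝ) : 0 ≤ primeSum x :=
  Finset.sum_nonneg fun _ hp => inv_sqrt_sub_nonneg_of_mem hp

theorem primeSum_le {x : ℝ} (hx : 0 ≤ x) : primeSum x ≤ 2 * √x := by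
  refine le_trans ?_ (sum_inv_sqrt_floor_le hx)
  refine (Finset.sum_le_sum (g := fun p : ℕ => 1 / √(p : ℝ)) fun p _ => ?_).trans
    (Finset.sum_le_sum_of_subset_of_nonneg (Finset.filter_subset _ _) fun _ _ _ => by positivity)
  have : 0 ≤ 1 / √x := by positivity
  linarith

theorem primeLogSum_le_log_mul_primeSum {x : ℝ} :
    primeLogSum x ≤ Real.log x * primeSum x := by
  rw [primeSum, Finset.mul_sum]
  refine Finset.sum_le_sum fun p hp => ?_
  have h := Finset.mem_Ioc.1 (Finset.mem_filter.1 hp).1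
  have hn0 : (0 : ℝ) < p := by exact_mod_cast h.1
  have hnx := (Nat.le_floor_iff' h.1.ne').1 h.2
  have := inv_sqrt_sub_nonneg_of_mem hp
  gcongr

/-- The primes above `y` satisfy `log y ≤ log p`; those up to `y` are estimated trivially. -/
theorem log_mul_primeSum_le {x y : ℝ} (hy : 1 ≤ y) (hyx : y ≤ x) :
    Real.log y * primeSum x ≤ primeLogSum x + Real.log y * (2 * √y) := by
  have hly : 0 ≤ Real.log y := Real.log_nonneg hy
  have hx0 : 0 < x := by linarith
  set S := (Finset.Ioc 0 ⌊x⌋₊).filter Nat.Prime with hS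
  have hterm : ∀ p ∈ S, Real.log y * (1 / √(p : ℝ) - 1 / √x) ≤
      Real.log p * (1 / √(p : ℝ) - 1 / √x) +
        Real.log y * (if (p : ℝ) ≤ y then 1 / √(p : ℝ) else 0) := by
    intro p hp
    have h0 := inv_sqrt_sub_nonneg_of_mem hp
    have h := Finset.mem_Ioc.1 (Finset.mem_filter.1 hp).1
    have hp1 : (1 : ℝ) ≤ p := by exact_mod_cast h.1
    have hlp : 0 ≤ Real.log p := Real.log_nonneg hp1
    split_ifs with hc
    · have h1 : Real.log y * (1 / √(p : ℝ) - 1 / √x) ≤ Real.log y * (1 / √(p : ℝ)) := by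
        gcongr
        have : 0 ≤ 1 / √x := by positivity
        linarith
      have : 0 ≤ Real.log p * (1 / √(p : ℝ) - 1 / √x) := by positivity
      linarith
    · rw [mul_zero, add_zero]
      gcongr
      exact (not_le.1 hc).le
  rw [primeSum, primeLogSum, Finset.mul_sum]
  refine (Finset.sum_le_sum hterm).trans ?_
  rw [Finset.sum_add_distrib, ← Finset.mul_sum]
  gcongr
  rw [← Finset.sum_filter]
  refine le_trans (Finset.sum_le_sum_of_subset_of_nonneg ?_ (fun _ _ _ => by positivity))
    (sum_inv_sqrt_floor_le (by linarith : 0 ≤ y))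
  intro n hn
  have h1 := Finset.mem_filter.1 hn
  have h2 := Finset.mem_Ioc.1 (Finset.mem_filter.1 h1.1).1
  exact Finset.mem_Ioc.2 ⟨h2.1, Nat.le_floor h1.2⟩

/-- The prime number theorem in the form used below. The factor `log p` of `primeLogSum` is removed
by noting that it is `log x + O(log log x)` except for primes below `x / (log x)⁴`, which are
negligible. -/
theorem exists_abs_primeSum_sub_le :
    ∃ C X : ℝ, 0 < C ∧ Real.exp (Real.exp 1) ≤ X ∧ ∀ x : ℝ, X ≤ x →
      |primeSum x - √x / Real.log x| ≤
        C * (√x / Real.log x) * (Real.log (Real.log x) / Real.log x) := by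
  obtain ⟨C, hC, h⟩ := exists_abs_primeLogSum_sub_sqrt_le
  have hev : ∀ᶠ x : ℝ in atTop, 8 * Real.log (Real.log x) ≤ Real.log x := by
    have h1 : ∀ᶠ y : ℝ in atTop, Real.log y ≤ 1 / 8 * y := by
      have := Real.isLittleO_log_id_atTop.bound (show (0 : ℝ) < 1 / 8 by norm_num)
      filter_upwards [this, eventually_ge_atTop 1] with y hy hy1
      rw [Real.norm_of_nonneg (Real.log_nonneg hy1), id, Real.norm_of_nonneg (by linarith)] at hy
      exact hy
    filter_upwards [Real.tendsto_log_atTop.eventually h1] with x hx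
    linarith
  obtain ⟨X, hX⟩ := eventually_atTop.1 hev
  refine ⟨2 + C + 8 + 8 * C, max X (Real.exp (Real.exp 1)), by positivity, le_max_right _ _,
    fun x hx => ?_⟩
  have hx1 : Real.exp (Real.exp 1) ≤ x := (le_max_right _ _).trans hx
  have hx2 := hX x ((le_max_left _ _).trans hx)
  have hx0 : 0 < x := (Real.exp_pos _).trans_le hx1
  set L := Real.log x with hL
  have hLe : Real.exp 1 ≤ L := by rw [hL, Real.le_log_iff_exp_le hx0]; exact hx1
  have hL0 : 0 < L := (Real.exp_pos _).trans_le hLe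
  set l := Real.log L with hl
  have hl1 : 1 ≤ l := by rw [hl, Real.le_log_iff_exp_le hL0]; exact hLe
  have hx3 : 3 ≤ x := by
    refine le_trans ?_ hx1
    have h1 := Real.add_one_le_exp (Real.exp 1)
    have h2 := Real.exp_one_gt_d9
    norm_num at h2
    linarith
  have hW := h x hx3
  rw [abs_le] at hW
  have hs0 : 0 < √x := Real.sqrt_pos.2 hx0
  have hlow : √x / L - C * (√x / L) * (1 / L) ≤ primeSum x := by
    have h1 := primeLogSum_le_log_mul_primeSum (x := x)
    have h2 : √x - C * √x / L ≤ L * primeSum x := by linarith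
    have h3 : (√x - C * √x / L) / L ≤ primeSum x := by
      rw [div_le_iff₀ hL0]; linarith
    refine le_trans (le_of_eq ?_) h3
    field_simp
  have hup : primeSum x ≤ 2 * √x / L ^ 2 + (√x + C * √x / L) / (L - 4 * l) := by
    -- the cut `y` makes the trivial part `√y` smaller than `√x / log x` by a factor `log x`
    set y := x / L ^ 4 with hy
    have hlogy : Real.log y = L - 4 * l := by
      rw [hy, Real.log_div hx0.ne' (by positivity), Real.log_pow]; norm_num [hL, hl]
    have hly : 0 < Real.log y := by rw [hlogy]; linarith
    have hy0 : 0 < y := by positivity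
    have hy1 : 1 ≤ y := by
      by_contra hcon
      exact absurd hly (not_lt.2 (Real.log_nonpos hy0.le (not_le.1 hcon).le))
    have hL1 : 1 ≤ L := by have := Real.add_one_le_exp (1 : ℝ); linarith
    have hyx : y ≤ x := div_le_self hx0.le (one_le_pow₀ hL1)
    have hsy : √y = √x / L ^ 2 := by
      rw [hy, Real.sqrt_div hx0.le, show L ^ 4 = (L ^ 2) ^ 2 by ring,
        Real.sqrt_sq (by positivity)]
    have h1 := log_mul_primeSum_le hy1 hyx
    rw [hsy] at h1
    rw [← hlogy, ← sub_le_iff_le_add', le_div_iff₀ hly]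
    have e : (primeSum x - 2 * √x / L ^ 2) * Real.log y =
      Real.log y * primeSum x - Real.log y * (2 * (√x / L ^ 2)) := by ring
    rw [e]
    linarith
  have hinv : 1 / (L - 4 * l) ≤ 1 / L * (1 + 8 * (l / L)) := by
    rw [div_le_iff₀ (by linarith)]
    have e : 1 / L * (1 + 8 * (l / L)) * (L - 4 * l) = 1 + 4 * l * (L - 8 * l) / L ^ 2 := by
      field_simp
      ring
    rw [e]
    have : 0 ≤ 4 * l * (L - 8 * l) / L ^ 2 := by
      have : 0 ≤ L - 8 * l := by linarith
      positivity
    linarith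
  have hq : 0 < √x / L := by positivity
  have h1L : 1 / L ≤ l / L := by gcongr
  have hlL : l / L ≤ 1 := by rw [div_le_one hL0]; linarith
  have hr : 0 < l / L := by positivity
  rw [abs_le]
  constructor
  · have : C * (√x / L) * (1 / L) ≤ C * (√x / L) * (l / L) := by gcongr
    have h2 : 0 < (10 + 8 * C) * (√x / L) * (l / L) := by positivity
    nlinarith
  · have h2 : (√x + C * √x / L) / (L - 4 * l) ≤
        √x / L * ((1 + C * (l / L)) * (1 + 8 * (l / L))) := by
      have e : (√x + C * √x / L) / (L - 4 * l) = √x * (1 + C * (1 / L)) * (1 / (L - 4 * l)) := by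
        field_simp
      rw [e]
      calc _ ≤ √x * (1 + C * (l / L)) * (1 / L * (1 + 8 * (l / L))) := by
            have : 0 ≤ 1 / (L - 4 * l) := by
              have : 0 < L - 4 * l := by linarith
              positivity
            gcongr
        _ = _ := by ring
    have h3 : 2 * √x / L ^ 2 ≤ √x / L * (2 * (l / L)) := by
      have e : 2 * √x / L ^ 2 = √x / L * (2 * (1 / L)) := by field_simp
      rw [e]
      gcongr
    have h4 : (1 + C * (l / L)) * (1 + 8 * (l / L)) ≤ 1 + (C + 8 + 8 * C) * (l / L) := by
      have : (l / L) * (l / L) ≤ l / L := mul_le_of_le_one_left hr.le hlL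
      nlinarith
    have h5 : √x / L * ((1 + C * (l / L)) * (1 + 8 * (l / L))) ≤
      √x / L * (1 + (C + 8 + 8 * C) * (l / L)) := by gcongr
    linarith

end GalDivisors

/-! ### The Gál sum over divisors as a multiplicative function -/

namespace GalDivisors

theorem gcd_rpow_div_lcm_rpow {m n : ℕ} (hm : m ≠ 0) (hn : n ≠ 0) :
    (Nat.gcd m n : ℝ) ^ (1 / 2 : ℝ) / (Nat.lcm m n : ℝ) ^ (1 / 2 : ℝ) =
      Nat.gcd m n / (√m * √n) := by
  have hg : (0 : ℝ) < Nat.gcd m n := by exact_mod_cast Nat.gcd_pos_of_pos_left n (by omega)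
  have hl : (0 : ℝ) < Nat.lcm m n := by
    exact_mod_cast Nat.lcm_pos (Nat.pos_of_ne_zero hm) (Nat.pos_of_ne_zero hn)
  have h : (Nat.gcd m n : ℝ) * Nat.lcm m n = m * n := by exact_mod_cast Nat.gcd_mul_lcm m n
  rw [← Real.sqrt_eq_rpow, ← Real.sqrt_eq_rpow, ← Real.sqrt_mul (by positivity), ← h,
    Real.sqrt_mul hg.le]
  have h1 := Real.mul_self_sqrt hg.le
  have h2 := Real.sqrt_pos.2 hg
  have h3 := Real.sqrt_pos.2 hl
  rw [div_eq_div_iff h3.ne' (by positivity)]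
  nlinarith

theorem galSum_divisors (D : ℕ) : galSum (1 / 2) D.divisors =
    ∑ m ∈ D.divisors, ∑ n ∈ D.divisors, (Nat.gcd m n : ℝ) / (√m * √n) := by
  refine Finset.sum_congr rfl fun m hm => Finset.sum_congr rfl fun n hn => ?_
  exact gcd_rpow_div_lcm_rpow (Nat.ne_of_gt (Nat.pos_of_mem_divisors hm))
    (Nat.ne_of_gt (Nat.pos_of_mem_divisors hn))

open scoped Pointwise in
theorem sum_divisors_mul_of_coprime {m n : ℕ} (h : m.Coprime n) (f : ℕ → ℝ) :
    ∑ d ∈ (m * n).divisors, f d = ∑ a ∈ m.divisors, ∑ b ∈ n.divisors, f (a * b) := by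
  rw [Nat.divisors_mul, Finset.mul_def, Finset.sum_image, Finset.sum_product]
  simpa using h.mul_injOn_divisors

theorem galSum_divisors_mul {m n : ℕ} (h : m.Coprime n) :
    galSum (1 / 2) (m * n).divisors = galSum (1 / 2) m.divisors * galSum (1 / 2) n.divisors := by
  rw [galSum_divisors, galSum_divisors, galSum_divisors, sum_divisors_mul_of_coprime h]
  simp_rw [sum_divisors_mul_of_coprime h]
  have key : ∀ a ∈ m.divisors, ∀ b ∈ n.divisors, ∀ a' ∈ m.divisors, ∀ b' ∈ n.divisors,
      (Nat.gcd (a * b) (a' * b') : ℝ) / (√((a * b : ℕ) : ℝ) * √((a' * b' : ℕ) : ℝ)) =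
      ((Nat.gcd a a' : ℝ) / (√a * √a')) * ((Nat.gcd b b' : ℝ) / (√b * √b')) := by
    intro a ha b hb a' ha' b' hb'
    have cop : ∀ u ∈ m.divisors, ∀ v ∈ n.divisors, u.Coprime v := fun u hu v hv =>
      Nat.Coprime.of_dvd (Nat.dvd_of_mem_divisors hu) (Nat.dvd_of_mem_divisors hv) h
    have hg : Nat.gcd (a * b) (a' * b') = Nat.gcd a a' * Nat.gcd b b' := by
      rw [Nat.Coprime.gcd_mul _ (cop a' ha' b' hb'), Nat.Coprime.mul_gcd (cop a ha b hb),
        Nat.Coprime.mul_gcd (cop a ha b hb), (cop a ha b' hb').gcd_eq_one,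
        (cop a' ha' b hb).symm.gcd_eq_one, mul_one, one_mul]
    rw [hg]
    push_cast
    rw [Real.sqrt_mul (Nat.cast_nonneg _), Real.sqrt_mul (Nat.cast_nonneg _)]
    rw [div_mul_div_comm]
    congr 1
    ring
  calc _ = ∑ a ∈ m.divisors, ∑ b ∈ n.divisors, ∑ a' ∈ m.divisors, ∑ b' ∈ n.divisors,
        ((Nat.gcd a a' : ℝ) / (√a * √a')) * ((Nat.gcd b b' : ℝ) / (√b * √b')) :=
        Finset.sum_congr rfl fun a ha => Finset.sum_congr rfl fun b hb =>
          Finset.sum_congr rfl fun a' ha' => Finset.sum_congr rfl fun b' hb' =>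
            key a ha b hb a' ha' b' hb'
    _ = _ := by
        simp_rw [← Finset.mul_sum, ← Finset.sum_mul]
        rw [Finset.sum_mul]
        simp_rw [Finset.mul_sum]

theorem galSum_divisors_eq_prod {D : ℕ} (hD : D ≠ 0) :
    galSum (1 / 2) D.divisors =
      ∏ p ∈ D.primeFactors, galSum (1 / 2) (p ^ D.factorization p).divisors := by
  rw [Nat.multiplicative_factorization (fun D => galSum (1 / 2) D.divisors)
    (fun _ _ h => galSum_divisors_mul h) (by simp [galSum]) hD]
  rfl

theorem gcd_prime_pow_div_sqrt {p : ℕ} (hp : p.Prime) {i j : ℕ} (hij : i ≤ j) :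
    (Nat.gcd (p ^ j) (p ^ i) : ℝ) / (√((p ^ j : ℕ) : ℝ) * √((p ^ i : ℕ) : ℝ)) =
      (1 / √p) ^ (j - i) := by
  have hp0 : (0 : ℝ) < p := by exact_mod_cast hp.pos
  have hs : 0 < √(p : ℝ) := Real.sqrt_pos.2 hp0
  have hpow : ∀ k : ℕ, √((p ^ k : ℕ) : ℝ) = √(p : ℝ) ^ k := by
    intro k
    push_cast
    rw [Real.sqrt_eq_iff_mul_self_eq (by positivity) (by positivity), ← mul_pow,
      Real.mul_self_sqrt hp0.le]
  obtain ⟨k, rfl⟩ := Nat.exists_eq_add_of_le hij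
  rw [Nat.gcd_eq_right (pow_dvd_pow p hij), hpow, hpow, Nat.add_sub_cancel_left]
  have hpi : (p : ℝ) ^ i = √(p : ℝ) ^ i * √(p : ℝ) ^ i := by
    rw [← mul_pow, Real.mul_self_sqrt hp0.le]
  push_cast
  rw [hpi, pow_add, one_div, inv_pow]
  field_simp

theorem gcd_div_sqrt_comm (m n : ℕ) :
    (Nat.gcd m n : ℝ) / (√m * √n) = (Nat.gcd n m : ℝ) / (√n * √m) := by
  rw [Nat.gcd_comm, mul_comm]

/-- Passing from `p ^ ν` to `p ^ (ν + 1)` adds a row and a column to the Gál sum. -/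
theorem galSum_divisors_prime_pow_succ {p : ℕ} (hp : p.Prime) (ν : ℕ) :
    galSum (1 / 2) (p ^ (ν + 1)).divisors = galSum (1 / 2) (p ^ ν).divisors + 1 +
      2 * ∑ h ∈ Finset.range (ν + 1), (1 / √(p : ℝ)) ^ (h + 1) := by
  rw [galSum_divisors, galSum_divisors]
  simp only [Nat.sum_divisors_prime_pow hp]
  have hrow : ∑ i ∈ Finset.range (ν + 1), (Nat.gcd (p ^ (ν + 1)) (p ^ i) : ℝ) /
      (√((p ^ (ν + 1) : ℕ) : ℝ) * √((p ^ i : ℕ) : ℝ)) =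
      ∑ h ∈ Finset.range (ν + 1), (1 / √(p : ℝ)) ^ (h + 1) := by
    rw [← Finset.sum_range_reflect]
    refine Finset.sum_congr rfl fun i hi => ?_
    have := Finset.mem_range.1 hi
    rw [gcd_prime_pow_div_sqrt hp (by omega)]
    congr 1
    omega
  have hcol : ∑ i ∈ Finset.range (ν + 1), (Nat.gcd (p ^ i) (p ^ (ν + 1)) : ℝ) /
      (√((p ^ i : ℕ) : ℝ) * √((p ^ (ν + 1) : ℕ) : ℝ)) =
      ∑ h ∈ Finset.range (ν + 1), (1 / √(p : ℝ)) ^ (h + 1) := by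
    rw [← hrow]
    exact Finset.sum_congr rfl fun i _ => gcd_div_sqrt_comm _ _
  have hdiag := gcd_prime_pow_div_sqrt hp (le_refl (ν + 1))
  rw [Nat.sub_self, pow_zero] at hdiag
  rw [Finset.sum_range_succ]
  simp_rw [Finset.sum_range_succ _ (ν + 1)]
  rw [Finset.sum_add_distrib, hrow, hcol, hdiag]
  ring

/-- `S(T_{p^ν})` up to an error `O(ν / p)`, by induction on `ν`; the higher powers of `1/√p` are summed
as a geometric series of ratio at most `1/√2`. -/
theorem galSum_divisors_prime_pow_bounds {p : ℕ} (hp : p.Prime) (ν : ℕ) :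
    (ν + 1 : ℝ) + 2 * ν * (1 / √p) ≤ galSum (1 / 2) (p ^ ν).divisors ∧
    galSum (1 / 2) (p ^ ν).divisors ≤ (ν + 1 : ℝ) + 2 * ν * (1 / √p) + 7 * ν * (1 / p) := by
  have hp2 : (2 : ℝ) ≤ p := by exact_mod_cast hp.two_le
  have hp0 : (0 : ℝ) < p := by linarith
  set r := 1 / √(p : ℝ) with hr
  have hr0 : 0 < r := by positivity
  have hrr : r ^ 2 = 1 / p := by rw [hr, div_pow, Real.sq_sqrt hp0.le]; norm_num
  have hr1 : r ≤ 5 / 7 := by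
    have : r ^ 2 ≤ 1 / 2 := by rw [hrr]; gcongr
    nlinarith
  induction ν with
  | zero => simp [galSum]
  | succ ν ih =>
    rw [galSum_divisors_prime_pow_succ hp ν]
    have hlow : r ≤ ∑ h ∈ Finset.range (ν + 1), r ^ (h + 1) := by
      rw [Finset.sum_range_succ']
      have : 0 ≤ ∑ h ∈ Finset.range ν, r ^ (h + 1 + 1) := Finset.sum_nonneg fun _ _ => by positivity
      simpa using this
    have hup : ∑ h ∈ Finset.range (ν + 1), r ^ (h + 1) ≤ r + 7 / 2 * r ^ 2 := by
      rw [Finset.sum_range_succ']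
      have hg : ∑ h ∈ Finset.range ν, r ^ h ≤ 7 / 2 := by
        have h1 := geom_sum_mul_neg r ν
        have h2 : 0 < r ^ ν := by positivity
        have h3 : 0 ≤ ∑ h ∈ Finset.range ν, r ^ h := Finset.sum_nonneg fun _ _ => by positivity
        nlinarith
      have e : ∑ h ∈ Finset.range ν, r ^ (h + 1 + 1) = r ^ 2 * ∑ h ∈ Finset.range ν, r ^ h := by
        rw [Finset.mul_sum]
        exact Finset.sum_congr rfl fun h _ => by ring
      rw [e]
      have : r ^ 2 * ∑ h ∈ Finset.range ν, r ^ h ≤ r ^ 2 * (7 / 2) := by gcongr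
      simp only [zero_add, pow_one]
      linarith
    rw [← hrr] at ih ⊢
    push_cast
    constructor <;> nlinarith [ih.1, ih.2]

/-- The linearisation of `log (S(T_D) / τ(D))`: the sum over `p ^ ν ∥ D` of
`2 ν / ((ν + 1) √p)`. -/
noncomputable def linSum (D : ℕ) : ℝ :=
  ∑ p ∈ D.primeFactors, 2 * D.factorization p / ((D.factorization p + 1) * √(p : ℝ))

theorem log_card_divisors {D : ℕ} (hD : D ≠ 0) :
    Real.log D.divisors.card = ∑ p ∈ D.primeFactors, Real.log (D.factorization p + 1) := by
  rw [Nat.card_divisors hD]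
  push_cast
  rw [Real.log_prod]
  intro p _
  positivity

theorem card_divisors_pos {D : ℕ} (hD : D ≠ 0) : (0 : ℝ) < D.divisors.card := by
  exact_mod_cast Finset.card_pos.2 ⟨1, Nat.one_mem_divisors.2 hD⟩

theorem galSum_divisors_prime_pow_pos {p : ℕ} (hp : p.Prime) (ν : ℕ) :
    0 < galSum (1 / 2) (p ^ ν).divisors := by
  refine lt_of_lt_of_le ?_ (galSum_divisors_prime_pow_bounds hp ν).1
  positivity

theorem galSum_divisors_pos {D : ℕ} (hD : D ≠ 0) : 0 < galSum (1 / 2) D.divisors := by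
  rw [galSum_divisors_eq_prod hD]
  exact Finset.prod_pos fun p hp =>
    galSum_divisors_prime_pow_pos (Nat.prime_of_mem_primeFactors hp) _

theorem log_galSum_div_card {D : ℕ} (hD : D ≠ 0) :
    Real.log (galSum (1 / 2) D.divisors / D.divisors.card) =
      ∑ p ∈ D.primeFactors, Real.log (galSum (1 / 2) (p ^ D.factorization p).divisors /
        (D.factorization p + 1)) := by
  rw [Real.log_div (galSum_divisors_pos hD).ne' (card_divisors_pos hD).ne', log_card_divisors hD,
    galSum_divisors_eq_prod hD, Real.log_prod, ← Finset.sum_sub_distrib]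
  · refine Finset.sum_congr rfl fun p hp => ?_
    rw [Real.log_div (galSum_divisors_prime_pow_pos (Nat.prime_of_mem_primeFactors hp) _).ne'
      (by positivity)]
  · intro p hp
    exact (galSum_divisors_prime_pow_pos (Nat.prime_of_mem_primeFactors hp) _).ne'

/-- Both the terms of `S(T_{p^ν})` beyond the first order and the quadratic term of the logarithm are
`O(1/p)`. -/
theorem abs_log_galSum_div_card_sub_linSum_le {D : ℕ} (hD : D ≠ 0) :
    |Real.log (galSum (1 / 2) D.divisors / D.divisors.card) - linSum D| ≤
      7 * ∑ p ∈ D.primeFactors, 1 / (p : ℝ) := by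
  rw [log_galSum_div_card hD, linSum, ← Finset.sum_sub_distrib, Finset.mul_sum]
  refine (Finset.abs_sum_le_sum_abs _ _).trans (Finset.sum_le_sum fun p hp => ?_)
  have hpp := Nat.prime_of_mem_primeFactors hp
  have hp0 : (0 : ℝ) < p := by exact_mod_cast hpp.pos
  have hs : 0 < √(p : ℝ) := Real.sqrt_pos.2 hp0
  have hsq : √(p : ℝ) ^ 2 = p := Real.sq_sqrt hp0.le
  obtain ⟨h1, h2⟩ := galSum_divisors_prime_pow_bounds hpp (D.factorization p)
  set ν : ℝ := (D.factorization p : ℝ)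
  have hν : 0 ≤ ν := Nat.cast_nonneg _
  have hν1 : 0 < ν + 1 := by linarith
  set y := 2 * ν / ((ν + 1) * √(p : ℝ)) with hy
  have hy0 : 0 ≤ y := by positivity
  have l1 : 1 + y ≤ galSum (1 / 2) (p ^ D.factorization p).divisors / (ν + 1) := by
    rw [le_div_iff₀ hν1]
    refine le_trans (le_of_eq ?_) h1
    rw [hy]
    field_simp
  have l2 : galSum (1 / 2) (p ^ D.factorization p).divisors / (ν + 1) ≤ 1 + (y + 7 * (1 / p)) := by
    rw [div_le_iff₀ hν1]
    refine h2.trans ?_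
    have e : (1 + (y + 7 * (1 / (p : ℝ)))) * (ν + 1) =
        (ν + 1) + 2 * ν * (1 / √p) + 7 * ν * (1 / p) + 7 * (1 / p) := by
      rw [hy]
      field_simp
      ring
    rw [e]
    have : 0 < 7 * (1 / (p : ℝ)) := by positivity
    linarith
  have hpos : 0 < galSum (1 / 2) (p ^ D.factorization p).divisors / (ν + 1) := by linarith
  have u : Real.log (galSum (1 / 2) (p ^ D.factorization p).divisors / (ν + 1)) ≤
      y + 7 * (1 / p) := by
    have := Real.log_le_sub_one_of_pos hpos
    linarith
  have hyp : y ^ 2 ≤ 4 * (1 / p) := by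
    have hy2 : y ≤ 2 * (1 / √p) := by
      rw [hy, div_le_iff₀ (by positivity)]
      have e : 2 * (1 / √(p : ℝ)) * ((ν + 1) * √p) = 2 * (ν + 1) := by field_simp
      rw [e]; linarith
    calc y ^ 2 ≤ (2 * (1 / √(p : ℝ))) ^ 2 := by gcongr
      _ = 4 * (1 / √(p : ℝ) ^ 2) := by ring
      _ = _ := by rw [hsq]
  have l : y - 2 * (1 / p) ≤
      Real.log (galSum (1 / 2) (p ^ D.factorization p).divisors / (ν + 1)) := by
    refine le_trans ?_ (Real.log_le_log (by linarith) l1)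
    refine le_trans ?_ (Real.le_log_one_add_of_nonneg hy0)
    rw [le_div_iff₀ (by linarith)]
    nlinarith
  have : 0 < 1 / (p : ℝ) := by positivity
  rw [abs_le]
  constructor <;> linarith

/-- An integer with `log τ(D) ≤ L` has at most `L / log 2` prime factors. -/
theorem sum_one_div_primeFactors_le {D : ℕ} (hD : D ≠ 0) {L : ℝ} (hL : 1 ≤ L)
    (hDL : Real.log D.divisors.card ≤ L) :
    ∑ p ∈ D.primeFactors, 1 / (p : ℝ) ≤ 4 + Real.log L := by
  have hω : (D.primeFactors.card : ℝ) ≤ 2 * L := by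
    have h1 : D.primeFactors.card * Real.log 2 ≤ L := by
      refine le_trans ?_ hDL
      rw [log_card_divisors hD, ← nsmul_eq_mul, ← Finset.sum_const]
      refine Finset.sum_le_sum fun p hp => ?_
      have hp1 : 1 ≤ D.factorization p :=
        (Nat.prime_of_mem_primeFactors hp).factorization_pos_of_dvd hD
          (Nat.dvd_of_mem_primeFactors hp)
      have : (1 : ℝ) ≤ D.factorization p := by exact_mod_cast hp1
      exact Real.log_le_log (by norm_num) (by linarith)
    have h2 := Real.log_two_gt_d9
    have h3 : (0 : ℝ) ≤ D.primeFactors.card := Nat.cast_nonneg _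
    nlinarith
  set M := ⌊2 * L⌋₊ with hM
  have hM1 : 1 ≤ M := Nat.le_floor (by push_cast; linarith)
  have hM0 : (0 : ℝ) < M := by exact_mod_cast hM1
  have hML : (M : ℝ) ≤ 2 * L := Nat.floor_le (by linarith)
  have hωM : (D.primeFactors.card : ℝ) ≤ M := by exact_mod_cast Nat.le_floor hω
  -- primes up to `M` contribute a harmonic sum, the others at most `1 / M` each
  have hterm : ∀ p ∈ D.primeFactors, 1 / (p : ℝ) ≤ (if p ≤ M then 1 / (p : ℝ) else 0) + 1 / M := by
    intro p _
    split_ifs with h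
    · have : 0 < 1 / (M : ℝ) := by positivity
      linarith
    · rw [zero_add]
      gcongr
      exact (not_le.1 h).le
  have hharm : ∑ p ∈ D.primeFactors, (if p ≤ M then 1 / (p : ℝ) else 0) ≤ 1 + Real.log M := by
    refine le_trans ?_ (harmonic_le_one_add_log M)
    have e : ((harmonic M : ℚ) : ℝ) = ∑ n ∈ Finset.Icc 1 M, 1 / (n : ℝ) := by
      rw [harmonic_eq_sum_Icc]
      push_cast
      simp
    rw [e, ← Finset.sum_filter]
    refine Finset.sum_le_sum_of_subset_of_nonneg ?_ (fun _ _ _ => by positivity)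
    intro p hp
    have h := Finset.mem_filter.1 hp
    exact Finset.mem_Icc.2 ⟨(Nat.prime_of_mem_primeFactors h.1).one_le, h.2⟩
  have hlogM : Real.log M ≤ 1 + Real.log L := by
    have h1 := Real.log_le_log hM0 hML
    rw [Real.log_mul (by norm_num) (by linarith)] at h1
    have := Real.log_two_lt_d9
    linarith
  calc _ ≤ ∑ p ∈ D.primeFactors, ((if p ≤ M then 1 / (p : ℝ) else 0) + 1 / M) :=
        Finset.sum_le_sum hterm
    _ = ∑ p ∈ D.primeFactors, (if p ≤ M then 1 / (p : ℝ) else 0) +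
        D.primeFactors.card * (1 / M) := by
        rw [Finset.sum_add_distrib, Finset.sum_const, nsmul_eq_mul]
    _ ≤ (1 + Real.log M) + 1 := by
        gcongr
        rw [mul_one_div, div_le_one hM0]
        exact hωM
    _ ≤ _ := by linarith

end GalDivisors

/-! ### The thresholds and the dual function -/

namespace GalDivisors

open Filter Topology Asymptotics

/-- The threshold coefficient `c_k = 1 / (k (k + 1) log (1 + 1/k))`: at the level `x`, raising the
exponent of `p` from `k - 1` to `k` is worth its cost exactly when `p ≤ x c_k²`. -/
noncomputable def threshold (k : ℕ) : ℝ := 1 / (k * (k + 1) * Real.log (1 + 1 / k))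

/-- The gain `2 / (k (k + 1))`, in units of `1/√p`, of raising an exponent from `k - 1` to `k`. -/
noncomputable def gain (k : ℕ) : ℝ := 2 / (k * (k + 1))

/-- The `k`-th term of the series for the constant of the asymptotic formula. -/
noncomputable def constTerm (k : ℕ) : ℝ :=
  1 / ((k : ℝ) ^ 2 * (1 + (k : ℝ)) ^ 2 * Real.log (1 + 1 / (k : ℝ)))

theorem inv_succ_le_log {k : ℕ} (hk : 1 ≤ k) : 1 / ((k : ℝ) + 1) ≤ Real.log (1 + 1 / k) := by
  have hk0 : (0 : ℝ) < k := by exact_mod_cast hk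
  have := Real.one_sub_inv_le_log_of_pos (x := 1 + 1 / (k : ℝ)) (by positivity)
  refine le_trans (le_of_eq ?_) this
  field_simp
  ring

theorem log_le_inv {k : ℕ} : Real.log (1 + 1 / (k : ℝ)) ≤ 1 / k := by
  have := Real.log_le_sub_one_of_pos (x := 1 + 1 / (k : ℝ)) (by positivity)
  linarith

theorem log_one_add_inv_pos {k : ℕ} (hk : 1 ≤ k) : 0 < Real.log (1 + 1 / (k : ℝ)) :=
  lt_of_lt_of_le (by positivity) (inv_succ_le_log hk)

theorem threshold_pos {k : ℕ} (hk : 1 ≤ k) : 0 < threshold k := by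
  have hk0 : (0 : ℝ) < k := by exact_mod_cast hk
  have := log_one_add_inv_pos hk
  unfold threshold
  positivity

theorem gain_pos {k : ℕ} (hk : 1 ≤ k) : 0 < gain k := by
  have hk0 : (0 : ℝ) < k := by exact_mod_cast hk
  unfold gain
  positivity

theorem constTerm_pos {k : ℕ} (hk : 1 ≤ k) : 0 < constTerm k := by
  have hk0 : (0 : ℝ) < k := by exact_mod_cast hk
  have := log_one_add_inv_pos hk
  unfold constTerm
  positivity

theorem threshold_le {k : ℕ} (hk : 1 ≤ k) : threshold k ≤ 1 / k := by
  have hk0 : (0 : ℝ) < k := by exact_mod_cast hk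
  have h := inv_succ_le_log hk
  unfold threshold
  gcongr
  calc (k : ℝ) = k * (k + 1) * (1 / (k + 1)) := by field_simp
    _ ≤ _ := by gcongr

theorem threshold_le_one {k : ℕ} (hk : 1 ≤ k) : threshold k ≤ 1 := by
  refine (threshold_le hk).trans ?_
  rw [div_le_one (by exact_mod_cast hk)]
  exact_mod_cast hk

theorem le_threshold {k : ℕ} (hk : 1 ≤ k) : 1 / ((k : ℝ) + 1) ≤ threshold k := by
  have hk0 : (0 : ℝ) < k := by exact_mod_cast hk
  have h := log_le_inv (k := k)
  have h0 := log_one_add_inv_pos hk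
  unfold threshold
  gcongr
  calc _ ≤ (k : ℝ) * (k + 1) * (1 / k) := by gcongr
    _ = _ := by field_simp

theorem threshold_succ_le {k : ℕ} (hk : 1 ≤ k) : threshold (k + 1) ≤ threshold k := by
  have hk0 : (0 : ℝ) < k := by exact_mod_cast hk
  have h0 := log_one_add_inv_pos hk
  have h1 := log_le_inv (k := k)
  have h2 := inv_succ_le_log (k := k + 1) (by omega)
  unfold threshold
  push_cast at h2 ⊢
  gcongr 1 / ?_
  have e1 : (k : ℝ) * Real.log (1 + 1 / k) ≤ 1 := by
    calc _ ≤ (k : ℝ) * (1 / k) := by gcongr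
      _ = 1 := by field_simp
  have e2 : 1 ≤ ((k : ℝ) + 1 + 1) * Real.log (1 + 1 / (k + 1)) := by
    calc (1 : ℝ) = ((k : ℝ) + 1 + 1) * (1 / (k + 1 + 1)) := by field_simp
      _ ≤ _ := by gcongr
  calc (k : ℝ) * (k + 1) * Real.log (1 + 1 / k) = (k + 1) * (k * Real.log (1 + 1 / k)) := by ring
    _ ≤ (k + 1) * (((k : ℝ) + 1 + 1) * Real.log (1 + 1 / (k + 1))) :=
        mul_le_mul_of_nonneg_left (e1.trans e2) (by positivity)
    _ = _ := by ring

theorem threshold_anti {j k : ℕ} (hj : 1 ≤ j) (hjk : j ≤ k) : threshold k ≤ threshold j := by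
  induction k, hjk using Nat.le_induction with
  | base => exact le_rfl
  | succ k hk ih => exact (threshold_succ_le (hj.trans hk)).trans ih

theorem gain_mul_threshold {k : ℕ} (hk : 1 ≤ k) : gain k * threshold k = 2 * constTerm k := by
  have hk0 : (0 : ℝ) < k := by exact_mod_cast hk
  have h0 := log_one_add_inv_pos hk
  unfold gain threshold constTerm
  field_simp
  ring

theorem threshold_one_sq_lt_one : threshold 1 ^ 2 < 1 := by
  have h : threshold 1 = 1 / (2 * Real.log 2) := by
    unfold threshold; norm_num
  have h2 := Real.log_two_gt_d9
  rw [h, div_pow, one_pow, div_lt_one (by positivity)]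
  nlinarith

theorem constTerm_le {k : ℕ} (hk : 1 ≤ k) : constTerm k ≤ 1 / (k : ℝ) - 1 / (k + 1) := by
  have hk1 : (1 : ℝ) ≤ k := by exact_mod_cast hk
  have hk0 : (0 : ℝ) < k := by linarith
  have h := gain_mul_threshold hk
  have h1 := threshold_le_one hk
  have h2 : gain k * threshold k ≤ gain k := mul_le_of_le_one_right (gain_pos hk).le h1
  have e : 1 / (k : ℝ) - 1 / (k + 1) = gain k / 2 := by
    unfold gain; field_simp; ring
  rw [e]
  linarith

theorem sum_Ioc_telescope_le {m M : ℕ} :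
    ∑ k ∈ Finset.Ioc m M, (1 / (k : ℝ) - 1 / (k + 1)) ≤ 1 / (m + 1) := by
  rcases le_or_gt m M with h | h
  · have : ∑ k ∈ Finset.Ioc m M, (1 / (k : ℝ) - 1 / (k + 1)) = 1 / ((m : ℝ) + 1) - 1 / (M + 1) := by
      induction M, h using Nat.le_induction with
      | base => simp
      | succ M hM ih =>
        rw [Finset.sum_Ioc_succ_top hM, ih]
        push_cast
        ring
    rw [this]
    have : 0 < 1 / ((M : ℝ) + 1) := by positivity
    linarith
  · rw [Finset.Ioc_eq_empty (by omega)]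
    simp only [Finset.sum_empty]
    positivity

open Classical in
/-- The exponents in `K` between `1` and `M`. -/
noncomputable def expRange (K : Set ℕ) (M : ℕ) : Finset ℕ := (Finset.Icc 1 M).filter (· ∈ K)

theorem mem_expRange {K : Set ℕ} {M k : ℕ} : k ∈ expRange K M ↔ (1 ≤ k ∧ k ≤ M) ∧ k ∈ K := by
  simp [expRange]

theorem expRange_mono {K : Set ℕ} {M M' : ℕ} (h : M ≤ M') : expRange K M ⊆ expRange K M' := by
  intro k hk
  rw [mem_expRange] at hk ⊢
  exact ⟨⟨hk.1.1, hk.1.2.trans h⟩, hk.2⟩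

/-- `A` is the value of the series `∑ k ∈ K, k ≥ 1` of `constTerm k`. -/
def IsConst (K : Set ℕ) (A : ℝ) : Prop :=
  Tendsto (fun M => ∑ k ∈ expRange K M, constTerm k) atTop (𝓝 A)

theorem IsConst.sum_le {K : Set ℕ} {A : ℝ} (h : IsConst K A) (M : ℕ) :
    ∑ k ∈ expRange K M, constTerm k ≤ A := by
  refine ge_of_tendsto h ?_
  filter_upwards [eventually_ge_atTop M] with M' hM'
  exact Finset.sum_le_sum_of_subset_of_nonneg (expRange_mono hM') fun k hk _ =>
    (constTerm_pos (mem_expRange.1 hk).1.1).le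

theorem sum_constTerm_tail_le {K : Set ℕ} {T : ℝ} (hT : 0 < T) (M : ℕ) :
    ∑ k ∈ (expRange K M).filter (fun k : ℕ => T < (k : ℝ)), constTerm k ≤ 1 / T := by
  calc ∑ k ∈ (expRange K M).filter (fun k : ℕ => T < (k : ℝ)), constTerm k
      ≤ ∑ k ∈ Finset.Ioc ⌊T⌋₊ M, constTerm k := by
        refine Finset.sum_le_sum_of_subset_of_nonneg ?_ ?_
        · intro k hk
          have h1 := Finset.mem_filter.1 hk
          have h2 := mem_expRange.1 h1.1
          exact Finset.mem_Ioc.2 ⟨(Nat.floor_lt hT.le).2 h1.2, h2.1.2⟩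
        · intro k hk _
          have := (Finset.mem_Ioc.1 hk).1
          exact (constTerm_pos (by omega)).le
    _ ≤ ∑ k ∈ Finset.Ioc ⌊T⌋₊ M, (1 / (k : ℝ) - 1 / (k + 1)) :=
        Finset.sum_le_sum fun k hk => constTerm_le (by have := (Finset.mem_Ioc.1 hk).1; omega)
    _ ≤ 1 / (⌊T⌋₊ + 1) := sum_Ioc_telescope_le
    _ ≤ 1 / T := by
        gcongr
        exact (Nat.lt_floor_add_one T).le

theorem IsConst.le_sum_add {K : Set ℕ} {A : ℝ} (h : IsConst K A) {T : ℝ} (hT : 0 < T) {M : ℕ}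
    (hM : T ≤ M) :
    A ≤ ∑ k ∈ (expRange K M).filter (fun k : ℕ => (k : ℝ) ≤ T), constTerm k + 1 / T := by
  refine le_of_tendsto h ?_
  filter_upwards [eventually_ge_atTop M] with M' hM'
  rw [← Finset.sum_filter_add_sum_filter_not (expRange K M') (fun k : ℕ => (k : ℝ) ≤ T)]
  refine add_le_add (le_of_eq ?_) ?_
  · refine Finset.sum_congr ?_ fun _ _ => rfl
    ext k
    simp only [Finset.mem_filter, mem_expRange]
    constructor
    · rintro ⟨⟨⟨a, b⟩, c⟩, d⟩
      exact ⟨⟨⟨a, by exact_mod_cast d.trans hM⟩, c⟩, d⟩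
    · rintro ⟨⟨⟨a, b⟩, c⟩, d⟩
      exact ⟨⟨⟨a, b.trans hM'⟩, c⟩, d⟩
  · simp only [not_le]
    exact sum_constTerm_tail_le hT M'

theorem IsConst.pos {K : Set ℕ} {A : ℝ} (h : IsConst K A) (h1 : 1 ∈ K) : 0 < A := by
  refine lt_of_lt_of_le ?_ (h.sum_le 1)
  have : expRange K 1 = {1} := by
    ext k
    simp only [mem_expRange, Finset.mem_singleton]
    constructor
    · rintro ⟨⟨a, b⟩, -⟩; omega
    · rintro rfl; exact ⟨⟨le_rfl, le_rfl⟩, h1⟩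
  rw [this, Finset.sum_singleton]
  exact constTerm_pos le_rfl

/-- The dual function of the optimisation problem at the level `x`, restricted to exponents up to
`M`: for `M` large this is the maximum over `D` of `linSum D - (2 / √x) log τ(D)`. -/
noncomputable def dualSum (K : Set ℕ) (x : ℝ) (M : ℕ) : ℝ :=
  ∑ k ∈ expRange K M, gain k * primeSum (x * threshold k ^ 2)

theorem dualSum_nonneg (K : Set ℕ) (x : ℝ) (M : ℕ) : 0 ≤ dualSum K x M :=
  Finset.sum_nonneg fun _ hk =>
    mul_nonneg (gain_pos (mem_expRange.1 hk).1.1).le (primeSum_nonneg _)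

/-- Asymptotics of the prime sums at the individual thresholds, uniformly for `k ≤ (log x)²`. -/
theorem exists_abs_primeSum_threshold_sub_le :
    ∃ C X : ℝ, 0 < C ∧ Real.exp (Real.exp 1) ≤ X ∧ ∀ x : ℝ, X ≤ x → Real.log x ^ 2 ≤ x ∧
      ∀ k : ℕ, 1 ≤ k → (k : ℝ) ≤ Real.log x ^ 2 →
      |primeSum (x * threshold k ^ 2) - threshold k * (√x / Real.log x)| ≤
        C * (threshold k * (√x / Real.log x)) * (Real.log (Real.log x) / Real.log x) := by
  obtain ⟨C, X₀, hC, hX₀, h⟩ := exists_abs_primeSum_sub_le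
  have hev1 : ∀ᶠ x : ℝ in atTop, 12 * Real.log (Real.log x) ≤ Real.log x := by
    have h1 : ∀ᶠ y : ℝ in atTop, Real.log y ≤ 1 / 12 * y := by
      have := Real.isLittleO_log_id_atTop.bound (show (0 : ℝ) < 1 / 12 by norm_num)
      filter_upwards [this, eventually_ge_atTop 1] with y hy hy1
      rw [Real.norm_of_nonneg (Real.log_nonneg hy1), id, Real.norm_of_nonneg (by linarith)] at hy
      exact hy
    filter_upwards [Real.tendsto_log_atTop.eventually h1] with x hx
    linarith
  have hev2 : ∀ᶠ x : ℝ in atTop, Real.log x ^ 2 ≤ x := by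
    have := (Real.isLittleO_pow_log_id_atTop (n := 2)).bound (show (0 : ℝ) < 1 by norm_num)
    filter_upwards [this, eventually_ge_atTop 1] with y hy hy1
    rwa [Real.norm_of_nonneg (by positivity), id, Real.norm_of_nonneg (by linarith), one_mul] at hy
  obtain ⟨X, hX⟩ := eventually_atTop.1 (hev1.and hev2)
  refine ⟨12 + 2 * C + 24 * C, max (max X (X₀ ^ 2)) (Real.exp (Real.exp 1)), by positivity,
    le_max_right _ _, fun x hx => ⟨(hX x ((le_max_left _ _).trans ((le_max_left _ _).trans hx))).2,
    fun k hk hkL => ?_⟩⟩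
  have hx1 : Real.exp (Real.exp 1) ≤ x := (le_max_right _ _).trans hx
  have hxX := (hX x ((le_max_left _ _).trans ((le_max_left _ _).trans hx))).1
  have hxX₀ : X₀ ^ 2 ≤ x := (le_max_right _ _).trans ((le_max_left _ _).trans hx)
  have hx0 : 0 < x := (Real.exp_pos _).trans_le hx1
  have hX₀0 : 0 < X₀ := (Real.exp_pos _).trans_le hX₀
  set L := Real.log x with hL
  have hLe : Real.exp 1 ≤ L := by rw [hL, Real.le_log_iff_exp_le hx0]; exact hx1
  have hL0 : 0 < L := (Real.exp_pos _).trans_le hLe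
  have hL2 : 2 ≤ L := by have := Real.add_one_le_exp (1 : ℝ); linarith
  set l := Real.log L with hl
  have hl1 : 1 ≤ l := by rw [hl, Real.le_log_iff_exp_le hL0]; exact hLe
  set c := threshold k with hc
  have hc0 : 0 < c := threshold_pos hk
  have hc1 : c ≤ 1 := threshold_le_one hk
  have hcL : 1 / (2 * L ^ 2) ≤ c := by
    refine le_trans ?_ (le_threshold hk)
    gcongr
    nlinarith
  set y := x * c ^ 2 with hy
  have hy0 : 0 < y := by positivity
  have hyx : y ≤ x := mul_le_of_le_one_right hx0.le (pow_le_one₀ hc0.le hc1)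
  have hsy : √y = c * √x := by
    rw [hy, Real.sqrt_mul hx0.le, Real.sqrt_sq hc0.le, mul_comm]
  have hlogy_le : Real.log y ≤ L := Real.log_le_log hy0 hyx
  -- `c_k` is at least of order `1 / (log x)²`, so `log y` is `log x + O(log log x)`
  have hlogy_ge : L - 6 * l ≤ Real.log y := by
    have e : Real.log (1 / (2 * L ^ 2)) = -(Real.log 2 + 2 * l) := by
      rw [one_div, Real.log_inv, Real.log_mul (by norm_num) (by positivity), Real.log_pow]
      norm_num [hl]
    have h1 := Real.log_le_log (by positivity) hcL
    rw [e] at h1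
    rw [hy, Real.log_mul hx0.ne' (by positivity), Real.log_pow]
    have := Real.log_two_lt_d9
    push_cast
    linarith
  have hlogy_half : L / 2 ≤ Real.log y := by linarith
  have hyX₀ : X₀ ≤ y := by
    have h1 : √x ≤ y := by
      rw [← Real.log_le_log_iff (Real.sqrt_pos.2 hx0) hy0, Real.log_sqrt hx0.le]
      exact hlogy_half
    refine le_trans ?_ h1
    exact Real.le_sqrt_of_sq_le hxX₀
  have hye : Real.exp 1 ≤ Real.log y := by
    rw [Real.le_log_iff_exp_le hy0]; exact hX₀.trans hyX₀
  have hly0 : 0 < Real.log y := (Real.exp_pos 1).trans_le hye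
  have hll : Real.log (Real.log y) ≤ l := Real.log_le_log hly0 hlogy_le
  have hll0 : 0 ≤ Real.log (Real.log y) := by
    apply Real.log_nonneg
    have := Real.add_one_le_exp (1 : ℝ); linarith
  have key := h y hyX₀
  rw [hsy] at key
  have hinv : 1 / Real.log y ≤ 1 / L * (1 + 12 * (l / L)) := by
    rw [div_le_iff₀ hly0]
    have e : 1 / L * (1 + 12 * (l / L)) * (L - 6 * l) = 1 + 6 * l * (L - 12 * l) / L ^ 2 := by
      field_simp
      ring
    have h1 : 0 ≤ 6 * l * (L - 12 * l) / L ^ 2 := by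
      have : 0 ≤ L - 12 * l := by linarith
      positivity
    have h2 : 1 / L * (1 + 12 * (l / L)) * (L - 6 * l) ≤
        1 / L * (1 + 12 * (l / L)) * Real.log y := by gcongr
    linarith
  have hinv' : 1 / L ≤ 1 / Real.log y := by gcongr
  have hinv2 : 1 / Real.log y ≤ 2 * (1 / L) := by
    rw [div_le_iff₀ hly0]
    have : 2 * (1 / L) * (L / 2) = 1 := by field_simp
    have : 2 * (1 / L) * (L / 2) ≤ 2 * (1 / L) * Real.log y := by gcongr
    linarith
  have hr0 : 0 < l / L := by positivity
  have hs : 0 < c * √x := mul_pos hc0 (Real.sqrt_pos.2 hx0)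
  have hrat : Real.log (Real.log y) / Real.log y ≤ 2 * (l / L) := by
    calc Real.log (Real.log y) / Real.log y = Real.log (Real.log y) * (1 / Real.log y) := by ring
      _ ≤ l * (2 * (1 / L)) := by gcongr
      _ = _ := by ring
  have hq : c * √x / Real.log y ≤ c * √x * (1 / L * (1 + 12 * (l / L))) := by
    rw [div_eq_mul_one_div]; gcongr
  have hq' : c * √x * (1 / L) ≤ c * √x / Real.log y := by
    rw [div_eq_mul_one_div (c * √x) (Real.log y)]; gcongr
  have hq2 : c * √x / Real.log y ≤ c * √x * (2 * (1 / L)) := by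
    rw [div_eq_mul_one_div]; gcongr
  have herr : C * (c * √x / Real.log y) * (Real.log (Real.log y) / Real.log y) ≤
      C * (c * √x * (2 * (1 / L))) * (2 * (l / L)) := by
    gcongr
  have e1 : c * (√x / L) = c * √x * (1 / L) := by ring
  rw [e1]
  have hP : 0 < c * √x * (1 / L) * (l / L) := by positivity
  rw [abs_le] at key ⊢
  have hCP : 0 < C * (c * √x * (1 / L)) * (l / L) := by positivity
  constructor
  · nlinarith [key.1]
  · nlinarith [key.2]

/-- Asymptotics of the dual function. -/
theorem exists_dualSum_bounds {K : Set ℕ} {A : ℝ} (hA : IsConst K A) (h1 : 1 ∈ K) :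
    ∃ C X : ℝ, 0 < C ∧ Real.exp (Real.exp 1) ≤ X ∧ ∀ x : ℝ, X ≤ x → ∀ M : ℕ,
      dualSum K x M ≤
        2 * A * (√x / Real.log x) * (1 + C * (Real.log (Real.log x) / Real.log x)) ∧
      (x ≤ M → 2 * A * (√x / Real.log x) * (1 - C * (Real.log (Real.log x) / Real.log x)) ≤
        dualSum K x M) := by
  obtain ⟨C, X, hC, hX, h⟩ := exists_abs_primeSum_threshold_sub_le
  have hA0 := hA.pos h1
  refine ⟨C + 2 / A, X, by positivity, hX, fun x hx M => ?_⟩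
  have hx1 : Real.exp (Real.exp 1) ≤ x := hX.trans hx
  obtain ⟨hLx, hk⟩ := h x hx
  have hx0 : 0 < x := (Real.exp_pos _).trans_le hx1
  set L := Real.log x with hL
  have hLe : Real.exp 1 ≤ L := by rw [hL, Real.le_log_iff_exp_le hx0]; exact hx1
  have hL0 : 0 < L := (Real.exp_pos _).trans_le hLe
  set l := Real.log L with hl
  have hl1 : 1 ≤ l := by rw [hl, Real.le_log_iff_exp_le hL0]; exact hLe
  set q := √x / L with hq
  have hs0 : 0 < √x := Real.sqrt_pos.2 hx0
  have hq0 : 0 < q := by positivity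
  set r := l / L with hr
  have hr0 : 0 < r := by positivity
  have hLr : 1 / L ≤ r := by rw [hr]; gcongr
  -- the exponents `k > (log x)²` form a negligible tail
  set S₁ := (expRange K M).filter (fun k : ℕ => (k : ℝ) ≤ L ^ 2) with hS₁
  set S₂ := (expRange K M).filter (fun k : ℕ => L ^ 2 < (k : ℝ)) with hS₂
  have hsplit : dualSum K x M = ∑ k ∈ S₁, gain k * primeSum (x * threshold k ^ 2) +
      ∑ k ∈ S₂, gain k * primeSum (x * threshold k ^ 2) := by
    rw [dualSum, ← Finset.sum_filter_add_sum_filter_not _ (fun k : ℕ => (k : ℝ) ≤ L ^ 2)]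
    simp only [not_le, hS₁, hS₂]
  have hmem : ∀ k ∈ expRange K M, 1 ≤ k := fun k hk => (mem_expRange.1 hk).1.1
  have hS₁mem : ∀ k ∈ S₁, 1 ≤ k := fun k hk => hmem k (Finset.mem_filter.1 hk).1
  have hS₁A : ∑ k ∈ S₁, constTerm k ≤ A :=
    (Finset.sum_le_sum_of_subset_of_nonneg (Finset.filter_subset _ _) fun k hk _ =>
      (constTerm_pos (hmem k hk)).le).trans (hA.sum_le M)
  have hterm : ∀ k ∈ S₁, 2 * constTerm k * (q - C * q * r) ≤
      gain k * primeSum (x * threshold k ^ 2) ∧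
      gain k * primeSum (x * threshold k ^ 2) ≤ 2 * constTerm k * (q + C * q * r) := by
    intro k hkS
    have h1k := hS₁mem k hkS
    have hb := hk k h1k (Finset.mem_filter.1 hkS).2
    rw [abs_le] at hb
    have hg := gain_pos h1k
    rw [← gain_mul_threshold h1k, mul_assoc _ _ (q - C * q * r), mul_assoc _ _ (q + C * q * r)]
    constructor
    · exact mul_le_mul_of_nonneg_left (by linarith [hb.1]) hg.le
    · exact mul_le_mul_of_nonneg_left (by linarith [hb.2]) hg.le
  have hlow1 : ∑ k ∈ S₁, 2 * constTerm k * (q - C * q * r) ≤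
      ∑ k ∈ S₁, gain k * primeSum (x * threshold k ^ 2) :=
    Finset.sum_le_sum fun k hk => (hterm k hk).1
  have hup1 : ∑ k ∈ S₁, gain k * primeSum (x * threshold k ^ 2) ≤
      ∑ k ∈ S₁, 2 * constTerm k * (q + C * q * r) :=
    Finset.sum_le_sum fun k hk => (hterm k hk).2
  rw [← Finset.sum_mul, ← Finset.mul_sum] at hlow1 hup1
  have hL2 : (0 : ℝ) < L ^ 2 := by positivity
  have htail : ∑ k ∈ S₂, gain k * primeSum (x * threshold k ^ 2) ≤ 4 * √x * (1 / L ^ 2) := by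
    calc ∑ k ∈ S₂, gain k * primeSum (x * threshold k ^ 2)
        ≤ ∑ k ∈ S₂, 4 * √x * constTerm k := by
          refine Finset.sum_le_sum fun k hk => ?_
          have h1k := hmem k (Finset.mem_filter.1 hk).1
          have hg := gain_pos h1k
          have hc := threshold_pos h1k
          have h2 := primeSum_le (x := x * threshold k ^ 2) (by positivity)
          rw [Real.sqrt_mul hx0.le, Real.sqrt_sq hc.le] at h2
          calc _ ≤ gain k * (2 * (√x * threshold k)) := by gcongr
            _ = 2 * √x * (gain k * threshold k) := by ring
            _ = _ := by rw [gain_mul_threshold h1k]; ring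
      _ = 4 * √x * ∑ k ∈ S₂, constTerm k := by rw [Finset.mul_sum]
      _ ≤ _ := by gcongr; exact sum_constTerm_tail_le hL2 M
  have htail0 : 0 ≤ ∑ k ∈ S₂, gain k * primeSum (x * threshold k ^ 2) :=
    Finset.sum_nonneg fun k hk =>
      mul_nonneg (gain_pos (hmem k (Finset.mem_filter.1 hk).1)).le (primeSum_nonneg _)
  have e4 : 4 * √x * (1 / L ^ 2) = 4 * q * (1 / L) := by rw [hq]; field_simp
  have e5 : 4 * q * (1 / L) ≤ 4 * q * r := by gcongr
  have e6 : 2 * A * q * (2 / A * r) = 4 * q * r := by field_simp; ring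
  have hCqr : 0 < C * q * r := by positivity
  rw [hsplit]
  constructor
  · have : 2 * (∑ k ∈ S₁, constTerm k) * (q + C * q * r) ≤ 2 * A * (q + C * q * r) := by
      gcongr
    nlinarith
  · intro hxM
    have hAle := hA.le_sum_add hL2 (M := M) (hLx.trans hxM)
    have hL2L : 1 / L ^ 2 ≤ r := by
      refine le_trans ?_ hLr
      have hL1 : 1 ≤ L := by have := Real.add_one_le_exp (1 : ℝ); linarith
      gcongr
      nlinarith
    have h7 : 2 * (A - r) * q ≤ 2 * (∑ k ∈ S₁, constTerm k) * q := by
      gcongr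
      linarith
    have h8 : 2 * (∑ k ∈ S₁, constTerm k) * (C * q * r) ≤ 2 * A * (C * q * r) := by gcongr
    have h9 : 0 < q * r := by positivity
    nlinarith

end GalDivisors

/-! ### Duality and the optimal integers -/

namespace GalDivisors

open Filter Topology Asymptotics

/-- All exponents of `D` lie in `K`, and so do the smaller positive ones. For `K = {1}` this says
that `D` is squarefree. -/
def ExpsIn (K : Set ℕ) (D : ℕ) : Prop := ∀ p k : ℕ, 1 ≤ k → k ≤ D.factorization p → k ∈ K

theorem sum_gain (ν : ℕ) : ∑ k ∈ Finset.Icc 1 ν, gain k = 2 * ν / (ν + 1) := by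
  induction ν with
  | zero => simp
  | succ ν ih =>
    rw [Finset.sum_Icc_succ_top (by omega), ih, gain]
    push_cast
    field_simp
    ring

theorem sum_log_one_add_inv (ν : ℕ) :
    ∑ k ∈ Finset.Icc 1 ν, Real.log (1 + 1 / (k : ℝ)) = Real.log (ν + 1) := by
  induction ν with
  | zero => simp
  | succ ν ih =>
    rw [Finset.sum_Icc_succ_top (by omega), ih, ← Real.log_mul (by positivity) (by positivity)]
    congr 1
    push_cast
    field_simp

/-- With the Lagrange multiplier `2 / √x` the cost of the step from `k - 1` to `k` equals its gain at
the threshold `p = x c_k²`. -/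
theorem multiplier_mul_log {x : ℝ} (hx : 0 < x) {k : ℕ} (hk : 1 ≤ k) :
    2 / √x * Real.log (1 + 1 / (k : ℝ)) = gain k * (1 / √(x * threshold k ^ 2)) := by
  have hk0 : (0 : ℝ) < k := by exact_mod_cast hk
  have h0 := log_one_add_inv_pos hk
  have hs := Real.sqrt_pos.2 hx
  rw [Real.sqrt_mul hx.le, Real.sqrt_sq (threshold_pos hk).le, gain, threshold]
  field_simp

/-- The Lagrangian as a sum over the steps `k - 1 → k` of the exponents. -/
theorem linSum_sub_multiplier {D : ℕ} (hD : D ≠ 0) {x : ℝ} (hx : 0 < x) :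
    linSum D - 2 / √x * Real.log D.divisors.card =
      ∑ p ∈ D.primeFactors, ∑ k ∈ Finset.Icc 1 (D.factorization p),
        gain k * (1 / √(p : ℝ) - 1 / √(x * threshold k ^ 2)) := by
  rw [linSum, log_card_divisors hD, Finset.mul_sum, ← Finset.sum_sub_distrib]
  refine Finset.sum_congr rfl fun p _ => ?_
  have e : ∀ k ∈ Finset.Icc 1 (D.factorization p),
      gain k * (1 / √(p : ℝ) - 1 / √(x * threshold k ^ 2)) =
      gain k * (1 / √p) - 2 / √x * Real.log (1 + 1 / (k : ℝ)) := fun k hk => by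
    rw [multiplier_mul_log hx (Finset.mem_Icc.1 hk).1]; ring
  rw [Finset.sum_congr rfl e, Finset.sum_sub_distrib, ← Finset.sum_mul, ← Finset.mul_sum, sum_gain,
    sum_log_one_add_inv]
  congr 1
  rw [div_mul_div_comm, mul_one]

/-- Weak duality: only the steps with `p ≤ x c_k²` contribute positively, and they are all contained in
the dual function. -/
theorem exists_linSum_le {K : Set ℕ} {D : ℕ} (hD : D ≠ 0) (hDK : ExpsIn K D) {x : ℝ} (hx : 0 < x) :
    ∃ M : ℕ, linSum D ≤ 2 / √x * Real.log D.divisors.card + dualSum K x M := by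
  set M := D.primeFactors.sup D.factorization with hM
  refine ⟨M, ?_⟩
  suffices h : linSum D - 2 / √x * Real.log D.divisors.card ≤ dualSum K x M by linarith
  rw [linSum_sub_multiplier hD hx]
  set t : ℕ → ℝ := fun k => x * threshold k ^ 2 with ht
  have ht0 : ∀ k, 1 ≤ k → 0 < t k := fun k hk => by
    have := threshold_pos hk
    simp only [ht]; positivity
  calc ∑ p ∈ D.primeFactors, ∑ k ∈ Finset.Icc 1 (D.factorization p),
        gain k * (1 / √(p : ℝ) - 1 / √(t k))
      ≤ ∑ p ∈ D.primeFactors, ∑ k ∈ expRange K M,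
        gain k * max 0 (1 / √(p : ℝ) - 1 / √(t k)) := by
        refine Finset.sum_le_sum fun p hp => ?_
        refine (Finset.sum_le_sum (g := fun k => gain k * max 0 (1 / √(p : ℝ) - 1 / √(t k)))
          fun k hk => ?_).trans (Finset.sum_le_sum_of_subset_of_nonneg ?_ ?_)
        · have := gain_pos (Finset.mem_Icc.1 hk).1
          gcongr
          exact le_max_right _ _
        · intro k hk
          have h1 := Finset.mem_Icc.1 hk
          exact mem_expRange.2 ⟨⟨h1.1, h1.2.trans (Finset.le_sup (f := D.factorization) hp)⟩,
            hDK p k h1.1 h1.2⟩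
        · intro k hk _
          exact mul_nonneg (gain_pos (mem_expRange.1 hk).1.1).le (le_max_left _ _)
    _ = ∑ k ∈ expRange K M, gain k * ∑ p ∈ D.primeFactors, max 0 (1 / √(p : ℝ) - 1 / √(t k)) := by
        rw [Finset.sum_comm]
        simp_rw [Finset.mul_sum]
    _ ≤ dualSum K x M := by
        refine Finset.sum_le_sum fun k hk => ?_
        have hk1 := (mem_expRange.1 hk).1.1
        have htk := ht0 k hk1
        refine mul_le_mul_of_nonneg_left ?_ (gain_pos hk1).le
        rw [primeSum]
        have e : ∀ p ∈ D.primeFactors, max 0 (1 / √(p : ℝ) - 1 / √(t k)) =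
            if (p : ℝ) ≤ t k then 1 / √(p : ℝ) - 1 / √(t k) else 0 := by
          intro p hp
          have hp0 : (0 : ℝ) < p := by exact_mod_cast (Nat.prime_of_mem_primeFactors hp).pos
          split_ifs with h
          · rw [max_eq_right]
            rw [sub_nonneg]
            gcongr
          · rw [max_eq_left]
            rw [sub_nonpos]
            gcongr
            exact (not_le.1 h).le
        rw [Finset.sum_congr rfl e, ← Finset.sum_filter]
        refine Finset.sum_le_sum_of_subset_of_nonneg ?_ fun p hp _ => inv_sqrt_sub_nonneg_of_mem hp
        intro p hp
        have h1 := Finset.mem_filter.1 hp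
        have hpp := Nat.prime_of_mem_primeFactors h1.1
        exact Finset.mem_filter.2 ⟨Finset.mem_Ioc.2 ⟨hpp.pos, Nat.le_floor h1.2⟩, hpp⟩

open Classical in
/-- The optimal exponent of `p` at the level `n`: the largest `k ∈ K` with `p ≤ n c_k²`, or `0`. -/
noncomputable def levelExp (K : Set ℕ) (n p : ℕ) : ℕ :=
  Nat.findGreatest (fun k => k ∈ K ∧ (p : ℝ) ≤ n * threshold k ^ 2) n

theorem le_of_le_mul_threshold_sq {n p k : ℕ} (hp : 1 ≤ p) (hk : 1 ≤ k)
    (h : (p : ℝ) ≤ n * threshold k ^ 2) : k ≤ n := by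
  have hk0 : (0 : ℝ) < k := by exact_mod_cast hk
  have hp1 : (1 : ℝ) ≤ p := by exact_mod_cast hp
  have h1 : threshold k ^ 2 ≤ (1 / (k : ℝ)) ^ 2 := by
    have := threshold_pos hk
    gcongr
    exact threshold_le hk
  have h2 : (1 : ℝ) ≤ n * (1 / (k : ℝ)) ^ 2 := hp1.trans (h.trans (by gcongr))
  rw [div_pow, one_pow, mul_one_div, one_le_div (by positivity)] at h2
  have h3 : k ^ 2 ≤ n := by exact_mod_cast h2
  nlinarith

theorem le_levelExp_iff {K : Set ℕ} (hK : ∀ k ∈ K, ∀ j, 1 ≤ j → j ≤ k → j ∈ K) {n p k : ℕ}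
    (hp : 1 ≤ p) (hk : 1 ≤ k) :
    k ≤ levelExp K n p ↔ k ∈ K ∧ (p : ℝ) ≤ n * threshold k ^ 2 := by
  classical
  constructor
  · intro h
    obtain ⟨h1, h2⟩ := Nat.findGreatest_of_ne_zero (P := fun k => k ∈ K ∧
      (p : ℝ) ≤ n * threshold k ^ 2) (m := levelExp K n p) (n := n)
      (by unfold levelExp; congr!) (by omega)
    refine ⟨hK _ h1 k hk h, h2.trans ?_⟩
    have := threshold_pos (hk.trans h)
    gcongr
    exact threshold_anti hk h
  · intro h
    unfold levelExp
    exact Nat.le_findGreatest (le_of_le_mul_threshold_sq hp hk h.2) h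

/-- The integer that is optimal at the level `n`. -/
noncomputable def levelInt (K : Set ℕ) (n : ℕ) : ℕ :=
  ∏ p ∈ (Finset.Icc 1 n).filter Nat.Prime, p ^ levelExp K n p

theorem levelInt_ne_zero (K : Set ℕ) (n : ℕ) : levelInt K n ≠ 0 := by
  unfold levelInt
  rw [Finset.prod_ne_zero_iff]
  intro p hp
  exact pow_ne_zero _ (Finset.mem_filter.1 hp).2.ne_zero

theorem le_factorization_levelInt_iff {K : Set ℕ}
    (hK : ∀ k ∈ K, ∀ j, 1 ≤ j → j ≤ k → j ∈ K) {n p k : ℕ} (hp : p.Prime) (hk : 1 ≤ k) :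
    k ≤ (levelInt K n).factorization p ↔ k ∈ K ∧ (p : ℝ) ≤ n * threshold k ^ 2 := by
  have e : (levelInt K n).factorization p =
      if p ≤ n then levelExp K n p else 0 := by
    unfold levelInt
    rw [Nat.factorization_prod fun q hq => pow_ne_zero _ (Finset.mem_filter.1 hq).2.ne_zero,
      Finset.sum_apply']
    have : ∀ q ∈ (Finset.Icc 1 n).filter Nat.Prime, (q ^ levelExp K n q).factorization p =
        if p = q then levelExp K n p else 0 := by
      intro q hq
      rw [(Finset.mem_filter.1 hq).2.factorization_pow, Finsupp.single_apply]
      split_ifs with h1 h2 h2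
      · rw [h1]
      · exact absurd h1.symm h2
      · exact absurd h2.symm h1
      · rfl
    rw [Finset.sum_congr rfl this, Finset.sum_ite_eq]
    refine if_congr ?_ rfl rfl
    rw [Finset.mem_filter, Finset.mem_Icc]
    exact ⟨fun h => h.1.2, fun h => ⟨⟨hp.one_le, h⟩, hp⟩⟩
  rw [e]
  split_ifs with h
  · exact le_levelExp_iff hK hp.one_le hk
  · constructor
    · intro h1; omega
    · rintro ⟨-, h2⟩
      refine absurd ?_ h
      have h3 : threshold k ^ 2 ≤ 1 := pow_le_one₀ (threshold_pos hk).le (threshold_le_one hk)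
      have h4 : (n : ℝ) * threshold k ^ 2 ≤ n := mul_le_of_le_one_right (Nat.cast_nonneg n) h3
      exact_mod_cast h2.trans h4

theorem expsIn_levelInt {K : Set ℕ} (hK : ∀ k ∈ K, ∀ j, 1 ≤ j → j ≤ k → j ∈ K) (n : ℕ) :
    ExpsIn K (levelInt K n) := by
  intro p k hk h
  by_cases hp : p.Prime
  · exact ((le_factorization_levelInt_iff hK hp hk).1 h).1
  · rw [Nat.factorization_eq_zero_of_not_prime _ hp] at h
    omega

/-- The primes up to `n c_k²`. -/
noncomputable def levelPrimes (n k : ℕ) : Finset ℕ :=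
  (Finset.Ioc 0 ⌊(n : ℝ) * threshold k ^ 2⌋₊).filter Nat.Prime

theorem mem_levelPrimes {n k p : ℕ} :
    p ∈ levelPrimes n k ↔ p.Prime ∧ (p : ℝ) ≤ n * threshold k ^ 2 := by
  unfold levelPrimes
  rw [Finset.mem_filter, Finset.mem_Ioc]
  constructor
  · rintro ⟨⟨h1, h2⟩, h3⟩
    exact ⟨h3, (Nat.le_floor_iff' h1.ne').1 h2⟩
  · rintro ⟨h1, h2⟩
    exact ⟨⟨h1.pos, Nat.le_floor h2⟩, h1⟩

/-- Sums over the steps contained in `levelInt K n`, rearranged according to `k`. -/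
theorem sum_levelInt {K : Set ℕ} (hK : ∀ k ∈ K, ∀ j, 1 ≤ j → j ≤ k → j ∈ K) {n M : ℕ}
    (hM : n ≤ M) (F : ℕ → ℕ → ℝ) :
    ∑ p ∈ (levelInt K n).primeFactors, ∑ k ∈ Finset.Icc 1 ((levelInt K n).factorization p), F p k =
      ∑ k ∈ expRange K M, ∑ p ∈ levelPrimes n k, F p k := by
  refine Finset.sum_comm' fun p k => ?_
  rw [mem_levelPrimes, mem_expRange, Finset.mem_Icc]
  constructor
  · rintro ⟨hp, h1, h2⟩
    have hpp := Nat.prime_of_mem_primeFactors hp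
    obtain ⟨h3, h4⟩ := (le_factorization_levelInt_iff hK hpp h1).1 h2
    exact ⟨⟨hpp, h4⟩, ⟨h1, (le_of_le_mul_threshold_sq hpp.one_le h1 h4).trans hM⟩, h3⟩
  · rintro ⟨⟨hpp, h4⟩, ⟨h1, -⟩, h3⟩
    have h2 := (le_factorization_levelInt_iff hK hpp h1).2 ⟨h3, h4⟩
    refine ⟨?_, h1, h2⟩
    rw [← Nat.support_factorization, Finsupp.mem_support_iff]
    omega

theorem log_card_divisors_levelInt {K : Set ℕ} (hK : ∀ k ∈ K, ∀ j, 1 ≤ j → j ≤ k → j ∈ K)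
    {n M : ℕ} (hM : n ≤ M) :
    Real.log (levelInt K n).divisors.card =
      ∑ k ∈ expRange K M, (levelPrimes n k).card * Real.log (1 + 1 / (k : ℝ)) := by
  rw [log_card_divisors (levelInt_ne_zero K n)]
  have h := sum_levelInt hK hM (fun _ k => Real.log (1 + 1 / (k : ℝ)))
  simp only [Finset.sum_const, nsmul_eq_mul, sum_log_one_add_inv] at h
  exact h

/-- Strong duality at the integers `levelInt K n`: they contain exactly the steps that contribute
positively. -/
theorem linSum_levelInt {K : Set ℕ} (hK : ∀ k ∈ K, ∀ j, 1 ≤ j → j ≤ k → j ∈ K) {n : ℕ}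
    (hn : 1 ≤ n) :
    linSum (levelInt K n) =
      2 / √(n : ℝ) * Real.log (levelInt K n).divisors.card + dualSum K n n := by
  have hn0 : (0 : ℝ) < n := by exact_mod_cast hn
  have h := linSum_sub_multiplier (levelInt_ne_zero K n) hn0
  rw [sum_levelInt hK le_rfl (fun p k => gain k * (1 / √(p : ℝ) -
    1 / √((n : ℝ) * threshold k ^ 2)))] at h
  have e : dualSum K n n = ∑ k ∈ expRange K n, ∑ p ∈ levelPrimes n k,
      gain k * (1 / √(p : ℝ) - 1 / √((n : ℝ) * threshold k ^ 2)) := by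
    unfold dualSum primeSum levelPrimes
    simp_rw [Finset.mul_sum]
  linarith

/-- Since `c_k² < 1`, raising the level by one lets at most one new prime in at each `k`. -/
theorem card_levelPrimes_succ_le {n k : ℕ} (hk : 1 ≤ k) :
    (levelPrimes (n + 1) k).card ≤ (levelPrimes n k).card + 1 := by
  have h1 : (levelPrimes (n + 1) k \ levelPrimes n k).card ≤ 1 := by
    rw [Finset.card_le_one]
    intro a ha b hb
    rw [Finset.mem_sdiff, mem_levelPrimes, mem_levelPrimes, not_and, not_le] at ha hb
    have ha2 := ha.2 ha.1.1
    have hb2 := hb.2 hb.1.1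
    have ha1 := ha.1.2
    have hb1 := hb.1.2
    have hc : threshold k ^ 2 < 1 := by
      refine lt_of_le_of_lt ?_ threshold_one_sq_lt_one
      have := threshold_pos hk
      gcongr
      exact threshold_anti le_rfl hk
    push_cast at ha1 hb1
    have hab : (a : ℝ) < b + 1 := by nlinarith
    have hba : (b : ℝ) < a + 1 := by nlinarith
    have hab' : a < b + 1 := by exact_mod_cast hab
    have hba' : b < a + 1 := by exact_mod_cast hba
    omega
  have h2 := Finset.le_card_sdiff (levelPrimes n k) (levelPrimes (n + 1) k)
  omega

/-- The number of divisors of `levelInt K n` grows slowly with the level. -/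
theorem log_card_divisors_levelInt_succ_le {K : Set ℕ}
    (hK : ∀ k ∈ K, ∀ j, 1 ≤ j → j ≤ k → j ∈ K) (n : ℕ) :
    Real.log (levelInt K (n + 1)).divisors.card ≤
      Real.log (levelInt K n).divisors.card + Real.log (n + 2) := by
  rw [log_card_divisors_levelInt hK (le_refl (n + 1)),
    log_card_divisors_levelInt hK (Nat.le_succ n)]
  have h1 : ∑ k ∈ expRange K (n + 1), Real.log (1 + 1 / (k : ℝ)) ≤ Real.log (n + 2) := by
    have e := sum_log_one_add_inv (n + 1)
    push_cast at e
    rw [show (n : ℝ) + 2 = n + 1 + 1 by ring, ← e]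
    refine Finset.sum_le_sum_of_subset_of_nonneg ?_ ?_
    · intro k hk
      exact Finset.mem_Icc.2 (mem_expRange.1 hk).1
    · intro k hk _
      exact (log_one_add_inv_pos (Finset.mem_Icc.1 hk).1).le
  refine le_trans ?_ (add_le_add_right h1 _)
  rw [← Finset.sum_add_distrib]
  refine Finset.sum_le_sum fun k hk => ?_
  have hk1 := (mem_expRange.1 hk).1.1
  have h2 : ((levelPrimes (n + 1) k).card : ℝ) ≤ (levelPrimes n k).card + 1 := by
    exact_mod_cast card_levelPrimes_succ_le hk1
  have h3 := log_one_add_inv_pos hk1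
  nlinarith

theorem exists_lt_log_card_divisors_levelInt {K : Set ℕ}
    (hK : ∀ k ∈ K, ∀ j, 1 ≤ j → j ≤ k → j ∈ K) (h1 : 1 ∈ K) (L : ℝ) :
    ∃ n, L < Real.log (levelInt K n).divisors.card := by
  have hlog2 : 0 < Real.log 2 := Real.log_pos (by norm_num)
  obtain ⟨m, hm, hm1⟩ : ∃ m : ℕ, L / Real.log 2 + 1 ≤ (Nat.primeCounting m : ℝ) ∧ 1 ≤ m :=
    (((tendsto_natCast_atTop_atTop (R := ℝ)).comp Nat.tendsto_primeCounting).eventually_ge_atTop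
      (L / Real.log 2 + 1)).and (eventually_ge_atTop 1) |>.exists
  refine ⟨4 * m, ?_⟩
  rw [log_card_divisors_levelInt hK (le_refl _)]
  have hmem : 1 ∈ expRange K (4 * m) := mem_expRange.2 ⟨⟨le_rfl, by omega⟩, h1⟩
  have h2 := Finset.single_le_sum (f := fun k => ((levelPrimes (4 * m) k).card : ℝ) *
    Real.log (1 + 1 / (k : ℝ))) (fun k hk => mul_nonneg (Nat.cast_nonneg _)
      (log_one_add_inv_pos (mem_expRange.1 hk).1.1).le) hmem
  refine lt_of_lt_of_le ?_ h2
  have h3 : (Nat.primeCounting m : ℝ) ≤ (levelPrimes (4 * m) 1).card := by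
    have : Nat.primeCounting m = ((Finset.Ioc 0 m).filter Nat.Prime).card := by
      rw [Nat.primeCounting, Nat.primeCounting', Nat.count_eq_card_filter_range]
      congr 1
      ext p
      simp only [Finset.mem_filter, Finset.mem_range, Finset.mem_Ioc]
      constructor
      · rintro ⟨a, b⟩; exact ⟨⟨b.pos, by omega⟩, b⟩
      · rintro ⟨⟨-, a⟩, b⟩; exact ⟨by omega, b⟩
    rw [this]
    norm_cast
    refine Finset.card_le_card fun p hp => ?_
    have hp1 := Finset.mem_filter.1 hp
    refine mem_levelPrimes.2 ⟨hp1.2, ?_⟩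
    have hpm : (p : ℝ) ≤ m := by exact_mod_cast (Finset.mem_Ioc.1 hp1.1).2
    have hc := le_threshold (le_refl 1)
    push_cast at hc ⊢
    have : (1 / (1 + 1) : ℝ) ^ 2 ≤ threshold 1 ^ 2 := by gcongr
    have hm0 : (0 : ℝ) ≤ m := Nat.cast_nonneg m
    norm_num at this
    nlinarith
  have h4 : L < (Nat.primeCounting m : ℝ) * Real.log 2 := by
    have : (L / Real.log 2 + 1) * Real.log 2 = L + Real.log 2 := by field_simp
    nlinarith
  have h5 : Real.log (1 + 1 / ((1 : ℕ) : ℝ)) = Real.log 2 := by norm_num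
  simp only [h5]
  nlinarith

/-- The last level at which the number of divisors does not exceed `exp L`. -/
theorem exists_level {K : Set ℕ} (hK : ∀ k ∈ K, ∀ j, 1 ≤ j → j ≤ k → j ∈ K) (h1 : 1 ∈ K) {L : ℝ}
    (hL : 0 ≤ L) :
    ∃ n : ℕ, 1 ≤ n ∧ Real.log (levelInt K n).divisors.card ≤ L ∧
      L - Real.log (n + 2) ≤ Real.log (levelInt K n).divisors.card := by
  classical
  have hex := exists_lt_log_card_divisors_levelInt hK h1 L
  have hspec := Nat.find_spec hex
  -- the levels `0` and `1` give the integer `1`, so the first excessive level is at least `2`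
  have hempty : ∀ m : ℕ, m ≤ 1 → Real.log (levelInt K m).divisors.card = 0 := by
    intro m hm
    rw [log_card_divisors_levelInt hK (le_refl m)]
    refine Finset.sum_eq_zero fun k hk => ?_
    have hk1 := (mem_expRange.1 hk).1.1
    have : levelPrimes m k = ∅ := by
      refine Finset.eq_empty_of_forall_notMem fun p hp => ?_
      obtain ⟨hpp, hple⟩ := mem_levelPrimes.1 hp
      have hp2 : (2 : ℝ) ≤ p := by exact_mod_cast hpp.two_le
      have hc : threshold k ^ 2 ≤ 1 := pow_le_one₀ (threshold_pos hk1).le (threshold_le_one hk1)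
      have hm1 : (m : ℝ) ≤ 1 := by exact_mod_cast hm
      have hc0 : 0 ≤ threshold k ^ 2 := by positivity
      nlinarith
    rw [this]; simp
  have hge : 2 ≤ Nat.find hex := by
    by_contra hcon
    have := hempty (Nat.find hex) (by omega)
    linarith
  obtain ⟨n, hn⟩ : ∃ n, Nat.find hex = n + 1 := ⟨Nat.find hex - 1, by omega⟩
  have hmin := Nat.find_min hex (m := n) (by omega)
  have hsucc := log_card_divisors_levelInt_succ_le hK n
  rw [hn] at hspec
  exact ⟨n, by omega, not_lt.1 hmin, by linarith⟩

/-- Multiplying by new primes doubles the number of divisors without decreasing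
`S(T_D) / τ(D)`. -/
theorem exists_card_divisors_eq_two_pow_mul {K : Set ℕ} (h1 : 1 ∈ K) {D : ℕ} (hD : D ≠ 0)
    (hDK : ExpsIn K D) (j : ℕ) :
    ∃ D' : ℕ, D' ≠ 0 ∧ ExpsIn K D' ∧ D'.divisors.card = 2 ^ j * D.divisors.card ∧
      2 ^ j * galSum (1 / 2) D.divisors ≤ galSum (1 / 2) D'.divisors := by
  induction j with
  | zero => exact ⟨D, hD, hDK, by simp, by simp⟩
  | succ j ih =>
    obtain ⟨E, hE, hEK, hcard, hgal⟩ := ih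
    obtain ⟨q, hqE, hq⟩ := Nat.exists_infinite_primes (E + 1)
    have hndvd : ¬ q ∣ E := fun h => by
      have := Nat.le_of_dvd (Nat.pos_of_ne_zero hE) h
      omega
    have hcop : E.Coprime q := ((Nat.Prime.coprime_iff_not_dvd hq).2 hndvd).symm
    refine ⟨E * q, mul_ne_zero hE hq.ne_zero, ?_, ?_, ?_⟩
    · intro p k hk h
      rw [Nat.factorization_mul hE hq.ne_zero, Finsupp.add_apply, hq.factorization,
        Finsupp.single_apply] at h
      split_ifs at h with hpq
      · rw [← hpq, Nat.factorization_eq_zero_of_not_dvd hndvd] at h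
        have : k = 1 := by omega
        rwa [this]
      · exact hEK p k hk (by simpa using h)
    · rw [hcop.card_divisors_mul, hcard, hq.divisors, Finset.card_pair hq.one_lt.ne]
      ring
    · rw [galSum_divisors_mul hcop, pow_succ]
      have h2 := (galSum_divisors_prime_pow_bounds hq 1).1
      have hq0 : (0 : ℝ) < q := by exact_mod_cast hq.pos
      have h3 : (2 : ℝ) ≤ galSum (1 / 2) q.divisors := by
        rw [pow_one] at h2
        refine le_trans ?_ h2
        have : 0 < 1 / √(q : ℝ) := by positivity
        push_cast
        linarith
      calc (2 : ℝ) ^ j * 2 * galSum (1 / 2) D.divisors =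
            2 ^ j * galSum (1 / 2) D.divisors * 2 := by ring
        _ ≤ galSum (1 / 2) E.divisors * galSum (1 / 2) q.divisors := by
            have := (galSum_divisors_pos hE).le
            gcongr

/-- Replacing the denominator `τ(D)` by `N` costs at most a factor `2`. -/
theorem exists_card_divisors_le {K : Set ℕ} (h1 : 1 ∈ K) {D N : ℕ} (hD : D ≠ 0)
    (hDK : ExpsIn K D) (hDN : D.divisors.card ≤ N) :
    ∃ D' : ℕ, D' ≠ 0 ∧ ExpsIn K D' ∧ D'.divisors.card ≤ N ∧
      galSum (1 / 2) D.divisors / D.divisors.card / 2 ≤ galSum (1 / 2) D'.divisors / N := by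
  have hc : 0 < D.divisors.card := by exact_mod_cast card_divisors_pos hD
  have hq : N / D.divisors.card ≠ 0 := (Nat.div_pos hDN hc).ne'
  set j := Nat.log 2 (N / D.divisors.card) with hj
  obtain ⟨D', hD', hDK', hcard, hgal⟩ := exists_card_divisors_eq_two_pow_mul h1 hD hDK j
  have hlow : 2 ^ j ≤ N / D.divisors.card := Nat.pow_log_le_self 2 hq
  have hup : N / D.divisors.card < 2 ^ (j + 1) := Nat.lt_pow_succ_log_self (by norm_num) _
  refine ⟨D', hD', hDK', ?_, ?_⟩
  · rw [hcard]
    exact (Nat.mul_le_mul_right _ hlow).trans (Nat.div_mul_le_self _ _)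
  · have hN : (N : ℝ) < 2 ^ (j + 1) * D.divisors.card := by
      exact_mod_cast (Nat.div_lt_iff_lt_mul hc).1 hup
    have hN0 : (0 : ℝ) < N := by exact_mod_cast hc.trans_le hDN
    have hc0 : (0 : ℝ) < D.divisors.card := by exact_mod_cast hc
    have hg := galSum_divisors_pos hD
    rw [div_div, div_le_div_iff₀ (by positivity) hN0]
    calc galSum (1 / 2) D.divisors * N
        ≤ galSum (1 / 2) D.divisors * (2 ^ (j + 1) * D.divisors.card) := by gcongr
      _ = 2 ^ j * galSum (1 / 2) D.divisors * (D.divisors.card * 2) := by ring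
      _ ≤ _ := by gcongr

end GalDivisors

/-! ### Optimisation of the level -/

namespace GalDivisors

open Filter Topology Asymptotics

/-- Real numbers `L` so large that the estimates below apply: `log L`, `log log L` and the ratio
`L / (log L)⁵` are all large compared with the given constants. -/
theorem eventually_large {A : ℝ} (hA : 0 < A) (R : ℝ) :
    ∀ᶠ L : ℝ in atTop, R ≤ L ∧ R ≤ Real.log L ∧ R ≤ Real.log (Real.log L) ∧
      R * (Real.log (Real.log L) / Real.log L) ≤ 1 ∧
      37 * Real.log L ^ 2 ≤ √(A * L / Real.log L) := by
  have hlog := Real.tendsto_log_atTop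
  have hsmall : ∀ᶠ L : ℝ in atTop,
      |Real.log (Real.log L)| ≤ 1 / (|R| + 1) * |Real.log L| := by
    have h := (Real.isLittleO_log_id_atTop.comp_tendsto hlog).bound
      (show (0 : ℝ) < 1 / (|R| + 1) by positivity)
    simpa using h
  have hpow : ∀ᶠ L : ℝ in atTop, |Real.log L ^ 5| ≤ A / 37 ^ 2 * |L| := by
    have h := (Real.isLittleO_pow_log_id_atTop (n := 5)).bound (show (0 : ℝ) < A / 37 ^ 2 by positivity)
    simpa using h
  filter_upwards [eventually_ge_atTop R, hlog.eventually_ge_atTop R,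
    (hlog.comp hlog).eventually_ge_atTop R, hsmall, hpow, eventually_gt_atTop 0,
    hlog.eventually_gt_atTop 0, (hlog.comp hlog).eventually_gt_atTop 0] with
    L h1 h2 h3 h4 h5 h6 h7 h8
  refine ⟨h1, h2, h3, ?_, ?_⟩
  · have h8' : 0 < Real.log (Real.log L) := h8
    rw [abs_of_pos h8', abs_of_pos h7, div_mul_eq_mul_div, one_mul, le_div_iff₀ (by positivity)]
      at h4
    rw [← mul_div_assoc, div_le_one h7]
    nlinarith [le_abs_self R, abs_nonneg R]
  · refine Real.le_sqrt_of_sq_le ?_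
    rw [abs_of_pos h6, abs_of_pos (by positivity)] at h5
    rw [le_div_iff₀ h7]
    calc (37 * Real.log L ^ 2) ^ 2 * Real.log L = 37 ^ 2 * Real.log L ^ 5 := by ring
      _ ≤ 37 ^ 2 * (A / 37 ^ 2 * L) := by gcongr
      _ = A * L := by ring

/-- At the multiplier level `x = L log L / A` the dual bound is the main term `4 √(A L / log L)`,
up to the relative error. -/
theorem eventually_dual_le {A C X : ℝ} (hA : 0 < A) (hC : 0 < C) :
    ∀ᶠ L : ℝ in atTop, 0 < L * Real.log L / A ∧ X ≤ L * Real.log L / A ∧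
      ∀ d : ℝ, d ≤ 2 * A * (√(L * Real.log L / A) / Real.log (L * Real.log L / A)) *
          (1 + C * (Real.log (Real.log (L * Real.log L / A)) /
            Real.log (L * Real.log L / A))) →
        2 / √(L * Real.log L / A) * L + d + 7 * (4 + Real.log L) ≤
          4 * √(A * L / Real.log L) *
            (1 + (C + 1) * (Real.log (Real.log L) / Real.log L)) := by
  filter_upwards [eventually_large hA (|X| + A + 3 + |Real.log A|)] with L ⟨h1, h2, h3, h4, h5⟩
  have ha := abs_nonneg X
  have hb := abs_nonneg (Real.log A)
  have hlA := le_abs_self (Real.log A)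
  have hlA' := neg_abs_le (Real.log A)
  set l := Real.log L with hl
  set e := Real.log l with he
  have hL : 0 < L := by linarith
  have hl0 : 0 < l := by linarith
  have he1 : 1 ≤ e := by linarith
  have hel : e ≤ l := (Real.log_le_sub_one_of_pos hl0).trans (by linarith)
  set x := L * l / A with hx
  have hx0 : 0 < x := by positivity
  have hLx : L ≤ x := by
    rw [hx, le_div_iff₀ hA]
    gcongr
    linarith
  refine ⟨hx0, by linarith [le_abs_self X], fun d hd => ?_⟩
  have hlogx : Real.log x = l + e - Real.log A := by
    rw [hx, Real.log_div (by positivity) hA.ne', Real.log_mul hL.ne' hl0.ne']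
  have hlx : l ≤ Real.log x := by rw [hlogx]; linarith
  have hlx3 : Real.log x ≤ 3 * l := by rw [hlogx]; linarith
  have hllx : Real.log (Real.log x) / Real.log x ≤ e / l := by
    -- `log t / t` decreases for `t ≥ e`
    refine Real.log_div_self_antitoneOn ?_ ?_ hlx
    · exact (Real.exp_one_lt_d9.le.trans (by linarith) : Real.exp 1 ≤ l)
    · exact (Real.exp_one_lt_d9.le.trans (by linarith) : Real.exp 1 ≤ Real.log x)
  set m := √(A * L / l) with hm
  have hm0 : 0 < m := Real.sqrt_pos.2 (by positivity)
  have hs0 : 0 < √x := Real.sqrt_pos.2 hx0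
  have hms : m * √x = L := by
    rw [hm, ← Real.sqrt_mul (by positivity), hx]
    rw [show A * L / l * (L * l / A) = L ^ 2 by field_simp, Real.sqrt_sq hL.le]
  have hsl : A * √x = l * m := by
    have : m * (A * √x) = m * (l * m) := by
      rw [show m * (A * √x) = A * (m * √x) by ring, hms, show m * (l * m) = l * (m * m) by ring,
        hm, Real.mul_self_sqrt (by positivity)]
      field_simp
    exact mul_left_cancel₀ hm0.ne' this
  have e1 : 2 / √x * L = 2 * m := by
    rw [← hms]
    field_simp
  have hd2 : d ≤ 2 * m * (1 + C * (e / l)) := by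
    refine hd.trans ?_
    have h6 : 2 * A * (√x / Real.log x) ≤ 2 * m := by
      rw [show 2 * A * (√x / Real.log x) = 2 * (A * √x) / Real.log x by ring, hsl,
        div_le_iff₀ (by linarith)]
      nlinarith
    gcongr
    have : 0 ≤ Real.log (Real.log x) := Real.log_nonneg (by linarith)
    have : 0 < Real.log x := by linarith
    positivity
  have h7 : 7 * (4 + l) ≤ m * (e / l) := by
    have h8 : 37 * l ≤ m / l := by rw [le_div_iff₀ hl0]; linarith
    calc 7 * (4 + l) ≤ 37 * l := by linarith
      _ ≤ m / l := h8
      _ = m * (1 / l) := by ring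
      _ ≤ m * (e / l) := by gcongr
  have h9 : 0 ≤ m * (e / l) := by positivity
  rw [e1]
  nlinarith [mul_nonneg hC.le h9]

theorem eventually_log_le_sqrt_sqrt :
    ∀ᶠ n : ℝ in atTop, Real.log n ≤ √(√n) ∧ 2 / √n * Real.log (n + 2) ≤ 1 := by
  have h1 : ∀ᶠ n : ℝ in atTop, |Real.log n| ≤ 1 / 4 * |n ^ (1 / 4 : ℝ)| := by
    simpa using (isLittleO_log_rpow_atTop (show (0 : ℝ) < 1 / 4 by norm_num)).bound
      (show (0 : ℝ) < 1 / 4 by norm_num)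
  filter_upwards [h1, eventually_ge_atTop 2] with n h hn
  have hq : n ^ (1 / 4 : ℝ) = √(√n) := by
    rw [Real.sqrt_eq_rpow, Real.sqrt_eq_rpow, ← Real.rpow_mul (by linarith)]
    norm_num
  rw [hq, abs_of_nonneg (Real.log_nonneg (by linarith)), abs_of_nonneg (by positivity)] at h
  have hs1 : 1 ≤ √n := Real.one_le_sqrt.2 (by linarith)
  have hs2 : 1 ≤ √(√n) := Real.one_le_sqrt.2 hs1
  have hss : √(√n) * √(√n) = √n := Real.mul_self_sqrt (by linarith)
  refine ⟨by linarith, ?_⟩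
  have h2 : Real.log (n + 2) ≤ 2 * Real.log n := by
    rw [show 2 * Real.log n = Real.log (n ^ 2) by simp]
    exact Real.log_le_log (by linarith) (by nlinarith)
  rw [div_mul_eq_mul_div, div_le_one (by linarith)]
  nlinarith

/-- Above a constant, `log L` absorbs the constants in front of `√(A L / log L)`. -/
theorem mul_sqrt_div_le {A L l : ℝ} (hA : 0 < A) (hL : 0 ≤ L) (hl : 0 < l) (h1 : 25 * A ≤ l)
    (h2 : 100 / A ≤ l) :
    5 * √(A * L / l) ≤ √L ∧ 10 * √(A * L / l) ≤ A * √L := by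
  have hm : √(A * L / l) ^ 2 = A * L / l := Real.sq_sqrt (by positivity)
  rw [div_le_iff₀ hA] at h2
  constructor
  · refine Real.le_sqrt_of_sq_le ?_
    rw [mul_pow, hm, ← mul_div_assoc, div_le_iff₀ hl]
    nlinarith
  · have e : A * √L = √(A ^ 2 * L) := by
      rw [Real.sqrt_mul (by positivity), Real.sqrt_sq hA.le]
    rw [e]
    refine Real.le_sqrt_of_sq_le ?_
    rw [mul_pow, hm, ← mul_div_assoc, div_le_iff₀ hl]
    have h3 := mul_le_mul_of_nonneg_left h2 (mul_nonneg hA.le hL)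
    linarith

/-- In the central range the inequality between the arithmetic and the geometric mean bounds the
dual value `2 T / s + d` below. Here `s` is the square root of the level, `w` its logarithm, and
`m = √(A L / l)`. -/
theorem main_le_of_central {A C L l ε m s w T b d : ℝ} (hA : 0 < A) (hC : 0 ≤ C) (hl : 0 < l)
    (hε : 0 ≤ ε) (hε1 : (2 * C + 2) * ε ≤ 1) (hm : 0 < m) (hmsq : m ^ 2 = A * L / l) (hs : 0 < s)
    (hw : 0 < w) (hwl : w ≤ l * (1 + 2 * ε)) (hT : L - b ≤ T) (hb : 2 / s * b ≤ 1)
    (hd : 2 * A * (s / w) * (1 - C * ε) ≤ d) :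
    4 * m * (1 - (2 * C + 2) * ε) - 1 ≤ 2 / s * T + d := by
  have hCε : 0 ≤ C * ε := by positivity
  have h1 : s / l * (1 - 2 * ε) ≤ s / w := by
    rw [div_mul_eq_mul_div, div_le_div_iff₀ hl hw, mul_assoc]
    gcongr
    calc (1 - 2 * ε) * w ≤ (1 - 2 * ε) * (l * (1 + 2 * ε)) := by
          have : 0 ≤ 1 - 2 * ε := by linarith
          gcongr
      _ = l - 4 * (l * ε ^ 2) := by ring
      _ ≤ l := by linarith [show 0 ≤ l * ε ^ 2 by positivity]
  have h2 : 2 * A * (s / l) * (1 - (2 * C + 2) * ε) ≤ d := by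
    refine le_trans ?_ hd
    have hle : 1 - (2 * C + 2) * ε ≤ (1 - 2 * ε) * (1 - C * ε) := by
      linarith [show (1 - 2 * ε) * (1 - C * ε) = 1 - (2 * C + 2) * ε + C * ε + 2 * (C * ε * ε) by
        ring, mul_nonneg hCε hε]
    have h3 : 0 ≤ 1 - C * ε := by linarith
    calc 2 * A * (s / l) * (1 - (2 * C + 2) * ε)
        ≤ 2 * A * (s / l) * ((1 - 2 * ε) * (1 - C * ε)) := by gcongr
      _ = 2 * A * (s / l * (1 - 2 * ε)) * (1 - C * ε) := by ring
      _ ≤ 2 * A * (s / w) * (1 - C * ε) := by gcongr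
  have h3 : 2 / s * L - 1 ≤ 2 / s * T := by
    have : 2 / s * (L - b) ≤ 2 / s * T := by gcongr
    linarith
  have hL : L = m ^ 2 * l / A := by rw [hmsq]; field_simp
  have h4 : 4 * m ≤ 2 / s * L + 2 * A * (s / l) := by
    have e : 2 / s * L + 2 * A * (s / l) - 4 * m = 2 / (s * A * l) * (m * l - A * s) ^ 2 := by
      rw [hL]
      field_simp
      ring
    have : 0 ≤ 2 / (s * A * l) * (m * l - A * s) ^ 2 := by positivity
    linarith
  have hL0 : 0 ≤ L := by rw [hL]; positivity
  have h5 : 0 ≤ 2 / s * L * ((2 * C + 2) * ε) := by positivity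
  have h6 := mul_le_mul_of_nonneg_right h4 (show 0 ≤ 1 - (2 * C + 2) * ε by linarith)
  linarith

theorem sqrt_half_mul_log_le {L n : ℝ} (hL : 0 < L) (hn : 0 < n)
    (hn0 : 0 < Real.log n) (hLn : L * Real.log L ^ 2 ≤ n) (hq : Real.log n ≤ √(√n)) :
    √L / 2 * Real.log n ≤ √n := by
  rcases le_or_gt n (L ^ 2) with h | h
  · have h1 : Real.log n ≤ 2 * Real.log L := by
      refine (Real.log_le_log hn h).trans_eq ?_
      rw [Real.log_pow, Nat.cast_two]
    calc √L / 2 * Real.log n ≤ √L / 2 * (2 * Real.log L) := by gcongr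
      _ = √L * Real.log L := by ring
      _ ≤ √n := by
        refine Real.le_sqrt_of_sq_le ?_
        rwa [mul_pow, Real.sq_sqrt hL.le]
  · have h1 : √L ≤ √(√n) := Real.sqrt_le_sqrt (Real.le_sqrt_of_sq_le h.le)
    calc √L / 2 * Real.log n ≤ √L * Real.log n := by
          have := Real.sqrt_nonneg L
          gcongr
          linarith
      _ ≤ √(√n) * √(√n) := by gcongr
      _ = √n := Real.mul_self_sqrt (Real.sqrt_nonneg n)

theorem sqrt_le_of_le {L n T : ℝ} (hn : 0 < n) (hnL : n ≤ L) (hL : 1 ≤ L)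
    (hq : 2 / √L * Real.log (L + 2) ≤ 1) (hT : L - Real.log (n + 2) ≤ T) :
    √L ≤ 2 / √n * T := by
  have hsL : 0 < √L := Real.sqrt_pos.2 (by linarith)
  have h1 : Real.log (n + 2) ≤ Real.log (L + 2) := Real.log_le_log (by linarith) (by linarith)
  have h2 : √L ≤ L := by
    rw [Real.sqrt_le_left (by linarith)]
    nlinarith
  rw [div_mul_eq_mul_div, div_le_one hsL] at hq
  have h3 : L / 2 ≤ T := by linarith
  have h4 : 0 < √n := Real.sqrt_pos.2 hn
  calc √L = 2 / √L * (L / 2) := by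
        rw [eq_comm, div_mul_eq_mul_div, div_eq_iff hsL.ne', Real.mul_self_sqrt (by linarith)]
        ring
    _ ≤ 2 / √n * T := by gcongr

/-- Whatever the level `n` is, its dual value is at least the main term `4 √(A L / log L)`, up to
the relative error. In the range `L ≤ n ≤ L (log L)²` this is the inequality between the arithmetic
and the geometric mean; outside of that range one of the two summands alone is of order `√L`. -/
theorem eventually_le_dual {A C X : ℝ} (hA : 0 < A) (hC : 0 < C) :
    ∀ᶠ L : ℝ in atTop, ∀ n T d : ℝ, 1 ≤ n → 0 ≤ T → L - Real.log (n + 2) ≤ T → 0 ≤ d →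
      (X ≤ n → 2 * A * (√n / Real.log n) *
        (1 - C * (Real.log (Real.log n) / Real.log n)) ≤ d) →
      4 * √(A * L / Real.log L) *
          (1 - (2 * C + 3) * (Real.log (Real.log L) / Real.log L)) ≤
        2 / √n * T + d - 7 * (4 + Real.log L) - 1 := by
  obtain ⟨Y, hY⟩ := eventually_atTop.1 eventually_log_le_sqrt_sqrt
  filter_upwards [eventually_large hA (|X| + |Y| + 5 + 2 * C + 25 * A + 100 / A)] with
    L ⟨h1, h2, h3, h4, h5⟩
  have haX := abs_nonneg X
  have haY := abs_nonneg Y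
  have hX := le_abs_self X
  have hY' := le_abs_self Y
  have hA' : 0 < 100 / A := by positivity
  intro n T d hn hT0 hT hd0 hd
  set l := Real.log L with hl
  set e := Real.log l with he
  have hL : 0 < L := by linarith
  have hl0 : 0 < l := by linarith
  have he1 : 1 ≤ e := by linarith
  have hel : e ≤ l := (Real.log_le_sub_one_of_pos hl0).trans (by linarith)
  set ε := e / l with hε
  have hε0 : 0 < ε := by positivity
  have hε1 : (2 * C + 5) * ε ≤ 1 := by
    refine le_trans ?_ h4
    have : 2 * C + 5 ≤ |X| + |Y| + 5 + 2 * C + 25 * A + 100 / A := by linarith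
    gcongr
  set m := √(A * L / l) with hm
  have hm0 : 0 < m := Real.sqrt_pos.2 (by positivity)
  have hmsq : m ^ 2 = A * L / l := Real.sq_sqrt (by positivity)
  have h7 : 7 * (4 + l) + 2 ≤ m * ε := by
    have h8 : 37 * l ≤ m / l := by rw [le_div_iff₀ hl0]; linarith
    calc 7 * (4 + l) + 2 ≤ 37 * l := by linarith
      _ ≤ m / l := h8
      _ = m * (1 / l) := by ring
      _ ≤ m * (e / l) := by gcongr
  have hεm : m * ε ≤ m := mul_le_of_le_one_right hm0.le ((div_le_one hl0).2 hel)
  -- outside the central range a lower bound of order `√L` suffices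
  have hfar : ∀ t : ℝ, (√L ≤ t ∨ A / 2 * √L ≤ t) →
      4 * m * (1 - (2 * C + 3) * ε) ≤ t - 7 * (4 + l) - 1 := by
    intro t ht
    have hg : 4 * m * (1 - (2 * C + 3) * ε) ≤ 4 * m := by
      have : 0 < 4 * m * ((2 * C + 3) * ε) := by positivity
      linarith
    have h5m : 5 * m ≤ t := by
      obtain ⟨h6, h8⟩ := mul_sqrt_div_le hA hL.le hl0 (by linarith) (by linarith)
      rcases ht with ht | ht <;> linarith
    linarith
  have hs0 : 0 < √n := Real.sqrt_pos.2 (by linarith)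
  rcases le_or_gt n L with hnL | hnL
  · refine hfar _ (Or.inl ?_)
    have h6 := sqrt_le_of_le (zero_lt_one.trans_le hn) hnL (by linarith) (hY L (by linarith)).2 hT
    linarith
  have hd := hd (by linarith)
  obtain ⟨hq, hq2⟩ := hY n (by linarith)
  have hln : l ≤ Real.log n := Real.log_le_log hL hnL.le
  have hln0 : 0 < Real.log n := by linarith
  have hlln : Real.log (Real.log n) / Real.log n ≤ ε := by
    -- `log t / t` decreases for `t ≥ e`
    refine Real.log_div_self_antitoneOn ?_ ?_ hln
    · exact (Real.exp_one_lt_d9.le.trans (by linarith) : Real.exp 1 ≤ l)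
    · exact (Real.exp_one_lt_d9.le.trans (by linarith) : Real.exp 1 ≤ Real.log n)
  have hd : 2 * A * (√n / Real.log n) * (1 - C * ε) ≤ d := by
    refine le_trans ?_ hd
    gcongr
  have hCε : C * ε ≤ 1 / 2 := by linarith
  have hd' : A * (√n / Real.log n) ≤ d := by
    refine le_trans ?_ hd
    calc A * (√n / Real.log n) = 2 * A * (√n / Real.log n) * (1 - 1 / 2) := by ring
      _ ≤ 2 * A * (√n / Real.log n) * (1 - C * ε) := by gcongr
  have hTn : 0 ≤ 2 / √n * T := by positivity
  rcases le_or_gt n (L * l ^ 2) with hn2 | hn2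
  · have hlogn : Real.log n ≤ l + 2 * e := by
      refine (Real.log_le_log (by linarith) hn2).trans_eq ?_
      rw [Real.log_mul hL.ne' (by positivity), Real.log_pow, Nat.cast_two]
    have h8 := main_le_of_central hA hC.le hl0 hε0.le (by linarith) hm0 (hmsq := hmsq) hs0 hln0
      (hlogn.trans_eq (by rw [hε]; field_simp)) hT hq2 hd
    linarith
  · refine hfar (2 / √n * T + d) (Or.inr ?_)
    suffices h : √L / 2 ≤ √n / Real.log n by
      calc A / 2 * √L = A * (√L / 2) := by ring
        _ ≤ A * (√n / Real.log n) := by gcongr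
        _ ≤ _ := by linarith
    rw [le_div_iff₀ hln0]
    exact sqrt_half_mul_log_le hL (hL.trans hnL) hln0 hn2.le hq

/-- The values `S(T_D) / N` over the admissible integers `D` whose exponents lie in `K`. -/
def ratioSet (K : Set ℕ) (N : ℕ) : Set ℝ :=
  {r | ∃ D : ℕ, D ≠ 0 ∧ ExpsIn K D ∧ D.divisors.card ≤ N ∧
    r = galSum (1 / 2) D.divisors / N}

theorem ratioSet_pos {K : Set ℕ} {N : ℕ} {r : ℝ} (hN : 1 ≤ N) (hr : r ∈ ratioSet K N) : 0 < r := by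
  obtain ⟨D, hD, -, -, rfl⟩ := hr
  have := galSum_divisors_pos hD
  have hN0 : (0 : ℝ) < N := by exact_mod_cast hN
  positivity

theorem log_div_le_linSum {D N : ℕ} (hD : D ≠ 0) (hDN : D.divisors.card ≤ N)
    (hN : 1 ≤ Real.log N) :
    Real.log (galSum (1 / 2) D.divisors / N) ≤
      linSum D + 7 * (4 + Real.log (Real.log N)) := by
  have hc := card_divisors_pos hD
  have hcN : (D.divisors.card : ℝ) ≤ N := by exact_mod_cast hDN
  have hS := galSum_divisors_pos hD
  have h1 := abs_log_galSum_div_card_sub_linSum_le hD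
  have h2 := sum_one_div_primeFactors_le hD hN (Real.log_le_log hc hcN)
  rw [abs_le] at h1
  have h3 : Real.log (galSum (1 / 2) D.divisors / N) ≤
      Real.log (galSum (1 / 2) D.divisors / D.divisors.card) :=
    Real.log_le_log (by have := hc.trans_le hcN; positivity) (by gcongr)
  linarith [h1.2]

/-- The asymptotic formula for the supremum over the integers with exponents in a downward closed
set `K`; the constant is `4 √A`, where `A` is the sum of the series over `K`. -/
theorem exists_abs_log_sub_le {K : Set ℕ} {A : ℝ} (hK : ∀ k ∈ K, ∀ j, 1 ≤ j → j ≤ k → j ∈ K)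
    (h1 : 1 ∈ K) (hA : IsConst K A) {Γ : ℕ → ℝ}
    (hΓ : ∀ N, 1 ≤ N → IsLUB (ratioSet K N) (Γ N)) :
    ∃ C : ℝ, ∀ᶠ N : ℕ in atTop,
      |Real.log (Γ N) - 4 * √(A * Real.log N / Real.log (Real.log N))| ≤
        C * (Real.log (Real.log (Real.log N)) / Real.log (Real.log N)) *
          (4 * √(A * Real.log N / Real.log (Real.log N))) := by
  obtain ⟨C, X, hC, hX, hdual⟩ := exists_dualSum_bounds hA h1
  have hA0 := hA.pos h1
  have hcast : Tendsto (fun N : ℕ => Real.log (N : ℝ)) atTop atTop :=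
    Real.tendsto_log_atTop.comp tendsto_natCast_atTop_atTop
  refine ⟨2 * C + 3, ?_⟩
  filter_upwards [hcast.eventually (eventually_dual_le (X := X) hA0 hC),
    hcast.eventually (eventually_le_dual (X := X) hA0 hC), hcast.eventually_ge_atTop 1,
    eventually_ge_atTop 1, hcast.eventually (eventually_large hA0 1)] with N hup hlow hL1 hN1
    ⟨_, hl, he, _, _⟩
  set L := Real.log (N : ℝ) with hL
  have hN0 : (0 : ℝ) < N := by exact_mod_cast hN1
  have hlub := hΓ N hN1
  obtain ⟨hx0, hxX, hup⟩ := hup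
  set U := 4 * √(A * L / Real.log L) with hU
  have hU0 : 0 ≤ U := by positivity
  set ε := Real.log (Real.log L) / Real.log L with hε
  have hε0 : 0 ≤ ε := by positivity
  have hle : ∀ D : ℕ, D ≠ 0 → ExpsIn K D → D.divisors.card ≤ N →
      galSum (1 / 2) D.divisors / N ≤ Real.exp (U * (1 + (C + 1) * ε)) := by
    intro D hD hDK hDN
    obtain ⟨M, hM⟩ := exists_linSum_le hD hDK hx0
    have h3 := hup _ (hdual _ hxX M).1
    have h4 := log_div_le_linSum hD hDN hL1
    have hc := card_divisors_pos hD
    have h5 : Real.log D.divisors.card ≤ L := Real.log_le_log hc (by exact_mod_cast hDN)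
    have h6 : 2 / √(L * Real.log L / A) * Real.log D.divisors.card ≤
        2 / √(L * Real.log L / A) * L := by gcongr
    rw [← Real.log_le_iff_le_exp (ratioSet_pos hN1 ⟨D, hD, hDK, hDN, rfl⟩)]
    linarith
  have hΓle : Γ N ≤ Real.exp (U * (1 + (C + 1) * ε)) := by
    refine hlub.2 ?_
    rintro r ⟨D, hD, hDK, hDN, rfl⟩
    exact hle D hD hDK hDN
  obtain ⟨n, hn1, hnL, hLn⟩ := exists_level hK h1 (zero_le_one.trans hL1)
  have hn1' : (1 : ℝ) ≤ n := by exact_mod_cast hn1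
  set D := levelInt K n with hDdef
  have hD : D ≠ 0 := levelInt_ne_zero K n
  have hc := card_divisors_pos hD
  have hDN : D.divisors.card ≤ N := by
    have := (Real.log_le_log_iff hc hN0).1 hnL
    exact_mod_cast this
  obtain ⟨D', hD', hD'K, hD'N, hSD'⟩ :=
    exists_card_divisors_le h1 hD (expsIn_levelInt hK n) hDN
  have hmem : galSum (1 / 2) D'.divisors / N ∈ ratioSet K N := ⟨D', hD', hD'K, hD'N, rfl⟩
  have hSD := galSum_divisors_pos hD
  have hge : galSum (1 / 2) D.divisors / D.divisors.card / 2 ≤ Γ N := hSD'.trans (hlub.1 hmem)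
  have hΓ0 : 0 < Γ N := (ratioSet_pos hN1 hmem).trans_le (hlub.1 hmem)
  have hlogge : linSum D - 7 * (4 + Real.log L) - 1 ≤ Real.log (Γ N) := by
    have h3 := Real.log_le_log (by positivity) hge
    rw [Real.log_div (by positivity) (by norm_num)] at h3
    have h4 := (abs_le.1 (abs_log_galSum_div_card_sub_linSum_le hD)).1
    have h5 := sum_one_div_primeFactors_le hD hL1 hnL
    have h6 := Real.log_two_lt_d9
    linarith
  have hT0 : 0 ≤ Real.log D.divisors.card := Real.log_natCast_nonneg _
  have h3 := hlow n _ _ hn1' hT0 hLn (dualSum_nonneg K n n) fun hXn => (hdual n hXn n).2 le_rfl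
  rw [← linSum_levelInt hK hn1] at h3
  have h4 : Real.log (Γ N) ≤ U * (1 + (C + 1) * ε) := (Real.log_le_iff_le_exp hΓ0).2 hΓle
  have h5 : 0 ≤ U * ε := by positivity
  rw [abs_le]
  constructor
  · linarith
  · nlinarith [mul_nonneg hC.le h5]

/-- Passing from an absolute error to the relative one. -/
theorem exists_relative_error {A c : ℝ} (hA : 0 < A) (hc : c = 4 * √A) {Γ : ℕ → ℝ}
    (h : ∃ C : ℝ, ∀ᶠ N : ℕ in atTop,
      |Real.log (Γ N) - 4 * √(A * Real.log N / Real.log (Real.log N))| ≤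
        C * (Real.log (Real.log (Real.log N)) / Real.log (Real.log N)) *
          (4 * √(A * Real.log N / Real.log (Real.log N)))) :
    ∃ E : ℕ → ℝ,
      E =O[atTop] (fun N : ℕ => Real.log (Real.log (Real.log N)) / Real.log (Real.log N)) ∧
      ∀ᶠ N : ℕ in atTop, Real.log (Γ N) =
        c * √(Real.log N / Real.log (Real.log N)) * (1 + E N) := by
  obtain ⟨C, hC⟩ := h
  have hlarge : ∀ᶠ N : ℕ in atTop, 1 ≤ Real.log (N : ℝ) ∧ 1 ≤ Real.log (Real.log (N : ℝ)) ∧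
      1 ≤ Real.log (Real.log (Real.log (N : ℝ))) :=
    (((Real.tendsto_log_atTop.comp tendsto_natCast_atTop_atTop).eventually
      (eventually_large hA 1))).mono fun N h => ⟨h.1, h.2.1, h.2.2.1⟩
  refine ⟨fun N => Real.log (Γ N) / (c * √(Real.log N / Real.log (Real.log N))) - 1, ?_, ?_⟩
  · refine IsBigO.of_bound C ?_
    filter_upwards [hC, hlarge] with N hN ⟨h1, h2, h3⟩
    have hU : 4 * √(A * Real.log N / Real.log (Real.log N)) =
        c * √(Real.log N / Real.log (Real.log N)) := by
      rw [hc, mul_div_assoc, Real.sqrt_mul hA.le, mul_assoc]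
    rw [hU] at hN
    have hU0 : 0 < c * √(Real.log N / Real.log (Real.log N)) := by
      rw [hc]
      positivity
    rw [Real.norm_eq_abs, Real.norm_of_nonneg (by positivity), ← div_self hU0.ne',
      ← sub_div, abs_div, abs_of_pos hU0, div_le_iff₀ hU0]
    exact hN
  · filter_upwards [hlarge] with N ⟨h1, h2, h3⟩
    have hU0 : 0 < c * √(Real.log N / Real.log (Real.log N)) := by
      rw [hc]
      positivity
    rw [add_sub_cancel, mul_div_cancel₀ _ hU0.ne']

/-! ### The two families of integers -/

theorem isConst_univ : IsConst Set.univ (∑' k : ℕ+, constTerm k) := by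
  have hs : Summable fun k : ℕ+ => constTerm k := summable_constB
  have hs0 : Summable (fun n : ℕ => constTerm (n + 1)) :=
    summable_pnat_iff_summable_succ.1 hs
  have h := hs0.hasSum.tendsto_sum_nat
  rw [← tsum_pnat_eq_tsum_succ] at h
  refine h.congr fun M => ?_
  have e : expRange Set.univ M = Finset.Ico 1 (M + 1) := by
    ext k
    rw [mem_expRange, Finset.mem_Ico]
    simp only [Set.mem_univ, and_true]
    omega
  rw [e, Finset.sum_Ico_eq_sum_range]
  simp [add_comm]

theorem isConst_singleton : IsConst {1} (1 / (4 * Real.log 2)) := by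
  refine tendsto_const_nhds.congr' ?_
  filter_upwards [eventually_ge_atTop 1] with M hM
  have e : expRange {1} M = {1} := by
    ext k
    rw [mem_expRange, Finset.mem_singleton, Set.mem_singleton_iff]
    omega
  rw [e, Finset.sum_singleton, constTerm]
  norm_num

theorem expsIn_univ (D : ℕ) : ExpsIn Set.univ D := fun _ _ _ _ => Set.mem_univ _

theorem expsIn_singleton_iff {D : ℕ} (hD : D ≠ 0) : ExpsIn {1} D ↔ Squarefree D := by
  rw [Nat.squarefree_iff_factorization_le_one hD]
  constructor
  · intro h p
    rcases Nat.eq_zero_or_pos (D.factorization p) with h0 | h0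
    · omega
    · have := h p _ h0 le_rfl
      rw [Set.mem_singleton_iff] at this
      omega
  · intro h p k hk1 hk2
    rw [Set.mem_singleton_iff]
    have := h p
    omega

theorem isLUB_gammaDiv {N : ℕ} (hN : 1 ≤ N) : IsLUB (ratioSet Set.univ N) (gammaDiv N) := by
  have := nonempty_index hN
  have h := isLUB_ciSup (bddAbove_gammaDiv N)
  suffices e : ratioSet Set.univ N = Set.range fun D : {D : ℕ // 0 < D ∧ D.divisors.card ≤ N} =>
      galSum (1 / 2) D.1.divisors / N by
    rw [e]
    exact h
  ext r
  constructor
  · rintro ⟨D, hD, -, hDN, rfl⟩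
    exact ⟨⟨D, Nat.pos_of_ne_zero hD, hDN⟩, rfl⟩
  · rintro ⟨⟨D, hD, hDN⟩, rfl⟩
    exact ⟨D, hD.ne', expsIn_univ D, hDN, rfl⟩

theorem isLUB_gammaDivSqfree {N : ℕ} (hN : 1 ≤ N) :
    IsLUB (ratioSet {1} N) (gammaDivSqfree N) := by
  have := nonempty_index hN
  have h := isLUB_ciSup (bddAbove_gammaDivSqfree N)
  have hval : ∀ D : ℕ, Squarefree D → (ArithmeticFunction.moebius D : ℝ) ^ 2 = 1 := by
    intro D hD
    exact_mod_cast ArithmeticFunction.moebius_sq_eq_one_of_squarefree hD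
  constructor
  · rintro r ⟨D, hD, hDK, hDN, rfl⟩
    refine h.1 ⟨⟨D, Nat.pos_of_ne_zero hD, hDN⟩, ?_⟩
    simp only [hval D ((expsIn_singleton_iff hD).1 hDK), one_mul]
  · intro b hb
    refine h.2 ?_
    rintro r ⟨⟨D, hD, hDN⟩, rfl⟩
    by_cases hsq : Squarefree D
    · simp only [hval D hsq, one_mul]
      exact hb ⟨D, hD.ne', (expsIn_singleton_iff hD.ne').2 hsq, hDN, rfl⟩
    · -- the integers that are not squarefree contribute `0`
      simp only [ArithmeticFunction.moebius_eq_zero_of_not_squarefree hsq, Int.cast_zero]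
      have h1 : galSum (1 / 2) (1 : ℕ).divisors / N ∈ ratioSet {1} N :=
        ⟨1, one_ne_zero, (expsIn_singleton_iff one_ne_zero).2 squarefree_one, by simpa using hN, rfl⟩
      have h2 := hb h1
      have h3 := ratioSet_pos hN h1
      norm_num
      linarith

end GalDivisors

theorem mainTheorem4 :
    (∃ E : ℕ → ℝ,
      E =O[Filter.atTop]
        (fun N : ℕ => Real.log (Real.log (Real.log N)) / Real.log (Real.log N)) ∧
      ∀ᶠ N : ℕ in Filter.atTop,
        Real.log (gammaDiv N) =
          constB * Real.sqrt (Real.log N / Real.log (Real.log N)) * (1 + E N)) ∧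
    (∃ E : ℕ → ℝ,
      E =O[Filter.atTop]
        (fun N : ℕ => Real.log (Real.log (Real.log N)) / Real.log (Real.log N)) ∧
      ∀ᶠ N : ℕ in Filter.atTop,
        Real.log (gammaDivSqfree N) =
          2 / Real.sqrt (Real.log 2) * Real.sqrt (Real.log N / Real.log (Real.log N)) *
            (1 + E N)) := by
  constructor
  · refine GalDivisors.exists_relative_error (GalDivisors.isConst_univ.pos (Set.mem_univ 1)) rfl
      (GalDivisors.exists_abs_log_sub_le (fun _ _ _ _ _ => Set.mem_univ _) (Set.mem_univ 1)
        GalDivisors.isConst_univ fun N hN => GalDivisors.isLUB_gammaDiv hN)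
  · refine GalDivisors.exists_relative_error (GalDivisors.isConst_singleton.pos rfl) ?_
      (GalDivisors.exists_abs_log_sub_le (K := {1}) ?_ rfl
        GalDivisors.isConst_singleton fun N hN => GalDivisors.isLUB_gammaDivSqfree hN)
    · -- `4 √(1 / (4 log 2)) = 2 / √(log 2)`
      rw [Real.sqrt_div zero_le_one, Real.sqrt_one, Real.sqrt_mul (by norm_num),
        show (4 : ℝ) = 2 ^ 2 by norm_num, Real.sqrt_sq (by norm_num)]
      ring
    · rintro k hk j hj1 hj2
      rw [Set.mem_singleton_iff] at hk ⊢
      omega
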